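/- Fix an alphabet $\Sigma$. **Precubical sets.** A lo-set is a finite totally ordered (event order $\dashrightarrow$) $\Sigma$-labelled set; an ilo-set ${}_SU_T$ is a lo-set $U$ with subsets $S,T\subseteq U$ (source and target interface). A coface map $d_{A,B}:U\to V$ of lo-sets is an order and label preserving injection together with a partition $A\sqcup B$ of the complement of its image ($A$: unstarted, $B$: terminated events); for ilo-sets one also requires $S_U$, $T_U$ to be the preimages of $S_V$, $T_V$, and $A\cap S_V=\emptyset=B\cap T_V$. Up to isomorphism this gives small categories $\square$ (lo-sets) and $\mathrm{I}\square$ (ilo-sets). A precubical set (ipc-set) is a presheaf of sets on $\square$ (on $\mathrm{I}\square$), with face maps $\delta_{A,B}=X[d_{A,B}]$, $\delta^0_A=\delta_{A,\emptyset}$, $\delta^1_B=\delta_{\emptyset,B}$; elements of $X[U]$ are cells with events $U$. An HDA is a finite precubical set $X$ with sets $X_\bot$, $X^\top$ of start and accept cells; an iHDA is a finite ipc-set with such sets, where start cells $x\in X[{}_SU_T]$ have $S=U$ and accept cells have $T=U$. **Ipomsets.** A labelled iposet is a finite $\Sigma$-labelled set $P$ with strict partial orders $<$ (precedence) and $\dashrightarrow$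 (event order) such that any two distinct elements are comparable by $<$ or by $\dashrightarrow$, and subsets $S_P$ of $<$-minimal and $T_P$ of $<$-maximal elements. A subsumption $P\sqsubseteq Q$ is a label preserving bijection $f:P\to Q$ with $f(S_P)=S_Q$, $f(T_P)=T_Q$, such that $f(x)<f(y)$ implies $x<y$, and $x\dashrightarrow y$ for $<$-incomparable $x,y$ implies $f(x)\dashrightarrow f(y)$. An isomorphism is a subsumption that is an isomorphism for $<$; ipomsets are isomorphism classes. $P$ is interval if there are $b,e:P\to\mathbb R$ with $b\le e$ and $x<y\iff e(x)<b(y)$. If $T_P\simeq S_Q$ as lo-sets, $P*Q$ is the quotient of $P\sqcup Q$ that identifies $T_P$ with $S_Q$, with interfaces $S_P$, $T_Q$, event order the transitive closure of the union of the two event orders, and $x<y$ iff $x<_Py$, or $x<_Qy$, or $x\in P\setminus T_P$ and $y\in Q\setminus S_Q$. For sets $L,M$ of ipomsets, $L*M$ is the set of interval ipomsets $R$ with $R\sqsubseteq P*Q$ for some $P\in L$, $Q\in M$ with $T_P\simeq S_Q$. **Languages.** A path is a finite sequence of cells with steps that are up-steps from $\delta^0_A(x)$ to $x$, with ipomset ${}_{U\setminus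 A}U_U$ ($U$ the events of $x$), or down-steps from $x$ to $\delta^1_B(x)$, with ipomset ${}_UU_{U\setminus B}$. The ipomset $\mathrm{ev}(\alpha)$ of a path is the gluing of those of its steps (${}_UU_U$ for a path of length $0$ at a cell with events $U$). $\mathrm{Lang}(X)$ is the set of $\mathrm{ev}(\alpha)$ for paths $\alpha$ from a start cell to an accept cell. **Properness.** An iHDA is start (accept) simple if it has exactly one start (accept) cell, and simple if both. Its start (accept) map is the map from the disjoint union of the representable presheaves of the ilo-sets of its start (accept) cells to $X$ that is given by these cells. An injective map is an initial (final) inclusion if its image is down-closed (up-closed) for the reachability preorder ($x\preceq y$ iff there is a path from $x$ to $y$). $X$ is start proper if its start map is an initial inclusion, accept proper if its accept map is a final inclusion, and proper if it is both and the images of the two maps are disjoint. **Closure.** For an iHDA $X$, $\mathrm{Cl}(X)$ is the HDA with $\mathrm{Cl}(X)[U]$ the set of all $[x;A,B]$ with $x\in X[{}_SV_T]$, $A\subseteq S$, $B\subseteq T$, $A\cap B=\emptyset$, $U=V\setminus(A\cup B)$, with face maps $\delta_{C,D}[x;A,B]=[\delta_{C\setminus S,D\setminus T}(x);A\cup(C\cap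 S),B\cup(D\cap T)]$; its start (accept) cells are the $[x;\emptyset,\emptyset]$ with $x\in X_\bot$ ($x\in X^\top$). **Proposition.** Let $X_1,\dots,X_n$ ($n\ge1$) be iHDAs such that $X_1$ is accept simple and accept proper, $X_2,\dots,X_{n-1}$ are simple and proper, and $X_n$ is start simple and start proper. For $1\le k<n$ let $x^\top_k$ be the accept cell of $X_k$ and $x_\bot^{k+1}$ the start cell of $X_{k+1}$, and assume that both have the same lo-set $U_k$ of events. Let $X_1*\dots*X_n$ be the HDA whose precubical set is the colimit of $$\mathrm{Cl}(X_1)\leftarrow\square^{U_1}\to\mathrm{Cl}(X_2)\leftarrow\square^{U_2}\to\dots\leftarrow\square^{U_{n-1}}\to\mathrm{Cl}(X_n),$$ where $\square^{U_k}$ is the presheaf represented by $U_k$ and the maps from it are those given by the cells $[x^\top_k;\emptyset,\emptyset]$ and $[x^{k+1}_\bot;\emptyset,\emptyset]$, with the start cells of $\mathrm{Cl}(X_1)$ as start cells and the accept cells of $\mathrm{Cl}(X_n)$ as accept cells. Then $$\mathrm{Lang}(X_1*\dots*X_n)=\mathrm{Lang}(X_1)*\dots*\mathrm{Lang}(X_n).$$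 -/

import Mathlib

open CategoryTheory Opposite

universe u

namespace HDAGluing

/-! ### Lo-sets and the labelled precube categories -/

/-- An object of the (skeletal) labelled precube category: a lo-set up to isomorphism, that is,
a finite word over the alphabet. The event order is the order of `Fin len`. -/
structure LoSet (Alph : Type u) : Type u where
  len : ℕ
  lab : Fin len → Alph

/-- An object of the (skeletal) labelled precube category with interfaces: a lo-set with a source
interface `S` and a target interface `T`. -/
structure ILoSet (Alph : Type u) : Type u extends LoSet Alph where
  S : Set (Fin len)
  T : Set (Fin len)

variable {Alph : Type u}

/-- A coface map `d_{A,B} : U → V` of lo-sets: an order and label preserving injection whose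
missed events are split into unstarted ones (`A`) and terminated ones (`B`). -/
@[ext]
structure LoSet.Hom (U V : LoSet Alph) : Type u where
  emb : Fin U.len ↪o Fin V.len
  A : Set (Fin V.len)
  B : Set (Fin V.len)
  lab_emb : ∀ i, V.lab (emb i) = U.lab i
  disj : Disjoint A B
  union : A ∪ B = (Set.range emb)ᶜ

/-- A coface map of ilo-sets: a coface map of lo-sets such that the interfaces of `U` are the
preimages of those of `V`, no event of `S_V` is unstarted and no event of `T_V` is terminated. -/
@[ext]
structure ILoSet.Hom (U V : ILoSet Alph) : Type u extends LoSet.Hom U.toLoSet V.toLoSet where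
  S_pre : U.S = emb ⁻¹' V.S
  T_pre : U.T = emb ⁻¹' V.T
  A_S : Disjoint A V.S
  B_T : Disjoint B V.T

/-- The identity coface map. -/
def LoSet.Hom.id (U : LoSet Alph) : LoSet.Hom U U where
  emb := RelEmbedding.refl _
  A := ∅
  B := ∅
  lab_emb _ := rfl
  disj := by simp
  union := by ext; simp

/-- Composition of coface maps, `d_{C,D} ∘ d_{A,B}`, with unstarted events `d_{C,D}(A) ∪ C` and
terminated events `d_{C,D}(B) ∪ D`. -/
def LoSet.Hom.comp {U V W : LoSet Alph} (f : LoSet.Hom U V) (g : LoSet.Hom V W) :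
    LoSet.Hom U W where
  emb := f.emb.trans g.emb
  A := g.emb '' f.A ∪ g.A
  B := g.emb '' f.B ∪ g.B
  lab_emb i := by simp [f.lab_emb, g.lab_emb]
  disj := by
    have hg : ∀ x, x ∈ g.A ∪ g.B ↔ x ∉ Set.range g.emb := fun x => by rw [g.union]; rfl
    have hgd := Set.disjoint_left.1 g.disj
    have hfd := Set.disjoint_left.1 f.disj
    rw [Set.disjoint_left]
    rintro x (⟨y, hy, rfl⟩ | hx) (⟨z, hz, hzx⟩ | hx')
    · exact hfd hy (g.emb.injective hzx ▸ hz)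
    · exact (hg _).1 (Or.inr hx') ⟨y, rfl⟩
    · exact (hg _).1 (Or.inl hx) ⟨z, hzx⟩
    · exact hgd hx hx'
  union := by
    have hg : ∀ x, x ∈ g.A ∪ g.B ↔ x ∉ Set.range g.emb := fun x => by rw [g.union]; rfl
    have hf : ∀ x, x ∈ f.A ∪ f.B ↔ x ∉ Set.range f.emb := fun x => by rw [f.union]; rfl
    ext x
    constructor
    · rintro ((⟨y, hy, rfl⟩ | hx) | (⟨y, hy, rfl⟩ | hx)) ⟨i, hi⟩
      · exact (hf y).1 (Or.inl hy) ⟨i, g.emb.injective hi⟩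
      · exact (hg x).1 (Or.inl hx) ⟨f.emb i, hi⟩
      · exact (hf y).1 (Or.inr hy) ⟨i, g.emb.injective hi⟩
      · exact (hg x).1 (Or.inr hx) ⟨f.emb i, hi⟩
    · intro hx
      by_cases hxg : x ∈ Set.range g.emb
      · obtain ⟨y, rfl⟩ := hxg
        have : y ∉ Set.range f.emb := by
          rintro ⟨i, rfl⟩; exact hx ⟨i, rfl⟩
        rcases (hf y).2 this with h | h
        · exact Or.inl (Or.inl ⟨y, h, rfl⟩)
        · exact Or.inr (Or.inl ⟨y, h, rfl⟩)
      · rcases (hg x).2 hxg with h | h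
        · exact Or.inl (Or.inr h)
        · exact Or.inr (Or.inr h)

/-- The labelled precube category. -/
instance : SmallCategory (LoSet Alph) where
  Hom := LoSet.Hom
  id := LoSet.Hom.id
  comp := LoSet.Hom.comp
  id_comp f := by ext <;> simp [LoSet.Hom.comp, LoSet.Hom.id]
  comp_id f := by ext <;> simp [LoSet.Hom.comp, LoSet.Hom.id]
  assoc f g h := by
    apply LoSet.Hom.ext
    · rfl
    · simp [LoSet.Hom.comp, Set.image_union, Set.image_image, Set.union_assoc]
    · simp [LoSet.Hom.comp, Set.image_union, Set.image_image, Set.union_assoc]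

/-- The labelled precube category with interfaces. -/
instance : SmallCategory (ILoSet Alph) where
  Hom := ILoSet.Hom
  id U :=
    { LoSet.Hom.id U.toLoSet with
      S_pre := by ext; simp [LoSet.Hom.id]
      T_pre := by ext; simp [LoSet.Hom.id]
      A_S := by simp [LoSet.Hom.id]
      B_T := by simp [LoSet.Hom.id] }
  comp {U V W} f g :=
    { LoSet.Hom.comp f.toHom g.toHom with
      S_pre := by rw [f.S_pre, g.S_pre]; rfl
      T_pre := by rw [f.T_pre, g.T_pre]; rfl
      A_S := by
        have h1 := Set.disjoint_left.1 f.A_S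
        have h2 := Set.disjoint_left.1 g.A_S
        rw [Set.disjoint_left]
        rintro x (⟨y, hy, rfl⟩ | hx) hS
        · exact h1 hy (by rw [g.S_pre]; exact hS)
        · exact h2 hx hS
      B_T := by
        have h1 := Set.disjoint_left.1 f.B_T
        have h2 := Set.disjoint_left.1 g.B_T
        rw [Set.disjoint_left]
        rintro x (⟨y, hy, rfl⟩ | hx) hS
        · exact h1 hy (by rw [g.T_pre]; exact hS)
        · exact h2 hx hS }
  id_comp f := ILoSet.Hom.ext
    (congrArg LoSet.Hom.emb (Category.id_comp (obj := LoSet Alph) f.toHom))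
    (congrArg LoSet.Hom.A (Category.id_comp (obj := LoSet Alph) f.toHom))
    (congrArg LoSet.Hom.B (Category.id_comp (obj := LoSet Alph) f.toHom))
  comp_id f := ILoSet.Hom.ext
    (congrArg LoSet.Hom.emb (Category.comp_id (obj := LoSet Alph) f.toHom))
    (congrArg LoSet.Hom.A (Category.comp_id (obj := LoSet Alph) f.toHom))
    (congrArg LoSet.Hom.B (Category.comp_id (obj := LoSet Alph) f.toHom))
  assoc f g h := ILoSet.Hom.ext rfl
    (congrArg LoSet.Hom.A (Category.assoc (obj := LoSet Alph) f.toHom g.toHom h.toHom))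
    (congrArg LoSet.Hom.B (Category.assoc (obj := LoSet Alph) f.toHom g.toHom h.toHom))

/-- The functor that forgets the interfaces. -/
def forgetIface (Alph : Type u) : ILoSet Alph ⥤ LoSet Alph where
  obj U := U.toLoSet
  map f := f.toHom
  map_id _ := rfl
  map_comp _ _ := rfl

/-! ### (i)HDAs -/

section Presheaf

variable {C : Type u} [SmallCategory C]

/-- The cells of a presheaf. -/
abbrev Cells (X : Cᵒᵖ ⥤ Type u) : Type u := Σ U : C, X.obj (op U)

/-- Paths in a presheaf `X` over one of the two precube categories; `G` is the functor to lo-sets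
(`forgetIface` for ipc-sets, the identity for precubical sets). An up-step goes from
`δ⁰_A(y)` to `y`, a down-step from `x` to `δ¹_B(x)`. -/
inductive Path (G : C ⥤ LoSet Alph) (X : Cᵒᵖ ⥤ Type u) : Cells X → Cells X → Type u
  | nil (x : Cells X) : Path G X x x
  | up {x y z : Cells X} (d : x.1 ⟶ y.1) (hd : (G.map d).B = ∅)
      (hx : x.2 = X.map d.op y.2) (p : Path G X y z) : Path G X x z
  | down {x y z : Cells X} (d : y.1 ⟶ x.1) (hd : (G.map d).A = ∅)
      (hy : y.2 = X.map d.op x.2) (p : Path G X y z) : Path G X x z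

/-- The disjoint union of the standard cubes `□^{U i}`. -/
def sigmaCubes {ι : Type u} (U : ι → C) : Cᵒᵖ ⥤ Type u where
  obj W := Σ i, (W.unop ⟶ U i)
  map f := TypeCat.ofHom fun p => ⟨p.1, f.unop ≫ p.2⟩
  map_id W := by
    apply TypeCat.homEquiv.injective
    funext p
    exact Sigma.ext rfl (heq_of_eq (Category.id_comp p.2))
  map_comp f g := by
    apply TypeCat.homEquiv.injective
    funext p
    exact Sigma.ext rfl (heq_of_eq (Category.assoc g.unop f.unop p.2))

/-- The map from the disjoint union of the cubes `□^{ev(x)}`, `x ∈ s`, which on each summand is the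
Yoneda embedding of the cell `x`. -/
def cellsMap {X : Cᵒᵖ ⥤ Type u} (s : Set (Cells X)) :
    sigmaCubes (fun x : s => x.1.1) ⟶ X where
  app W := TypeCat.ofHom fun p => X.map p.2.op p.1.1.2
  naturality W W' f := by
    apply TypeCat.homEquiv.injective
    funext p
    exact Functor.map_comp_apply X p.2.op f p.1.1.2

/-- The image of a map of presheaves, as a set of cells. -/
def imageCells {Y X : Cᵒᵖ ⥤ Type u} (f : Y ⟶ X) : Set (Cells X) :=
  {x | ∃ y : Y.obj (op x.1), f.app (op x.1) y = x.2}

/-- Initial inclusions: injective maps with image down-closed for reachability. -/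
def IsInitialInclusion (G : C ⥤ LoSet Alph) {Y X : Cᵒᵖ ⥤ Type u} (f : Y ⟶ X) : Prop :=
  (∀ W, Function.Injective (f.app W)) ∧
    ∀ x y : Cells X, Nonempty (Path G X x y) → y ∈ imageCells f → x ∈ imageCells f

/-- Final inclusions: injective maps with image up-closed for reachability. -/
def IsFinalInclusion (G : C ⥤ LoSet Alph) {Y X : Cᵒᵖ ⥤ Type u} (f : Y ⟶ X) : Prop :=
  (∀ W, Function.Injective (f.app W)) ∧
    ∀ x y : Cells X, Nonempty (Path G X x y) → x ∈ imageCells f → y ∈ imageCells f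

end Presheaf

/-- Higher-dimensional automata: finite precubical sets with start and accept cells. -/
structure HDA (Alph : Type u) where
  cell : (LoSet Alph)ᵒᵖ ⥤ Type u
  finite : Finite (Cells cell)
  start : Set (Cells cell)
  accept : Set (Cells cell)

/-- Higher-dimensional automata with interfaces: finite ipc-sets with start and accept cells, such
that all events of a start cell are in its source interface and all events of an accept cell are in
its target interface. -/
structure IHDA (Alph : Type u) where
  cell : (ILoSet Alph)ᵒᵖ ⥤ Type u
  finite : Finite (Cells cell)
  start : Set (Cells cell)
  accept : Set (Cells cell)
  start_iface : ∀ x ∈ start, x.1.S = Set.univ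
  accept_iface : ∀ x ∈ accept, x.1.T = Set.univ

namespace IHDA

variable (X : IHDA Alph)

/-- Exactly one start cell. -/
def StartSimple : Prop := ∃ x, X.start = {x}

/-- Exactly one accept cell. -/
def AcceptSimple : Prop := ∃ x, X.accept = {x}

/-- Start simple and accept simple. -/
def Simple : Prop := X.StartSimple ∧ X.AcceptSimple

/-- The start map is an initial inclusion. -/
def StartProper : Prop := IsInitialInclusion (forgetIface Alph) (cellsMap X.start)

/-- The accept map is a final inclusion. -/
def AcceptProper : Prop := IsFinalInclusion (forgetIface Alph) (cellsMap X.accept)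

/-- Start proper, accept proper, and the images of the start and the accept map are disjoint. -/
def Proper : Prop :=
  X.StartProper ∧ X.AcceptProper ∧
    Disjoint (imageCells (cellsMap X.start)) (imageCells (cellsMap X.accept))

end IHDA

/-! ### Closure -/

/-- A factorisation of `m : U → F(V)` as `U → F(V') → F(V)`, where the second map comes from a
coface map `e` of ilo-sets, and the first one only inserts unstarted events in the source
interface and terminated events in the target interface of `V'`. -/
structure Factor {U : LoSet Alph} {V : ILoSet Alph} (m : U ⟶ V.toLoSet) where
  mid : ILoSet Alph
  e : mid ⟶ V
  d : U ⟶ mid.toLoSet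
  fac : d ≫ e.toHom = m
  hA : d.A ⊆ mid.S
  hB : d.B ⊆ mid.T

theorem Factor.e_A {U : LoSet Alph} {V : ILoSet Alph} {m : U ⟶ V.toLoSet} (f : Factor m) :
    f.e.A = m.A \ V.S := by
  have h : f.e.emb '' f.d.A ∪ f.e.A = m.A := congrArg LoSet.Hom.A f.fac
  have hS := Set.disjoint_left.1 f.e.A_S
  rw [← h]
  ext x
  constructor
  · intro hx
    exact ⟨Or.inr hx, hS hx⟩
  · rintro ⟨⟨y, hy, rfl⟩ | hx, hn⟩
    · exact absurd (by have := f.hA hy; rw [f.e.S_pre] at this; exact this) hn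
    · exact hx

theorem Factor.e_B {U : LoSet Alph} {V : ILoSet Alph} {m : U ⟶ V.toLoSet} (f : Factor m) :
    f.e.B = m.B \ V.T := by
  have h : f.e.emb '' f.d.B ∪ f.e.B = m.B := congrArg LoSet.Hom.B f.fac
  have hS := Set.disjoint_left.1 f.e.B_T
  rw [← h]
  ext x
  constructor
  · intro hx
    exact ⟨Or.inr hx, hS hx⟩
  · rintro ⟨⟨y, hy, rfl⟩ | hx, hn⟩
    · exact absurd (by have := f.hB hy; rw [f.e.T_pre] at this; exact this) hn
    · exact hx

theorem Factor.e_range {U : LoSet Alph} {V : ILoSet Alph} {m : U ⟶ V.toLoSet} (f : Factor m) :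
    Set.range f.e.emb = (m.A \ V.S ∪ m.B \ V.T)ᶜ := by
  rw [← f.e_A, ← f.e_B, f.e.union, compl_compl]

/-- Such a factorisation is unique. -/
theorem Factor.eq {U : LoSet Alph} {V : ILoSet Alph} {m : U ⟶ V.toLoSet} (f g : Factor m) :
    f = g := by
  have hr : Set.range f.e.emb = Set.range g.e.emb := by rw [f.e_range, g.e_range]
  have hA : f.e.A = g.e.A := by rw [f.e_A, g.e_A]
  have hB : f.e.B = g.e.B := by rw [f.e_B, g.e_B]
  obtain ⟨⟨⟨n₁, l₁⟩, S₁, T₁⟩, ⟨⟨e₁, A₁, B₁, lab₁, dj₁, un₁⟩, sp₁, tp₁, as₁, bt₁⟩,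
    ⟨d₁, dA₁, dB₁, dl₁, dd₁, du₁⟩, fac₁, hA₁, hB₁⟩ := f
  obtain ⟨⟨⟨n₂, l₂⟩, S₂, T₂⟩, ⟨⟨e₂, A₂, B₂, lab₂, dj₂, un₂⟩, sp₂, tp₂, as₂, bt₂⟩,
    ⟨d₂, dA₂, dB₂, dl₂, dd₂, du₂⟩, fac₂, hA₂, hB₂⟩ := g
  dsimp only at *
  subst hA hB
  have hn : n₁ = n₂ := by
    have h1 := Set.ncard_range_of_injective e₁.injective
    have h2 := Set.ncard_range_of_injective e₂.injective
    rw [hr] at h1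
    simpa using h1.symm.trans h2
  subst hn
  have he : e₁ = e₂ := OrderEmbedding.range_inj.1 hr
  subst he
  have hl : l₁ = l₂ := funext fun i => (lab₁ i).symm.trans (lab₂ i)
  subst hl
  have hS : S₁ = S₂ := sp₁.trans sp₂.symm
  have hT : T₁ = T₂ := tp₁.trans tp₂.symm
  subst hS hT
  have hfac := fac₁.trans fac₂.symm
  have h1 : d₁.trans e₁ = d₂.trans e₁ := congrArg LoSet.Hom.emb hfac
  have h2 : e₁ '' dA₁ ∪ A₁ = e₁ '' dA₂ ∪ A₁ := congrArg LoSet.Hom.A hfac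
  have h3 : e₁ '' dB₁ ∪ B₁ = e₁ '' dB₂ ∪ B₁ := congrArg LoSet.Hom.B hfac
  have hd : d₁ = d₂ := by
    ext i : 1
    exact e₁.injective (congrArg (fun k => k i) h1)
  have hnot : ∀ i, e₁ i ∉ A₁ ∪ B₁ := fun i hi => by rw [un₁] at hi; exact hi ⟨i, rfl⟩
  have key : ∀ (P Q R : Set _), (∀ i, e₁ i ∉ R) → e₁ '' P ∪ R = e₁ '' Q ∪ R → P = Q := by
    intro P Q R hR h
    ext i
    have := congrArg (fun s => e₁ i ∈ s) h
    simpa [hR i] using this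
  have hdA : dA₁ = dA₂ := key _ _ _ (fun i hi => hnot i (Or.inl hi)) h2
  have hdB : dB₁ = dB₂ := key _ _ _ (fun i hi => hnot i (Or.inr hi)) h3
  subst hd hdA hdB
  rfl

/-- The order embedding that enumerates a set of positions. -/
noncomputable def enumEmb {n : ℕ} (K : Set (Fin n)) : Fin K.ncard ↪o Fin n :=
  K.toFinite.toFinset.orderEmbOfFin (Set.ncard_eq_toFinset_card K).symm

theorem range_enumEmb {n : ℕ} (K : Set (Fin n)) : Set.range (enumEmb K) = K := by
  simp [enumEmb]

/-- The factorisation: `e` omits the unstarted events outside of `S_V` and the terminated events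
outside of `T_V`. -/
noncomputable def factor {U : LoSet Alph} {V : ILoSet Alph} (m : U ⟶ V.toLoSet) : Factor m :=
  have hm : m.A ∪ m.B = (Set.range m.emb)ᶜ := m.union
  let K : Set (Fin V.len) := (m.A \ V.S ∪ m.B \ V.T)ᶜ
  have hK : Set.range (enumEmb K) = K := range_enumEmb K
  have hmK : ∀ i, m.emb i ∈ Set.range (enumEmb K) := fun i => by
    have hn : m.emb i ∉ m.A ∪ m.B := by rw [hm]; exact fun h => h ⟨i, rfl⟩
    rw [hK]
    rintro (h | h)
    · exact hn (Or.inl h.1)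
    · exact hn (Or.inr h.1)
  have hsymm : ∀ i, enumEmb K ((enumEmb K).orderIso.symm ⟨m.emb i, hmK i⟩) = m.emb i := fun i =>
    congrArg Subtype.val ((enumEmb K).orderIso.apply_symm_apply ⟨m.emb i, hmK i⟩)
  { mid :=
      { len := K.ncard
        lab := fun i => V.lab (enumEmb K i)
        S := enumEmb K ⁻¹' V.S
        T := enumEmb K ⁻¹' V.T }
    e :=
      { emb := enumEmb K
        A := m.A \ V.S
        B := m.B \ V.T
        lab_emb := fun _ => rfl
        disj := m.disj.mono Set.sdiff_subset Set.sdiff_subset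
        union := by rw [hK, compl_compl]
        S_pre := rfl
        T_pre := rfl
        A_S := Set.disjoint_sdiff_left
        B_T := Set.disjoint_sdiff_left }
    d :=
      { emb := OrderEmbedding.ofMapLEIff
          (fun i => (enumEmb K).orderIso.symm ⟨m.emb i, hmK i⟩)
          (fun i j => by simp)
        A := enumEmb K ⁻¹' m.A
        B := enumEmb K ⁻¹' m.B
        lab_emb := fun i => (congrArg V.lab (hsymm i)).trans (m.lab_emb i)
        disj := m.disj.preimage _
        union := by
          rw [← Set.preimage_union, hm]
          ext j
          constructor
          · rintro h ⟨i, rfl⟩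
            exact h ⟨i, (hsymm i).symm⟩
          · rintro h ⟨i, hi⟩
            exact h ⟨i, (enumEmb K).injective ((hsymm i).trans hi)⟩ }
    fac := by
      apply LoSet.Hom.ext
      · ext i : 1
        exact hsymm i
      · change enumEmb K '' (enumEmb K ⁻¹' m.A) ∪ m.A \ V.S = m.A
        rw [Set.image_preimage_eq_inter_range, hK]
        ext x
        have : x ∈ m.A → x ∉ m.B := fun h => Set.disjoint_left.1 m.disj h
        simp only [K, Set.mem_union, Set.mem_inter_iff, Set.mem_compl_iff, Set.mem_sdiff]
        tauto
      · change enumEmb K '' (enumEmb K ⁻¹' m.B) ∪ m.B \ V.T = m.B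
        rw [Set.image_preimage_eq_inter_range, hK]
        ext x
        have : x ∈ m.A → x ∉ m.B := fun h => Set.disjoint_left.1 m.disj h
        simp only [K, Set.mem_union, Set.mem_inter_iff, Set.mem_compl_iff, Set.mem_sdiff]
        tauto
    hA := by
      intro i hi
      by_contra hS
      have h1 : enumEmb K i ∈ K := hK.subset ⟨i, rfl⟩
      exact h1 (Or.inl ⟨hi, hS⟩)
    hB := by
      intro i hi
      by_contra hS
      have h1 : enumEmb K i ∈ K := hK.subset ⟨i, rfl⟩
      exact h1 (Or.inr ⟨hi, hS⟩) }

/-- The cells `[x; A, B]` of `Cl(X)[U]`: a cell `x ∈ X[V]` and disjoint sets `A ⊆ S_V`,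
`B ⊆ T_V` such that `U = V ∖ (A ∪ B)`. The sets `A`, `B` and the identification of `U` with
`V ∖ (A ∪ B)` are given by a coface map `d = d_{A,B} : U → V` of lo-sets. -/
structure ClosureCell (X : (ILoSet Alph)ᵒᵖ ⥤ Type u) (U : LoSet Alph) : Type u where
  base : ILoSet Alph
  x : X.obj (op base)
  d : U ⟶ base.toLoSet
  hA : d.A ⊆ base.S
  hB : d.B ⊆ base.T

/-- The face of `[x; A, B]` obtained from a factorisation. -/
def ClosureCell.faceOf {X : (ILoSet Alph)ᵒᵖ ⥤ Type u} {U W : LoSet Alph} (c : ClosureCell X U)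
    {m : W ⟶ c.base.toLoSet} (f : Factor m) : ClosureCell X W :=
  ⟨f.mid, X.map f.e.op c.x, f.d, f.hA, f.hB⟩

/-- The face maps
`δ_{C,D}[x; A, B] = [δ_{C∖S,D∖T}(x); A ∪ (C ∩ S), B ∪ (D ∩ T)]` of the closure. -/
noncomputable def ClosureCell.face {X : (ILoSet Alph)ᵒᵖ ⥤ Type u} {U W : LoSet Alph}
    (c : ClosureCell X U) (g : W ⟶ U) : ClosureCell X W :=
  c.faceOf (factor (g ≫ c.d))

theorem ClosureCell.face_eq {X : (ILoSet Alph)ᵒᵖ ⥤ Type u} {U W : LoSet Alph}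
    (c : ClosureCell X U) (g : W ⟶ U) (f : Factor (g ≫ c.d)) : c.face g = c.faceOf f := by
  rw [Factor.eq f (factor (g ≫ c.d))]; rfl

/-- The closure of an ipc-set. -/
noncomputable def closurePresheaf (X : (ILoSet Alph)ᵒᵖ ⥤ Type u) : (LoSet Alph)ᵒᵖ ⥤ Type u where
  obj U := ClosureCell X U.unop
  map g := TypeCat.ofHom fun c => c.face g.unop
  map_id U := by
    ext c
    have h := c.face_eq (𝟙 _)
      ⟨c.base, 𝟙 _, c.d, by rw [Category.id_comp]; exact Category.comp_id c.d, c.hA, c.hB⟩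
    refine h.trans ?_
    simp [ClosureCell.faceOf]
  map_comp {U V W} g h := by
    ext c
    let f₁ := factor (g.unop ≫ c.d)
    let f₂ := factor (h.unop ≫ f₁.d)
    have key := c.face_eq (h.unop ≫ g.unop)
      ⟨f₂.mid, f₂.e ≫ f₁.e, f₂.d, by
        change f₂.d ≫ (f₂.e.toHom ≫ f₁.e.toHom : f₂.mid.toLoSet ⟶ c.base.toLoSet) = _
        rw [← Category.assoc, f₂.fac, Category.assoc, f₁.fac, Category.assoc], f₂.hA, f₂.hB⟩
    refine key.trans ?_
    simp [ClosureCell.face, ClosureCell.faceOf, f₁, f₂]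

/-- The cell `[x; ∅, ∅]` of the closure. -/
def closureCellOf {X : (ILoSet Alph)ᵒᵖ ⥤ Type u} {V : ILoSet Alph} (x : X.obj (op V)) :
    (closurePresheaf X).obj (op V.toLoSet) :=
  (⟨V, x, 𝟙 V.toLoSet, Set.empty_subset _, Set.empty_subset _⟩ : ClosureCell X V.toLoSet)

/-- Only finitely many coface maps end in a given lo-set. -/
theorem finite_homs (V : LoSet Alph) : Finite (Σ U : LoSet Alph, (U ⟶ V)) := by
  let φ : (Σ U : LoSet Alph, (U ⟶ V)) →
      (Σ m : Fin (V.len + 1), (Fin m → Fin V.len) × Set (Fin V.len) × Set (Fin V.len)) :=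
    fun p => ⟨⟨p.1.len, by
      have := Fintype.card_le_of_injective _ p.2.emb.injective
      simp at this
      omega⟩, p.2.emb, p.2.A, p.2.B⟩
  refine Finite.of_injective φ ?_
  rintro ⟨⟨n₁, l₁⟩, ⟨e₁, A₁, B₁, lab₁, _, _⟩⟩ ⟨⟨n₂, l₂⟩, ⟨e₂, A₂, B₂, lab₂, _, _⟩⟩ h
  dsimp only [φ] at h
  have hn : n₁ = n₂ := by
    have := congrArg (fun q => (q.1 : ℕ)) h
    exact this
  subst hn
  simp only [Sigma.mk.injEq, heq_eq_eq, Prod.mk.injEq, true_and] at h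
  obtain ⟨he, rfl, rfl⟩ := h
  have he' : e₁ = e₂ := DFunLike.coe_injective he
  subst he'
  have hl : l₁ = l₂ := funext fun i => (lab₁ i).symm.trans (lab₂ i)
  subst hl
  rfl

theorem finite_closure (X : (ILoSet Alph)ᵒᵖ ⥤ Type u) (hX : Finite (Cells X)) :
    Finite (Cells (closurePresheaf X)) := by
  have := hX
  have : ∀ c : Cells X, Finite (Σ U : LoSet Alph, (U ⟶ c.1.toLoSet)) := fun c =>
    finite_homs _
  let φ : Cells (closurePresheaf X) → Σ c : Cells X, Σ U : LoSet Alph, (U ⟶ c.1.toLoSet) :=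
    fun c => ⟨⟨ClosureCell.base c.2, ClosureCell.x c.2⟩, c.1, ClosureCell.d c.2⟩
  refine Finite.of_injective φ ?_
  rintro ⟨U₁, ⟨V₁, x₁, d₁, _, _⟩⟩ ⟨U₂, ⟨V₂, x₂, d₂, _, _⟩⟩ h
  simp only [φ, Sigma.mk.injEq] at h
  obtain ⟨⟨rfl, hx⟩, h⟩ := h
  cases hx
  simp only [heq_eq_eq, Sigma.mk.injEq] at h
  obtain ⟨rfl, h⟩ := h
  cases h
  rfl

/-- The closure of an iHDA; its start (accept) cells are the `[x; ∅, ∅]` with `x` a start (accept)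
cell. -/
noncomputable def IHDA.closure (X : IHDA Alph) : HDA Alph where
  cell := closurePresheaf X.cell
  finite := finite_closure X.cell X.finite
  start := (fun x => ⟨x.1.toLoSet, closureCellOf x.2⟩) '' X.start
  accept := (fun x => ⟨x.1.toLoSet, closureCellOf x.2⟩) '' X.accept

/-! ### Sequential gluing -/

section Gluing

variable {C : Type u} [SmallCategory C] {n : ℕ}
  (X : Fin (n + 1) → Cᵒᵖ ⥤ Type u) (Y : Fin n → Cᵒᵖ ⥤ Type u)
  (f : ∀ k : Fin n, Y k ⟶ X k.succ) (g : ∀ k : Fin n, Y k ⟶ X k.castSucc)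

/-- The identification of `g_k(y) ∈ X_k` with `f_k(y) ∈ X_{k+1}`. -/
inductive GlueStep (W : Cᵒᵖ) : (Σ k, (X k).obj W) → (Σ k, (X k).obj W) → Prop
  | mk (k : Fin n) (y : (Y k).obj W) :
      GlueStep W ⟨k.castSucc, (g k).app W y⟩ ⟨k.succ, (f k).app W y⟩

/-- The colimit of the zigzag `X_0 ← Y_0 → X_1 ← Y_1 → ⋯ ← Y_{n-1} → X_n`, computed pointwise as
a quotient of the disjoint union of the `X_k`. -/
def seqGluing : Cᵒᵖ ⥤ Type u where
  obj W := Quot (GlueStep X Y f g W)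
  map {W W'} h := TypeCat.ofHom (Quot.map (fun p => ⟨p.1, (X p.1).map h p.2⟩) (by
    rintro _ _ ⟨k, y⟩
    have h1 := NatTrans.naturality_apply (g k) h y
    have h2 := NatTrans.naturality_apply (f k) h y
    dsimp only
    rw [← h1, ← h2]
    exact GlueStep.mk k _))
  map_id W := by
    ext p
    induction p using Quot.ind
    simp [Quot.map]
  map_comp h h' := by
    ext p
    induction p using Quot.ind
    simp [Quot.map]

/-- The structural map `j_k`, on cells. -/
def seqGluingIncl (k : Fin (n + 1)) (x : Cells (X k)) : Cells (seqGluing X Y f g) :=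
  ⟨x.1, Quot.mk _ ⟨k, x.2⟩⟩

theorem finite_seqGluing (hX : ∀ k, Finite (Cells (X k))) :
    Finite (Cells (seqGluing X Y f g)) := by
  have := hX
  refine Finite.of_surjective
    (fun p : Σ k, Cells (X k) => seqGluingIncl X Y f g p.1 p.2) ?_
  rintro ⟨W, q⟩
  obtain ⟨⟨k, x⟩, rfl⟩ := Quot.exists_rep q
  exact ⟨⟨k, W, x⟩, rfl⟩

end Gluing

/-- The sequential composition of the iHDAs `X_0, …, X_n`: the sequential gluing of their closures
along the cubes `□^{U_k}`, which are mapped by the Yoneda embeddings of the accept cell `xacc k` of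
`X_k` and the start cell `xst k` of `X_{k+1}`. -/
noncomputable def seqComp {n : ℕ} (X : Fin (n + 1) → IHDA Alph) (U : Fin n → LoSet Alph)
    (S T : ∀ k, Set (Fin (U k).len))
    (xacc : ∀ k : Fin n, (X k.castSucc).cell.obj (op ⟨U k, S k, Set.univ⟩))
    (xst : ∀ k : Fin n, (X k.succ).cell.obj (op ⟨U k, Set.univ, T k⟩)) : HDA Alph :=
  let Z : Fin (n + 1) → (LoSet Alph)ᵒᵖ ⥤ Type u := fun k => (X k).closure.cell
  let Y : Fin n → (LoSet Alph)ᵒᵖ ⥤ Type u := fun k => yoneda.obj (U k)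
  let f : ∀ k : Fin n, Y k ⟶ Z k.succ := fun k => yonedaEquiv.symm (closureCellOf (xst k))
  let g : ∀ k : Fin n, Y k ⟶ Z k.castSucc := fun k => yonedaEquiv.symm (closureCellOf (xacc k))
  { cell := seqGluing Z Y f g
    finite := finite_seqGluing Z Y f g fun k => (X k).closure.finite
    start := seqGluingIncl Z Y f g 0 '' (X 0).closure.start
    accept := seqGluingIncl Z Y f g (Fin.last n) '' (X (Fin.last n)).closure.accept }

/-! ### Ipomsets -/

/-- A labelled iposet: precedence order `lt`, event order `ev`, source interface `S`, target
interface `T` and labelling `lab`. -/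
structure Iposet (Alph : Type u) where
  carrier : Type
  finite : Finite carrier
  lt : carrier → carrier → Prop
  ev : carrier → carrier → Prop
  lt_strict : IsStrictOrder carrier lt
  ev_strict : IsStrictOrder carrier ev
  total : ∀ x y, x = y ∨ lt x y ∨ lt y x ∨ ev x y ∨ ev y x
  S : Set carrier
  T : Set carrier
  S_min : ∀ s ∈ S, ∀ x, ¬ lt x s
  T_max : ∀ t ∈ T, ∀ x, ¬ lt t x
  lab : carrier → Alph

namespace Iposet

/-- Subsumptions: bijections which respect labels and interfaces, reflect precedence and preserve
the event order of concurrent events. -/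
structure IsSubsumption (P Q : Iposet Alph) (f : P.carrier ≃ Q.carrier) : Prop where
  lab : ∀ x, Q.lab (f x) = P.lab x
  S : f '' P.S = Q.S
  T : f '' P.T = Q.T
  lt : ∀ x y, Q.lt (f x) (f y) → P.lt x y
  ev : ∀ x y, P.ev x y → ¬ P.lt x y → ¬ P.lt y x → Q.ev (f x) (f y)

/-- `P ⊑ Q`. -/
def Subsumed (P Q : Iposet Alph) : Prop := ∃ f, IsSubsumption P Q f

/-- Isomorphisms: subsumptions which are isomorphisms for the precedence order. (The event order
between events ordered by precedence is irrelevant.) -/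
def Isomorphic (P Q : Iposet Alph) : Prop :=
  ∃ f, IsSubsumption P Q f ∧ ∀ x y, P.lt x y → Q.lt (f x) (f y)

theorem Isomorphic.refl (P : Iposet Alph) : Isomorphic P P :=
  ⟨Equiv.refl _, ⟨fun _ => rfl, by simp, by simp, fun _ _ h => h, fun _ _ h _ _ => h⟩,
    fun _ _ h => h⟩

theorem Isomorphic.symm {P Q : Iposet Alph} (h : Isomorphic P Q) : Isomorphic Q P := by
  obtain ⟨f, hf, hlt⟩ := h
  refine ⟨f.symm, ⟨fun x => ?_, ?_, ?_, fun x y h => ?_, fun x y h h1 h2 => ?_⟩, fun x y h => ?_⟩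
  · rw [← hf.lab, f.apply_symm_apply]
  · rw [← hf.S]; simp
  · rw [← hf.T]; simp
  · simpa using hlt _ _ h
  · have h1' : ¬ P.lt (f.symm x) (f.symm y) := fun h => h1 (by simpa using hlt _ _ h)
    have h2' : ¬ P.lt (f.symm y) (f.symm x) := fun h => h2 (by simpa using hlt _ _ h)
    have := Q.ev_strict
    rcases P.total (f.symm x) (f.symm y) with h3 | h3 | h3 | h3 | h3
    · rw [f.symm.injective h3] at h
      exact absurd h (irrefl_of Q.ev y)
    · exact absurd h3 h1'
    · exact absurd h3 h2'
    · exact h3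
    · have h4 := hf.ev _ _ h3 h2' h1'
      simp only [f.apply_symm_apply] at h4
      exact absurd (trans_of Q.ev h h4) (irrefl_of Q.ev x)
  · exact hf.lt _ _ (by simpa using h)

theorem Isomorphic.trans {P Q R : Iposet Alph} (h : Isomorphic P Q) (h' : Isomorphic Q R) :
    Isomorphic P R := by
  obtain ⟨f, hf, hlt⟩ := h
  obtain ⟨g, hg, hlt'⟩ := h'
  refine ⟨f.trans g, ⟨fun x => ?_, ?_, ?_, fun x y h => ?_, fun x y h h1 h2 => ?_⟩,
    fun x y h => hlt' _ _ (hlt _ _ h)⟩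
  · exact (hg.lab _).trans (hf.lab _)
  · rw [← hg.S, ← hf.S, Set.image_image]; rfl
  · rw [← hg.T, ← hf.T, Set.image_image]; rfl
  · exact hf.lt _ _ (hg.lt _ _ h)
  · exact hg.ev _ _ (hf.ev _ _ h h1 h2) (fun h => h1 (hf.lt _ _ h)) (fun h => h2 (hf.lt _ _ h))

instance setoid (Alph : Type u) : Setoid (Iposet Alph) where
  r := Isomorphic
  iseqv := ⟨Isomorphic.refl, Isomorphic.symm, Isomorphic.trans⟩

/-- Existence of an interval representation. -/
def IsInterval (P : Iposet Alph) : Prop :=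
  ∃ b e : P.carrier → ℝ, (∀ x, b x ≤ e x) ∧ ∀ x y, P.lt x y ↔ e x < b y

/-- An ilo-set as a discrete iposet. -/
def ofILoSet (V : ILoSet Alph) : Iposet Alph where
  carrier := Fin V.len
  finite := inferInstance
  lt _ _ := False
  ev i j := i < j
  lt_strict := { irrefl := fun _ h => h, trans := fun _ _ _ h _ => h }
  ev_strict := { irrefl := lt_irrefl, trans := fun _ _ _ => lt_trans }
  total i j := by
    rcases lt_trichotomy i j with h | h | h
    · exact Or.inr (Or.inr (Or.inr (Or.inl h)))
    · exact Or.inl h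
    · exact Or.inr (Or.inr (Or.inr (Or.inr h)))
  S := V.S
  T := V.T
  S_min _ _ _ h := h
  T_max _ _ _ h := h
  lab := V.lab

/-- A lo-isomorphism `T_P ≃ S_Q`. -/
structure Matching (P Q : Iposet Alph) where
  equiv : {p // p ∈ P.T} ≃ {q // q ∈ Q.S}
  ev_iff : ∀ a b, P.ev a.1 b.1 ↔ Q.ev (equiv a).1 (equiv b).1
  lab : ∀ a, Q.lab (equiv a).1 = P.lab a.1

section Glue

variable (P Q : Iposet Alph) (f : Matching P Q)

/-- The carrier of `P * Q`: the quotient of `P ⊔ Q` by `T_P ≃ S_Q`, represented as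
`P ⊔ (Q ∖ S_Q)`. -/
abbrev GlueCarrier : Type := P.carrier ⊕ {q : Q.carrier // q ∉ Q.S}

variable {P Q}

open Classical in
/-- The structural inclusion of `Q` in `P * Q`; the one of `P` is `Sum.inl`. -/
noncomputable def glueInr (q : Q.carrier) : GlueCarrier P Q :=
  if h : q ∈ Q.S then Sum.inl (f.equiv.symm ⟨q, h⟩).1 else Sum.inr ⟨q, h⟩

/-- The precedence order of `P * Q`. -/
inductive GlueLt : GlueCarrier P Q → GlueCarrier P Q → Prop
  | left {p p'} : P.lt p p' → GlueLt (Sum.inl p) (Sum.inl p')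
  | right {q q'} : Q.lt q q' → GlueLt (glueInr f q) (glueInr f q')
  | cross {p q} : p ∉ P.T → q ∉ Q.S → GlueLt (Sum.inl p) (glueInr f q)

/-- The union of the event orders of `P` and `Q`. -/
inductive GlueEvStep : GlueCarrier P Q → GlueCarrier P Q → Prop
  | left {p p'} : P.ev p p' → GlueEvStep (Sum.inl p) (Sum.inl p')
  | right {q q'} : Q.ev q q' → GlueEvStep (glueInr f q) (glueInr f q')

theorem glueInr_mem {q : Q.carrier} (h : q ∈ Q.S) :
    glueInr f q = Sum.inl (f.equiv.symm ⟨q, h⟩).1 := dif_pos h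

theorem glueInr_not_mem {q : Q.carrier} (h : q ∉ Q.S) :
    glueInr f q = Sum.inr ⟨q, h⟩ := dif_neg h

theorem glueInr_equiv (t : {p // p ∈ P.T}) : glueInr f (f.equiv t).1 = Sum.inl t.1 := by
  rw [glueInr_mem f (f.equiv t).2]
  simp

theorem glueInr_eq_inl {q : Q.carrier} {p : P.carrier} (h : glueInr f q = Sum.inl p) :
    ∃ t : {p // p ∈ P.T}, t.1 = p ∧ (f.equiv t).1 = q := by
  by_cases hq : q ∈ Q.S
  · rw [glueInr_mem f hq] at h
    exact ⟨f.equiv.symm ⟨q, hq⟩, Sum.inl.inj h, by simp⟩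
  · rw [glueInr_not_mem f hq] at h
    cases h

theorem glueInr_eq_inr {q : Q.carrier} {q' : {q : Q.carrier // q ∉ Q.S}}
    (h : glueInr f q = Sum.inr q') : q = q'.1 := by
  by_cases hq : q ∈ Q.S
  · rw [glueInr_mem f hq] at h
    cases h
  · rw [glueInr_not_mem f hq] at h
    cases h
    rfl

/-- Precedence in `P * Q`, case by case. -/
def GlueLt' : GlueCarrier P Q → GlueCarrier P Q → Prop
  | Sum.inl p, Sum.inl p' => P.lt p p'
  | Sum.inl p, Sum.inr q => p ∉ P.T ∨ ∃ t, t.1 = p ∧ Q.lt (f.equiv t).1 q.1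
  | Sum.inr _, Sum.inl _ => False
  | Sum.inr q, Sum.inr q' => Q.lt q.1 q'.1

theorem glueLt_iff (x y : GlueCarrier P Q) : GlueLt f x y ↔ GlueLt' f x y := by
  constructor
  · rintro (h | h | ⟨hp, hq⟩)
    · exact h
    · rename_i q q'
      have hq' : q' ∉ Q.S := fun hS => Q.S_min _ hS _ h
      rw [glueInr_not_mem f hq']
      by_cases hq : q ∈ Q.S
      · rw [glueInr_mem f hq]
        exact Or.inr ⟨f.equiv.symm ⟨q, hq⟩, rfl, by simpa using h⟩
      · rw [glueInr_not_mem f hq]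
        exact h
    · rw [glueInr_not_mem f hq]
      exact Or.inl hp
  · rcases x with p | q <;> rcases y with p' | q' <;> intro h
    · exact GlueLt.left h
    · rw [← glueInr_not_mem f q'.2]
      rcases h with h | ⟨t, rfl, h⟩
      · exact GlueLt.cross h q'.2
      · rw [← glueInr_equiv f t]
        exact GlueLt.right h
    · exact h.elim
    · rw [← glueInr_not_mem f q.2, ← glueInr_not_mem f q'.2]
      exact GlueLt.right h

theorem glueLt_strict : IsStrictOrder (GlueCarrier P Q) (GlueLt f) where
  irrefl x := by
    rw [glueLt_iff]
    have := P.lt_strict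
    have := Q.lt_strict
    rcases x with p | q
    · exact irrefl_of P.lt p
    · exact irrefl_of Q.lt q.1
  trans x y z := by
    simp only [glueLt_iff]
    have := P.lt_strict
    have := Q.lt_strict
    rcases x with p | q <;> rcases y with p' | q' <;> rcases z with p'' | q'' <;> intro h h'
    · exact trans_of P.lt h h'
    · exact Or.inl fun hT => P.T_max _ hT _ h
    · exact h'.elim
    · rcases h with h | ⟨t, rfl, h⟩
      · exact Or.inl h
      · exact Or.inr ⟨t, rfl, trans_of Q.lt h h'⟩
    · exact h.elim
    · exact h.elim
    · exact h'.elim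
    · exact trans_of Q.lt h h'

/-- The event order of `P * Q`, case by case. -/
def GlueEv' : GlueCarrier P Q → GlueCarrier P Q → Prop
  | Sum.inl p, Sum.inl p' => P.ev p p'
  | Sum.inl p, Sum.inr q => ∃ t, (p = t.1 ∨ P.ev p t.1) ∧ Q.ev (f.equiv t).1 q.1
  | Sum.inr q, Sum.inl p => ∃ t, Q.ev q.1 (f.equiv t).1 ∧ (t.1 = p ∨ P.ev t.1 p)
  | Sum.inr q, Sum.inr q' => Q.ev q.1 q'.1

theorem glueEv'_of_step {x y : GlueCarrier P Q} (h : GlueEvStep f x y) : GlueEv' f x y := by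
  rcases h with h | h
  · exact h
  · rename_i q q'
    by_cases hq : q ∈ Q.S <;> by_cases hq' : q' ∈ Q.S
    · rw [glueInr_mem f hq, glueInr_mem f hq']
      exact (f.ev_iff _ _).2 (by simpa using h)
    · rw [glueInr_mem f hq, glueInr_not_mem f hq']
      exact ⟨_, Or.inl rfl, by simpa using h⟩
    · rw [glueInr_not_mem f hq, glueInr_mem f hq']
      exact ⟨_, by simpa using h, Or.inl rfl⟩
    · rw [glueInr_not_mem f hq, glueInr_not_mem f hq']
      exact h

theorem glueEv'_trans {x y z : GlueCarrier P Q} (h : GlueEv' f x y) (h' : GlueEv' f y z) :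
    GlueEv' f x z := by
  have := P.ev_strict
  have := Q.ev_strict
  rcases x with p | q <;> rcases y with p' | q' <;> rcases z with p'' | q''
  · exact trans_of P.ev h h'
  · obtain ⟨t, rfl | ht, h'⟩ := h'
    · exact ⟨t, Or.inr h, h'⟩
    · exact ⟨t, Or.inr (trans_of P.ev h ht), h'⟩
  · obtain ⟨t, ht, h⟩ := h
    obtain ⟨t', h', ht'⟩ := h'
    have htt : P.ev t.1 t'.1 := (f.ev_iff t t').2 (trans_of Q.ev h h')
    have h1 : P.ev p t'.1 := by
      rcases ht with rfl | ht
      · exact htt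
      · exact trans_of P.ev ht htt
    rcases ht' with rfl | ht'
    · exact h1
    · exact trans_of P.ev h1 ht'
  · obtain ⟨t, ht, h⟩ := h
    exact ⟨t, ht, trans_of Q.ev h h'⟩
  · obtain ⟨t, h, ht⟩ := h
    refine ⟨t, h, Or.inr ?_⟩
    rcases ht with rfl | ht
    · exact h'
    · exact trans_of P.ev ht h'
  · obtain ⟨t, h, ht⟩ := h
    obtain ⟨t', ht', h'⟩ := h'
    have htt : t = t' ∨ P.ev t.1 t'.1 := by
      rcases ht with rfl | ht <;> rcases ht' with ht' | ht'
      · exact Or.inl (Subtype.ext ht')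
      · exact Or.inr ht'
      · exact Or.inr (ht' ▸ ht)
      · exact Or.inr (trans_of P.ev ht ht')
    rcases htt with rfl | htt
    · exact trans_of Q.ev h h'
    · exact trans_of Q.ev (trans_of Q.ev h ((f.ev_iff t t').1 htt)) h'
  · obtain ⟨t, h', ht⟩ := h'
    exact ⟨t, trans_of Q.ev h h', ht⟩
  · exact trans_of Q.ev h h'

theorem glueEv'_of_transGen {x y : GlueCarrier P Q}
    (h : Relation.TransGen (GlueEvStep f) x y) : GlueEv' f x y := by
  induction h with
  | single h => exact glueEv'_of_step f h
  | tail _ h ih => exact glueEv'_trans f ih (glueEv'_of_step f h)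

/-- The gluing composition `P * Q` of iposets with `T_P ≃ S_Q`. -/
noncomputable def glue : Iposet Alph where
  carrier := GlueCarrier P Q
  finite := by
    have := P.finite
    have := Q.finite
    infer_instance
  lt := GlueLt f
  ev := Relation.TransGen (GlueEvStep f)
  lt_strict := glueLt_strict f
  ev_strict :=
    { irrefl := fun x h => by
        have h' := glueEv'_of_transGen f h
        have := P.ev_strict
        have := Q.ev_strict
        rcases x with p | q
        · exact irrefl_of P.ev p h'
        · exact irrefl_of Q.ev q.1 h'
      trans := fun _ _ _ => Relation.TransGen.trans }
  total := by
    have hQ : ∀ q q' : Q.carrier, glueInr f q = glueInr f q' ∨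
        GlueLt f (glueInr f q) (glueInr f q') ∨ GlueLt f (glueInr f q') (glueInr f q) ∨
        Relation.TransGen (GlueEvStep f) (glueInr f q) (glueInr f q') ∨
        Relation.TransGen (GlueEvStep f) (glueInr f q') (glueInr f q) := by
      intro q q'
      rcases Q.total q q' with h | h | h | h | h
      · exact Or.inl (h ▸ rfl)
      · exact Or.inr (Or.inl (GlueLt.right h))
      · exact Or.inr (Or.inr (Or.inl (GlueLt.right h)))
      · exact Or.inr (Or.inr (Or.inr (Or.inl (.single (GlueEvStep.right h)))))
      · exact Or.inr (Or.inr (Or.inr (Or.inr (.single (GlueEvStep.right h)))))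
    rintro (p | q) (p' | q')
    · rcases P.total p p' with h | h | h | h | h
      · exact Or.inl (h ▸ rfl)
      · exact Or.inr (Or.inl (GlueLt.left h))
      · exact Or.inr (Or.inr (Or.inl (GlueLt.left h)))
      · exact Or.inr (Or.inr (Or.inr (Or.inl (.single (GlueEvStep.left h)))))
      · exact Or.inr (Or.inr (Or.inr (Or.inr (.single (GlueEvStep.left h)))))
    · rw [← glueInr_not_mem f q'.2]
      by_cases hp : p ∈ P.T
      · have := hQ (f.equiv ⟨p, hp⟩).1 q'.1
        rwa [glueInr_equiv] at this
      · exact Or.inr (Or.inl (GlueLt.cross hp q'.2))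
    · rw [← glueInr_not_mem f q.2]
      by_cases hp : p' ∈ P.T
      · have := hQ q.1 (f.equiv ⟨p', hp⟩).1
        rwa [glueInr_equiv] at this
      · exact Or.inr (Or.inr (Or.inl (GlueLt.cross hp q.2)))
    · have := hQ q.1 q'.1
      rwa [glueInr_not_mem f q.2, glueInr_not_mem f q'.2] at this
  S := Sum.inl '' P.S
  T := glueInr f '' Q.T
  S_min := by
    rintro _ ⟨s, hs, rfl⟩ x h
    rw [glueLt_iff] at h
    rcases x with p | q
    · exact P.S_min s hs p h
    · exact h
  T_max := by
    rintro _ ⟨t, ht, rfl⟩ x h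
    rw [glueLt_iff] at h
    by_cases hS : t ∈ Q.S
    · rw [glueInr_mem f hS] at h
      rcases x with p | q
      · exact P.T_max _ (f.equiv.symm ⟨t, hS⟩).2 _ h
      · rcases h with h | ⟨t', ht', h⟩
        · exact h (f.equiv.symm ⟨t, hS⟩).2
        · have h2 : f.equiv t' = ⟨t, hS⟩ := by rw [Subtype.ext ht']; simp
          rw [h2] at h
          exact Q.T_max t ht _ h
    · rw [glueInr_not_mem f hS] at h
      rcases x with p | q
      · exact h
      · exact Q.T_max t ht _ h
  lab := Sum.elim P.lab fun q => Q.lab q.1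

end Glue

end Iposet

/-- Ipomsets: isomorphism classes of labelled iposets. -/
def Ipomset (Alph : Type u) : Type (max 1 u) := Quotient (Iposet.setoid Alph)

/-- The gluing product of languages: the interval ipomsets subsumed by some `P * Q`, `P ∈ L`,
`Q ∈ M`, `T_P ≃ S_Q`. -/
def langMul (L M : Set (Ipomset Alph)) : Set (Ipomset Alph) :=
  {R | ∃ (P Q R' : Iposet Alph) (f : Iposet.Matching P Q),
    (Quotient.mk _ P : Ipomset Alph) ∈ L ∧ (Quotient.mk _ Q : Ipomset Alph) ∈ M ∧
    R = Quotient.mk _ R' ∧ R'.IsInterval ∧ R'.Subsumed (Iposet.glue f)}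

/-- The product `L_0 * ⋯ * L_n`. -/
def langProd : ∀ {n : ℕ}, (Fin (n + 1) → Set (Ipomset Alph)) → Set (Ipomset Alph)
  | 0, L => L 0
  | _ + 1, L => langMul (L 0) (langProd fun k => L k.succ)

/-! ### Ipomsets of paths and languages -/

/-- A lo-isomorphism from a lo-set to the source interface of an iposet. -/
structure SrcIso (U : LoSet Alph) (P : Iposet Alph) where
  equiv : Fin U.len ≃ {p // p ∈ P.S}
  ev_iff : ∀ i j, i < j ↔ P.ev (equiv i).1 (equiv j).1
  lab : ∀ i, P.lab (equiv i).1 = U.lab i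

/-- The ipomset `_U U_U`. -/
def idIposet (U : LoSet Alph) : Iposet Alph := .ofILoSet ⟨U, Set.univ, Set.univ⟩

/-- The ipomset `_{V∖A} V_V` of an up-step along `d⁰_A : U → V`. -/
def upIposet {U V : LoSet Alph} (d : U ⟶ V) : Iposet Alph :=
  .ofILoSet ⟨V, Set.range d.emb, Set.univ⟩

/-- The ipomset `_U U_{U∖B}` of a down-step along `d¹_B : V → U`. -/
def downIposet {U V : LoSet Alph} (d : V ⟶ U) : Iposet Alph :=
  .ofILoSet ⟨U, Set.univ, Set.range d.emb⟩

/-- The whole lo-set as source interface. -/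
def univSrc (U : LoSet Alph) (T : Set (Fin U.len)) :
    SrcIso U (.ofILoSet ⟨U, Set.univ, T⟩) where
  equiv := (Equiv.Set.univ _).symm
  ev_iff _ _ := Iff.rfl
  lab _ := rfl

/-- The source interface of the ipomset of an up-step. -/
noncomputable def upSrc {U V : LoSet Alph} (d : U ⟶ V) : SrcIso U (upIposet d) where
  equiv := d.emb.orderIso.toEquiv
  ev_iff _ _ := d.emb.lt_iff_lt.symm
  lab i := d.lab_emb i

/-- The target interface of an up-step matches a source interface isomorphic to `V`. -/
def upMatching {U V : LoSet Alph} (d : U ⟶ V) {Q : Iposet Alph} (s : SrcIso V Q) :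
    Iposet.Matching (upIposet d) Q where
  equiv := (Equiv.Set.univ _).trans s.equiv
  ev_iff _ _ := s.ev_iff _ _
  lab _ := s.lab _

/-- The target interface of a down-step matches a source interface isomorphic to `V`. -/
noncomputable def downMatching {U V : LoSet Alph} (d : V ⟶ U) {Q : Iposet Alph} (s : SrcIso V Q) :
    Iposet.Matching (downIposet d) Q where
  equiv := d.emb.orderIso.symm.toEquiv.trans s.equiv
  ev_iff a b :=
    (d.emb.orderIso.symm.lt_iff_lt (x := a) (y := b)).symm.trans (s.ev_iff _ _)
  lab a := (s.lab _).trans ((d.lab_emb _).symm.trans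
    (congrArg (fun x => U.lab x.1) (d.emb.orderIso.apply_symm_apply a)))

/-- The source interface of `P * Q` is that of `P`. -/
noncomputable def glueSrc {U : LoSet Alph} {P Q : Iposet Alph} (s : SrcIso U P)
    (f : Iposet.Matching P Q) : SrcIso U (Iposet.glue f) where
  equiv := s.equiv.trans (Equiv.Set.image Sum.inl P.S Sum.inl_injective)
  ev_iff i j :=
    ⟨fun h => .single (.left ((s.ev_iff i j).1 h)),
      fun h => (s.ev_iff i j).2 (Iposet.glueEv'_of_transGen f h)⟩
  lab i := s.lab i

section Language

variable {C : Type u} [SmallCategory C] (G : C ⥤ LoSet Alph) {X : Cᵒᵖ ⥤ Type u}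

/-- The ipomset `ev(α)` of a path `α`, the gluing of the ipomsets of its steps, with the
identification of its source interface with the events of the first cell. -/
noncomputable def evAux : {x y : Cells X} → Path G X x y →
    Σ P : Iposet Alph, SrcIso (G.obj x.1) P
  | _, _, .nil x => ⟨idIposet (G.obj x.1), univSrc _ _⟩
  | _, _, .up d _ _ p =>
      ⟨Iposet.glue (upMatching (G.map d) (evAux p).2),
        glueSrc (upSrc (G.map d)) (upMatching (G.map d) (evAux p).2)⟩
  | _, _, .down d _ _ p =>
      ⟨Iposet.glue (downMatching (G.map d) (evAux p).2),
        glueSrc (univSrc _ _) (downMatching (G.map d) (evAux p).2)⟩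

/-- The ipomset of a path. -/
noncomputable def pathEv {x y : Cells X} (p : Path G X x y) : Ipomset Alph :=
  Quotient.mk _ (evAux G p).1

/-- The ipomsets of the paths from a cell in `start` to a cell in `accept`. -/
def langOf (start accept : Set (Cells X)) : Set (Ipomset Alph) :=
  {P | ∃ x ∈ start, ∃ y ∈ accept, ∃ p : Path G X x y, pathEv G p = P}

end Language

/-- The language of an HDA. -/
def HDA.Lang (X : HDA Alph) : Set (Ipomset Alph) := langOf (𝟭 (LoSet Alph)) X.start X.accept

/-- The language of an iHDA. -/
def IHDA.Lang (X : IHDA Alph) : Set (Ipomset Alph) := langOf (forgetIface Alph) X.start X.accept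

end HDAGluing

/-!
Proof idea. By induction on `n` it suffices to glue one iHDA (the head) to a sequential composition
(the tail).

A path with ipomset `P` amounts to a consistent choice of a cell for every cut of `P`, that is,
for every set of events that are active together; this needs `P` to be interval, since the path
sweeps along an interval representation. Such choices for `P` in the head and for `Q` in the tail
combine to one for `P * Q`, which restricts along subsumptions `R ⊑ P * Q`. This gives `⊇`.

For `⊆`, follow a path of the composition. The cells `[z; A, B]` of the closure of the head are
replaced by `z`: the events of `A` are started as early, and those of `B` terminated as late, as
possible. The result is a path of the head to its accept cell followed by a path of the tail, and
the ipomset of the original path is subsumed by the gluing of theirs. Accept properness makes the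
cube of the accept cell closed upwards, so that a path never returns from the tail.
-/

namespace HDAGluing

variable {Alph : Type u}

namespace Iposet

theorem ev_irrefl (P : Iposet Alph) (x : P.carrier) : ¬ P.ev x x :=
  have := P.ev_strict
  irrefl_of P.ev x

theorem ev_trans (P : Iposet Alph) {x y z : P.carrier} (h : P.ev x y) (h' : P.ev y z) :
    P.ev x z :=
  have := P.ev_strict
  trans_of P.ev h h'

theorem lt_irrefl (P : Iposet Alph) (x : P.carrier) : ¬ P.lt x x :=
  have := P.lt_strict
  irrefl_of P.lt x

theorem lt_trans (P : Iposet Alph) {x y z : P.carrier} (h : P.lt x y) (h' : P.lt y z) :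
    P.lt x z :=
  have := P.lt_strict
  trans_of P.lt h h'

section Glue

variable {P Q : Iposet Alph} (f : Matching P Q)

theorem glueInr_injective : Function.Injective (glueInr f) := by
  intro q q' h
  by_cases hq : q' ∈ Q.S
  · rw [glueInr_mem f hq] at h
    obtain ⟨t, ht, rfl⟩ := glueInr_eq_inl f h
    rw [show t = f.equiv.symm ⟨q', hq⟩ from Subtype.ext ht, Equiv.apply_symm_apply]
  · rw [glueInr_not_mem f hq] at h
    exact glueInr_eq_inr f h

theorem exists_equiv_eq {q : Q.carrier} (hq : q ∈ Q.S) : ∃ t, (f.equiv t).1 = q :=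
  ⟨f.equiv.symm ⟨q, hq⟩, by rw [Equiv.apply_symm_apply]⟩

theorem glue_cases {motive : (glue f).carrier → Prop} (left : ∀ p ∉ P.T, motive (Sum.inl p))
    (right : ∀ q, motive (glueInr f q)) : ∀ x, motive x := by
  rintro (p | q)
  · by_cases hp : p ∈ P.T
    · exact glueInr_equiv f ⟨p, hp⟩ ▸ right _
    · exact left p hp
  · exact glueInr_not_mem f q.2 ▸ right q.1

theorem glue_cases₂ {motive : (glue f).carrier → (glue f).carrier → Prop}
    (left : ∀ p p', motive (Sum.inl p) (Sum.inl p'))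
    (right : ∀ q q', motive (glueInr f q) (glueInr f q'))
    (cross : ∀ p ∉ P.T, ∀ q ∉ Q.S, motive (Sum.inl p) (glueInr f q))
    (cross' : ∀ p ∉ P.T, ∀ q ∉ Q.S, motive (glueInr f q) (Sum.inl p)) : ∀ x y, motive x y := by
  rintro (p | q) (p' | q')
  · exact left p p'
  · rw [← glueInr_not_mem f q'.2]
    by_cases hp : p ∈ P.T
    · exact glueInr_equiv f ⟨p, hp⟩ ▸ right _ _
    · exact cross p hp q' q'.2
  · rw [← glueInr_not_mem f q.2]
    by_cases hp : p' ∈ P.T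
    · exact glueInr_equiv f ⟨p', hp⟩ ▸ right _ _
    · exact cross' p' hp q q.2
  · rw [← glueInr_not_mem f q.2, ← glueInr_not_mem f q'.2]
    exact right _ _

theorem glue_lab_glueInr (q : Q.carrier) : (glue f).lab (glueInr f q) = Q.lab q := by
  by_cases hq : q ∈ Q.S
  · obtain ⟨t, rfl⟩ := exists_equiv_eq f hq
    rw [glueInr_equiv]
    exact (f.lab t).symm
  · rw [glueInr_not_mem f hq]
    rfl

theorem glue_ev_glueInr_iff {q q' : Q.carrier} (h : q = q' ∨ Q.ev q q' ∨ Q.ev q' q) :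
    (glue f).ev (glueInr f q) (glueInr f q') ↔ Q.ev q q' := by
  refine ⟨fun h' => ?_, fun h' => .single (.right h')⟩
  rcases h with rfl | h | h
  · exact absurd h' ((glue f).ev_irrefl _)
  · exact h
  · exact absurd ((glue f).ev_trans h' (.single (.right h))) ((glue f).ev_irrefl _)

theorem inl_notMem_glue_T {p : P.carrier} (hp : p ∉ P.T) : Sum.inl p ∉ (glue f).T := by
  rintro ⟨q, -, h⟩
  obtain ⟨t, rfl, -⟩ := glueInr_eq_inl f h
  exact hp t.2

theorem glueInr_mem_glue_T {q : Q.carrier} : glueInr f q ∈ (glue f).T ↔ q ∈ Q.T :=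
  (glueInr_injective f).mem_set_image

theorem range_glueInr : Set.range (glueInr f) = (Sum.inl '' P.Tᶜ)ᶜ := by
  ext x
  induction x using glue_cases f with
  | left p hp =>
    refine iff_of_false ?_ (not_not_intro ⟨p, hp, rfl⟩)
    rintro ⟨q, hq⟩
    obtain ⟨t, rfl, -⟩ := glueInr_eq_inl f hq
    exact hp t.2
  | right q =>
    refine iff_of_true ⟨q, rfl⟩ ?_
    rintro ⟨p, hp, hq⟩
    obtain ⟨t, rfl, -⟩ := glueInr_eq_inl f hq.symm
    exact hp t.2

/-- The map on `P * Q` given by maps on `P` and on `Q` that agree on the common interface. -/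
def glueElim {α : Type*} (g : P.carrier → α) (h : Q.carrier → α) : (glue f).carrier → α :=
  Sum.elim g fun q => h q.1

theorem glueElim_glueInr {α : Type*} {g : P.carrier → α} {h : Q.carrier → α}
    (hgh : ∀ t, g t.1 = h (f.equiv t).1) (q : Q.carrier) :
    glueElim f g h (glueInr f q) = h q := by
  by_cases hq : q ∈ Q.S
  · obtain ⟨t, rfl⟩ := exists_equiv_eq f hq
    rw [glueInr_equiv]
    exact hgh t
  · rw [glueInr_not_mem f hq]
    rfl

end Glue

section Interval

theorem ofILoSet_interval (V : ILoSet Alph) : (ofILoSet V).IsInterval :=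
  ⟨fun _ => 0, fun _ => 0, fun _ => le_rfl, fun _ _ => by simp [ofILoSet]⟩

theorem exists_forall_lt_add {α β : Type*} [Finite α] [Finite β] (e : α → ℝ) (b : β → ℝ) :
    ∃ K, ∀ p q, e p < b q + K := by
  obtain ⟨K, hK⟩ := (Set.finite_range fun x : α × β => e x.1 - b x.2).bddAbove
  refine ⟨K + 1, fun p q => ?_⟩
  have : e p - b q ≤ K := hK ⟨(p, q), rfl⟩
  linarith

theorem glue_interval {P Q : Iposet Alph} (f : Matching P Q) (hP : P.IsInterval)
    (hQ : Q.IsInterval) : (glue f).IsInterval := by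
  obtain ⟨b, e, hbe, hlt⟩ := hP
  obtain ⟨b', e', hbe', hlt'⟩ := hQ
  have := P.finite
  have := Q.finite
  classical
  -- The events of `Q` are delayed until all events of `P` that are not in `P.T` have ended.
  obtain ⟨K, hK⟩ := exists_forall_lt_add e b'
  have hbK : ∀ p q, b p < e' q + K := fun p q => by linarith [hbe p, hK p q, hbe' q]
  let eK : P.carrier → ℝ := fun p => if h : p ∈ P.T then e' (f.equiv ⟨p, h⟩).1 + K else e p
  refine ⟨Sum.elim b fun q => b' q.1 + K, Sum.elim eK fun q => e' q.1 + K, ?_, fun x y => ?_⟩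
  · rintro (p | q)
    · by_cases hp : p ∈ P.T
      · simpa [eK, hp] using (hbK p _).le
      · simpa [eK, hp] using hbe p
    · simpa using hbe' q.1
  · refine (glueLt_iff f x y).trans ?_
    rcases x with p | q <;> rcases y with p' | q'
    · by_cases hp : p ∈ P.T
      · simpa [GlueLt', eK, hp, P.T_max p hp p'] using (hbK p' _).le
      · simpa [GlueLt', eK, hp] using hlt p p'
    · by_cases hp : p ∈ P.T
      · simpa [GlueLt', eK, hp] using hlt' (f.equiv ⟨p, hp⟩).1 q'
      · simpa [GlueLt', eK, hp] using hK p q'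
    · simpa [GlueLt'] using (hbK p' q).le
    · simpa [GlueLt'] using hlt' q q'

end Interval

section Refining

variable {P Q R : Iposet Alph}

/-- Injections that preserve labels and precedence and reflect the event order of concurrent
events; the bijective ones that match the interfaces are the inverses of subsumptions. -/
structure IsRefining (g : Q.carrier → R.carrier) : Prop where
  inj : Function.Injective g
  lab : ∀ q, R.lab (g q) = Q.lab q
  lt : ∀ a b, Q.lt a b → R.lt (g a) (g b)
  ev : ∀ a b, R.ev (g a) (g b) → ¬ R.lt (g a) (g b) → ¬ R.lt (g b) (g a) → Q.ev a b

theorem isRefining_glueInr (f : Matching P Q) : IsRefining (R := glue f) (glueInr f) where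
  inj := glueInr_injective f
  lab := glue_lab_glueInr f
  lt _ _ h := .right h
  ev a b h1 h2 h3 := by
    refine (glue_ev_glueInr_iff f ?_).1 h1
    rcases Q.total a b with h | h | h | h
    · exact Or.inl h
    · exact absurd (.right h) h2
    · exact absurd (.right h) h3
    · exact Or.inr h

theorem isRefining_inl (f : Matching P Q) : IsRefining (R := glue f) (Sum.inl : P.carrier → _) where
  inj := Sum.inl_injective
  lab _ := rfl
  lt _ _ h := .left h
  ev _ _ h1 _ _ := glueEv'_of_transGen f h1

variable {g : P.carrier → R.carrier} {h : Q.carrier → R.carrier}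

theorem IsRefining.glue (hg : IsRefining g) (hh : IsRefining h) (f : Matching P Q)
    (hgh : ∀ t, g t.1 = h (f.equiv t).1)
    (hcross : ∀ p ∉ P.T, ∀ q ∉ Q.S, R.lt (g p) (h q)) :
    IsRefining (Q := Iposet.glue f) (glueElim f g h) := by
  have hr := glueElim_glueInr f hgh
  refine ⟨fun x y => ?_, fun x => ?_, fun x y hxy => ?_, fun x y => ?_⟩
  · induction x, y using glue_cases₂ f with
    | left p p' => exact fun hpp' => congrArg Sum.inl (hg.inj hpp')
    | right q q' => rw [hr, hr]; exact fun hqq' => congrArg _ (hh.inj hqq')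
    | cross p hp q hq =>
      rw [hr]; exact fun hpq : g p = h q => absurd (hpq ▸ hcross p hp q hq) (R.lt_irrefl _)
    | cross' p hp q hq =>
      rw [hr]; exact fun hpq : h q = g p => absurd (hpq ▸ hcross p hp q hq) (R.lt_irrefl _)
  · induction x using glue_cases f with
    | left p => exact hg.lab p
    | right q => rw [hr, glue_lab_glueInr, hh.lab]
  · rcases hxy with hl | hl | ⟨hp, hq⟩
    · exact hg.lt _ _ hl
    · rw [hr, hr]; exact hh.lt _ _ hl
    · rw [hr]; exact hcross _ hp _ hq
  · induction x, y using glue_cases₂ f with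
    | left p p' => exact fun h1 h2 h3 => .single (.left (hg.ev p p' h1 h2 h3))
    | right q q' => rw [hr, hr]; exact fun h1 h2 h3 => .single (.right (hh.ev q q' h1 h2 h3))
    | cross p hp q hq => rw [hr]; exact fun _ h2 _ => absurd (hcross p hp q hq) h2
    | cross' p hp q hq => rw [hr]; exact fun _ _ h3 => absurd (hcross p hp q hq) h3

theorem glue_lt_of_glueElim_lt (f : Matching P Q) (hgh : ∀ t, g t.1 = h (f.equiv t).1)
    (hcross : ∀ p ∉ P.T, ∀ q ∉ Q.S, R.lt (g p) (h q))
    (hg : ∀ a b, R.lt (g a) (g b) → P.lt a b) (hh : ∀ a b, R.lt (h a) (h b) → Q.lt a b)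
    (x y : (glue f).carrier) (hxy : R.lt (glueElim f g h x) (glueElim f g h y)) :
    (glue f).lt x y := by
  have hr := glueElim_glueInr f hgh
  induction x, y using glue_cases₂ f with
  | left p p' => exact .left (hg p p' hxy)
  | right q q' =>
    rw [hr, hr] at hxy
    exact .right (hh q q' hxy)
  | cross p hp q hq => exact .cross hp hq
  | cross' p hp q hq =>
    rw [hr] at hxy
    exact absurd (R.lt_trans hxy (hcross p hp q hq)) (R.lt_irrefl _)

end Refining

section Segment

variable {P Q R : Iposet Alph} {strict : Prop} {g : Q.carrier → R.carrier}

/-- The map `g` presents `Q` as the part of `R` that is executed between two stages at which the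
events of `F`, respectively of `F'`, are not yet terminated. The flag `strict` says whether the
precedence order of `R` agrees with that of `Q` or merely refines it. -/
structure IsSegment (R : Iposet Alph) (strict : Prop) (Q : Iposet Alph)
    (g : Q.carrier → R.carrier) (F F' : Set R.carrier) : Prop extends IsRefining g where
  mem : ∀ q, g q ∈ F
  sub : F' ⊆ F
  cover : ∀ x ∈ F, x ∈ F' ∨ x ∈ Set.range g
  mem_iff : ∀ q, g q ∈ F' ↔ q ∈ Q.T
  cross : ∀ q ∉ Q.T, ∀ y ∈ F', y ∉ Set.range g → R.lt (g q) y
  lt_of_strict : strict → ∀ a b, R.lt (g a) (g b) → Q.lt a b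

theorem IsSegment.lt_cross {g : P.carrier → R.carrier} {h : Q.carrier → R.carrier}
    {F F' F'' : Set R.carrier} (hP : R.IsSegment strict P g F F')
    (hQ : R.IsSegment strict Q h F' F'') (f : Matching P Q)
    (hgh : ∀ t, g t.1 = h (f.equiv t).1) (p : P.carrier) (hp : p ∉ P.T) (q : Q.carrier)
    (hq : q ∉ Q.S) : R.lt (g p) (h q) := by
  refine hP.cross p hp _ (hQ.mem q) ?_
  rintro ⟨p', hp'⟩
  have hp'T : p' ∈ P.T := (hP.mem_iff p').1 (hp' ▸ hQ.mem q)
  obtain rfl := hQ.inj ((hgh ⟨p', hp'T⟩).symm.trans hp')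
  exact hq (f.equiv ⟨p', hp'T⟩).2

theorem IsSegment.glue {g : P.carrier → R.carrier} {h : Q.carrier → R.carrier}
    {F F' F'' : Set R.carrier} (hP : R.IsSegment strict P g F F')
    (hQ : R.IsSegment strict Q h F' F'') (f : Matching P Q)
    (hgh : ∀ t, g t.1 = h (f.equiv t).1) :
    R.IsSegment strict (Iposet.glue f) (glueElim f g h) F F'' := by
  have hr := glueElim_glueInr f hgh
  have hcross := hP.lt_cross hQ f hgh
  have hrange : ∀ y ∉ Set.range (glueElim f g h), y ∉ Set.range g ∧ y ∉ Set.range h :=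
    fun y hy => ⟨fun ⟨p, hp⟩ => hy ⟨Sum.inl p, hp⟩,
      fun ⟨q, hq⟩ => hy ⟨glueInr f q, (hr q).trans hq⟩⟩
  refine ⟨hP.toIsRefining.glue hQ.toIsRefining f hgh hcross, fun x => ?_, hQ.sub.trans hP.sub,
    fun x hx => ?_, fun x => ?_, fun x hx y hy hyr => ?_, fun hst =>
      glue_lt_of_glueElim_lt f hgh hcross (hP.lt_of_strict hst) (hQ.lt_of_strict hst)⟩
  · induction x using glue_cases f with
    | left p => exact hP.mem p
    | right q => exact hr q ▸ hP.sub (hQ.mem q)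
  · rcases hP.cover x hx with hx | ⟨p, hp⟩
    · rcases hQ.cover x hx with hx | ⟨q, hq⟩
      · exact Or.inl hx
      · exact Or.inr ⟨glueInr f q, (hr q).trans hq⟩
    · exact Or.inr ⟨Sum.inl p, hp⟩
  · induction x using glue_cases f with
    | left p hp =>
      exact iff_of_false (fun h => hp ((hP.mem_iff p).1 (hQ.sub h))) (inl_notMem_glue_T f hp)
    | right q => exact hr q ▸ (hQ.mem_iff q).trans (glueInr_mem_glue_T f).symm
  · induction x using glue_cases f with
    | left p hp => exact hP.cross p hp y (hQ.sub hy) (hrange y hyr).1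
    | right q =>
      rw [hr]
      exact hQ.cross q (fun hq => hx ((glueInr_mem_glue_T f).2 hq)) y hy (hrange y hyr).2

theorem IsSegment.subsumed (h : R.IsSegment strict Q g Set.univ R.T) (hS : g '' Q.S = R.S)
    (hT : R.T ⊆ Set.range g) :
    ∃ k, IsSubsumption R Q k ∧ (strict → ∀ x y, R.lt x y → Q.lt (k x) (k y)) := by
  have hb : Function.Bijective g :=
    ⟨h.inj, fun x => (h.cover x trivial).elim (fun hx => hT hx) id⟩
  obtain ⟨k, rfl⟩ : ∃ k : Q.carrier ≃ R.carrier, g = k := ⟨Equiv.ofBijective g hb, rfl⟩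
  have hkT : R.T = k '' Q.T := by
    ext x
    rw [← k.apply_symm_apply x, h.mem_iff, k.injective.mem_set_image]
  refine ⟨k.symm, ⟨fun x => ?_, ?_, ?_, fun x y hl => ?_, fun x y h1 h2 h3 => ?_⟩,
    fun hst x y hl => ?_⟩
  · rw [← h.lab, k.apply_symm_apply]
  · rw [← hS, k.symm_image_image]
  · rw [hkT, k.symm_image_image]
  · simpa using h.lt _ _ hl
  · apply h.ev <;> simpa
  · apply h.lt_of_strict hst; simpa

/-- A stage of an execution of `R`: the events of `F` are not yet terminated and `s` enumerates
the active ones, which carry the labels `lab`. The flag `strict` says whether active events are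
required to be pairwise incomparable for the precedence of `R`. -/
structure IsStage {ι : Type*} [LT ι] (R : Iposet Alph) (strict : Prop) (lab : ι → Alph)
    (F : Set R.carrier) (s : ι → R.carrier) : Prop where
  inj : Function.Injective s
  mem : ∀ i, s i ∈ F
  lab : ∀ i, R.lab (s i) = lab i
  ev : ∀ i j, R.ev (s i) (s j) → ¬ R.lt (s i) (s j) → ¬ R.lt (s j) (s i) → i < j
  anti : strict → ∀ i j, ¬ R.lt (s i) (s j)

theorem IsStage.comp_emb {ι κ : Type*} [Preorder ι] [Preorder κ] {lab : ι → Alph}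
    {lab' : κ → Alph} {F F' : Set R.carrier} {s : ι → R.carrier} (h : R.IsStage strict lab F s)
    (φ : κ ↪o ι) (hlab : ∀ k, lab (φ k) = lab' k) (hF : ∀ k, s (φ k) ∈ F') :
    R.IsStage strict lab' F' (s ∘ φ) where
  inj := h.inj.comp φ.injective
  mem := hF
  lab k := (h.lab _).trans (hlab k)
  ev _ _ h1 h2 h3 := φ.lt_iff_lt.1 (h.ev _ _ h1 h2 h3)
  anti hst _ _ := h.anti hst _ _

theorem IsStage.of_cover {ι κ₁ κ₂ : Type*} [Preorder ι] [Preorder κ₁] [Preorder κ₂]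
    {lab : ι → Alph} {F F₁ F₂ : Set R.carrier} {t : ι → R.carrier} (a : κ₁ ↪o ι) (b : κ₂ ↪o ι)
    (ha : R.IsStage False (lab ∘ a) F₁ (t ∘ a)) (hb : R.IsStage False (lab ∘ b) F₂ (t ∘ b))
    (hcover : ∀ i, i ∈ Set.range a ∨ i ∈ Set.range b)
    (hcross : ∀ l, b l ∉ Set.range a → ∀ k, a k ∈ Set.range b ∨ R.lt (t (b l)) (t (a k)))
    (hF : ∀ i, t i ∈ F) : R.IsStage False lab F t := by
  have hpair : ∀ i j, (∃ k l, a k = i ∧ a l = j) ∨ (∃ k l, b k = i ∧ b l = j) ∨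
      R.lt (t i) (t j) ∨ R.lt (t j) (t i) := by
    intro i j
    by_cases hi : i ∈ Set.range a <;> by_cases hj : j ∈ Set.range a
    · obtain ⟨⟨k, rfl⟩, l, rfl⟩ := And.intro hi hj
      exact .inl ⟨k, l, rfl, rfl⟩
    · obtain ⟨⟨k, rfl⟩, l, rfl⟩ := And.intro hi ((hcover j).resolve_left hj)
      exact .inr ((hcross l hj k).imp (fun ⟨m, hm⟩ => ⟨m, l, hm, rfl⟩) .inr)
    · obtain ⟨⟨k, rfl⟩, l, rfl⟩ := And.intro hj ((hcover i).resolve_left hi)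
      exact .inr ((hcross l hi k).imp (fun ⟨m, hm⟩ => ⟨l, m, rfl, hm⟩) .inl)
    · obtain ⟨⟨k, rfl⟩, l, rfl⟩ :=
        And.intro ((hcover i).resolve_left hi) ((hcover j).resolve_left hj)
      exact .inr (.inl ⟨k, l, rfl, rfl⟩)
  refine ⟨fun i j hij => ?_, hF, fun i => ?_, fun i j h h₁ h₂ => ?_, False.elim⟩
  · rcases hpair i j with ⟨k, l, rfl, rfl⟩ | ⟨k, l, rfl, rfl⟩ | h | h
    · exact congrArg a (ha.inj hij)
    · exact congrArg b (hb.inj hij)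
    · exact (R.lt_irrefl _ (hij ▸ h)).elim
    · exact (R.lt_irrefl _ (hij ▸ h)).elim
  · rcases hcover i with ⟨k, rfl⟩ | ⟨k, rfl⟩
    · exact ha.lab k
    · exact hb.lab k
  · rcases hpair i j with ⟨k, l, rfl, rfl⟩ | ⟨k, l, rfl, rfl⟩ | h' | h'
    · exact a.lt_iff_lt.2 (ha.ev k l h h₁ h₂)
    · exact b.lt_iff_lt.2 (hb.ev k l h h₁ h₂)
    · exact (h₁ h').elim
    · exact (h₂ h').elim

theorem IsStage.image {F : Set Q.carrier} {ι : Type*} [LT ι] {lab : ι → Alph}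
    {s : ι → Q.carrier} (hs : Q.IsStage False lab F s) (hg : IsRefining g) :
    R.IsStage False lab (g '' F) (g ∘ s) where
  inj := hg.inj.comp hs.inj
  mem i := ⟨_, hs.mem i, rfl⟩
  lab i := (hg.lab _).trans (hs.lab i)
  ev i j h1 h2 h3 :=
    hs.ev i j (hg.ev _ _ h1 h2 h3) (fun h => h2 (hg.lt _ _ h)) fun h => h3 (hg.lt _ _ h)
  anti h := h.elim

theorem IsStage.isSegment {U : LoSet Alph} {S T : Set (Fin U.len)}
    {F F' : Set R.carrier} {s : Fin U.len → R.carrier} (h : R.IsStage strict U.lab F s)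
    (hF : F' = F \ s '' Tᶜ) (hc : ∀ i ∉ T, ∀ y ∈ F, y ∉ Set.range s → R.lt (s i) y) :
    R.IsSegment strict (ofILoSet ⟨U, S, T⟩) s F F' := by
  subst hF
  have hT : ∀ i, s i ∈ F \ s '' Tᶜ ↔ i ∈ T := fun i => by
    rw [Set.mem_sdiff, h.inj.mem_set_image, Set.notMem_compl_iff, and_iff_right (h.mem i)]
  exact ⟨⟨h.inj, h.lab, fun _ _ => False.elim, h.ev⟩, h.mem, Set.sdiff_subset,
    fun x hx => or_iff_not_imp_right.2 fun hs => ⟨hx, fun h' => hs (Set.image_subset_range _ _ h')⟩,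
    hT, fun i hi y hy => hc i hi y hy.1, h.anti⟩

end Segment

end Iposet

theorem SrcIso.isStage {U : LoSet Alph} {P : Iposet Alph} (s : SrcIso U P) :
    P.IsStage False U.lab Set.univ fun i => (s.equiv i).1 where
  inj _ _ h := s.equiv.injective (Subtype.ext h)
  mem _ := trivial
  lab := s.lab
  ev i j h _ _ := (s.ev_iff i j).2 h
  anti h := h.elim

theorem SrcIso.range_equiv {U : LoSet Alph} {P : Iposet Alph} (s : SrcIso U P) :
    Set.range (fun i => (s.equiv i).1) = P.S := by
  rw [Set.range_comp' Subtype.val, s.equiv.range_eq_univ, Set.image_univ, Subtype.range_val]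

/-- A lo-isomorphism from a lo-set to the target interface of an iposet. -/
structure TgtIso (U : LoSet Alph) (P : Iposet Alph) where
  equiv : Fin U.len ≃ {p // p ∈ P.T}
  ev_iff : ∀ i j, i < j ↔ P.ev (equiv i).1 (equiv j).1
  lab : ∀ i, P.lab (equiv i).1 = U.lab i

/-- The matching of interfaces that are isomorphic to the same lo-set. -/
def matchingOfIso {U : LoSet Alph} {P Q : Iposet Alph} (t : TgtIso U P) (s : SrcIso U Q) :
    Iposet.Matching P Q where
  equiv := t.equiv.symm.trans s.equiv
  ev_iff a b := by
    have h1 := t.ev_iff (t.equiv.symm a) (t.equiv.symm b)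
    simp only [Equiv.apply_symm_apply] at h1
    exact h1.symm.trans (s.ev_iff _ _)
  lab a := by
    have h1 := t.lab (t.equiv.symm a)
    rw [Equiv.apply_symm_apply] at h1
    exact (s.lab _).trans h1.symm

/-- The target interface of `P * Q` is that of `Q`. -/
noncomputable def glueTgt {U : LoSet Alph} {P Q : Iposet Alph} (t : TgtIso U Q)
    (f : Iposet.Matching P Q) : TgtIso U (Iposet.glue f) where
  equiv := t.equiv.trans (Equiv.Set.image _ Q.T (Iposet.glueInr_injective f))
  ev_iff i j := by
    refine (t.ev_iff i j).trans (Iposet.glue_ev_glueInr_iff f ?_).symm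
    rw [← t.ev_iff, ← t.ev_iff, ← Subtype.ext_iff, t.equiv.injective.eq_iff, or_left_comm]
    exact lt_trichotomy i j
  lab i := (Iposet.glue_lab_glueInr f _).trans (t.lab i)

section Tracks

theorem glueInr_upMatching {U V : LoSet Alph} (d : U ⟶ V) {Q : Iposet Alph} (s : SrcIso V Q)
    (j : Fin V.len) : Iposet.glueInr (upMatching d s) (s.equiv j).1 = Sum.inl j :=
  Iposet.glueInr_equiv (upMatching d s) ⟨j, trivial⟩

theorem downMatching_equiv_emb {U V : LoSet Alph} (d : V ⟶ U) {Q : Iposet Alph} (s : SrcIso V Q)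
    (j : Fin V.len) : (downMatching d s).equiv ⟨d.emb j, j, rfl⟩ = s.equiv j :=
  congrArg s.equiv (d.emb.orderIso.symm_apply_apply j)

theorem glueInr_downMatching {U V : LoSet Alph} (d : V ⟶ U) {Q : Iposet Alph} (s : SrcIso V Q)
    (j : Fin V.len) : Iposet.glueInr (downMatching d s) (s.equiv j).1 = Sum.inl (d.emb j) := by
  rw [← downMatching_equiv_emb d s]
  exact Iposet.glueInr_equiv (downMatching d s) ⟨d.emb j, j, rfl⟩

variable {C : Type u} [SmallCategory C] (G : C ⥤ LoSet Alph) {X : Cᵒᵖ ⥤ Type u}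

/-- The target interface of the ipomset of a path. -/
noncomputable def evTgt : {x y : Cells X} → (p : Path G X x y) →
    TgtIso (G.obj y.1) (evAux G p).1
  | _, _, .nil _ => ⟨(Equiv.Set.univ _).symm, fun _ _ => Iff.rfl, fun _ => rfl⟩
  | _, _, .up _ _ _ p => glueTgt (evTgt p) _
  | _, _, .down _ _ _ p => glueTgt (evTgt p) _

theorem evAux_interval {x y : Cells X} (p : Path G X x y) : (evAux G p).1.IsInterval := by
  induction p with
  | nil => exact Iposet.ofILoSet_interval _
  | up _ _ _ _ ih => exact Iposet.glue_interval _ (Iposet.ofILoSet_interval _) ih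
  | down _ _ _ _ ih => exact Iposet.glue_interval _ (Iposet.ofILoSet_interval _) ih

/-- The path executes the part of `R` between the stages `(F, s)` and `(F', s')`. A down-step is
possible only if the terminated events precede every event that is not yet active. -/
def Tracks (R : Iposet Alph) (strict : Prop) : {x y : Cells X} → Path G X x y →
    (F : Set R.carrier) → (Fin (G.obj x.1).len → R.carrier) → (F' : Set R.carrier) →
    (Fin (G.obj y.1).len → R.carrier) → Prop
  | _, _, .nil x, F, s, F', s' => R.IsStage strict (G.obj x.1).lab F s ∧ F = F' ∧ s = s'
  | x, _, .up d _ _ p, F, s, F', s' => R.IsStage strict (G.obj x.1).lab F s ∧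
      ∃ s₁, s = s₁ ∘ (G.map d).emb ∧ Tracks R strict p F s₁ F' s'
  | x, _, .down d _ _ p, F, s, F', s' => R.IsStage strict (G.obj x.1).lab F s ∧
      (∀ i ∉ Set.range (G.map d).emb, ∀ y ∈ F, y ∉ Set.range s → R.lt (s i) y) ∧
      Tracks R strict p (F \ s '' (Set.range (G.map d).emb)ᶜ) (s ∘ (G.map d).emb) F' s'

variable {G} {R : Iposet Alph} {strict : Prop} {x y z : Cells X}

theorem Tracks.isStage {p : Path G X x y} {F F' : Set R.carrier}
    {s : Fin (G.obj x.1).len → R.carrier} {s' : Fin (G.obj y.1).len → R.carrier}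
    (h : Tracks G R strict p F s F' s') : R.IsStage strict (G.obj x.1).lab F s := by
  cases p <;> exact h.1

theorem Tracks.exists_isSegment {p : Path G X x y} {F F' : Set R.carrier}
    {s : Fin (G.obj x.1).len → R.carrier} {s' : Fin (G.obj y.1).len → R.carrier}
    (h : Tracks G R strict p F s F' s') :
    ∃ g, R.IsSegment strict (evAux G p).1 g F F' ∧
      (∀ i, g ((evAux G p).2.equiv i).1 = s i) ∧ ∀ i, g ((evTgt G p).equiv i).1 = s' i := by
  induction p generalizing F with
  | nil x =>
    obtain ⟨h, rfl, rfl⟩ := h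
    exact ⟨s, h.isSegment (by simp) (by simp), fun _ => rfl, fun _ => rfl⟩
  | up d _ _ p ih =>
    obtain ⟨-, s₁, rfl, hp⟩ := h
    obtain ⟨g, hg, hs, ht⟩ := ih hp
    have hm : ∀ t : {t // t ∈ (upIposet (G.map d)).T},
        s₁ t.1 = g ((upMatching (G.map d) (evAux G p).2).equiv t).1 := fun t => (hs t.1).symm
    exact ⟨Iposet.glueElim _ s₁ g,
      (Iposet.IsStage.isSegment hp.isStage (by simp) (by simp)).glue hg _ hm, fun _ => rfl,
      fun i => (Iposet.glueElim_glueInr _ hm _).trans (ht i)⟩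
  | down d _ _ p ih =>
    obtain ⟨h, hc, hp⟩ := h
    obtain ⟨g, hg, hs, ht⟩ := ih hp
    have hm : ∀ t : {t // t ∈ (downIposet (G.map d)).T},
        s t.1 = g ((downMatching (G.map d) (evAux G p).2).equiv t).1 := by
      rintro ⟨_, j, rfl⟩
      rw [downMatching_equiv_emb]
      exact (hs j).symm
    exact ⟨Iposet.glueElim _ s g, (h.isSegment rfl hc).glue hg _ hm, fun _ => rfl,
      fun i => (Iposet.glueElim_glueInr _ hm _).trans (ht i)⟩

theorem Tracks.image {R' : Iposet Alph} {h : R.carrier → R'.carrier} (hh : Iposet.IsRefining h)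
    {p : Path G X x y} {F F' : Set R.carrier} {s : Fin (G.obj x.1).len → R.carrier}
    {s' : Fin (G.obj y.1).len → R.carrier} (ht : Tracks G R False p F s F' s') :
    Tracks G R' False p (h '' F) (h ∘ s) (h '' F') (h ∘ s') := by
  induction p generalizing F with
  | nil x =>
    obtain ⟨hs, rfl, rfl⟩ := ht
    exact ⟨hs.image hh, rfl, rfl⟩
  | up d _ _ p ih =>
    obtain ⟨hs, s₁, rfl, hp⟩ := ht
    exact ⟨hs.image hh, _, rfl, ih hp⟩
  | down d _ _ p ih =>
    obtain ⟨hs, hc, hp⟩ := ht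
    refine ⟨hs.image hh, ?_, ?_⟩
    · rintro i hi _ ⟨y, hy, rfl⟩ hys
      exact hh.lt _ _ (hc i hi y hy fun ⟨j, hj⟩ => hys ⟨j, congrArg h hj⟩)
    · rw [Set.image_comp, ← Set.image_sdiff hh.inj]
      exact ih hp

theorem Tracks.glueInr {P Q : Iposet Alph} (f : Iposet.Matching P Q) {p : Path G X x y}
    {s : Fin (G.obj x.1).len → Q.carrier} {s' : Fin (G.obj y.1).len → Q.carrier}
    (h : Tracks G Q False p Set.univ s Q.T s') {F : Set (Iposet.glue f).carrier}
    {r : Fin (G.obj x.1).len → (Iposet.glue f).carrier} (hF : F = Set.range (Iposet.glueInr f))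
    (hr : ∀ i, Iposet.glueInr f (s i) = r i) :
    Tracks G (Iposet.glue f) False p F r (Iposet.glue f).T (Iposet.glueInr f ∘ s') := by
  obtain rfl : Iposet.glueInr f ∘ s = r := funext hr
  rw [hF, ← Set.image_univ]
  exact h.image (Iposet.isRefining_glueInr f)

theorem tracks_evAux (p : Path G X x y) :
    Tracks G (evAux G p).1 False p Set.univ (fun i => ((evAux G p).2.equiv i).1)
      (evAux G p).1.T (fun i => ((evTgt G p).equiv i).1) := by
  induction p with
  | nil x => exact ⟨(univSrc _ _).isStage, rfl, rfl⟩
  | up d _ _ p ih =>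
    refine ⟨SrcIso.isStage _, fun j => Sum.inl j, rfl, ih.glueInr _ ?_ (glueInr_upMatching _ _)⟩
    exact (Set.eq_univ_of_forall fun x => fun ⟨_, hp, _⟩ => hp trivial).symm.trans
      (Iposet.range_glueInr _).symm
  | down d _ _ p ih =>
    refine ⟨SrcIso.isStage _, ?_, ih.glueInr _ ?_ (glueInr_downMatching _ _)⟩
    · rintro i hi (j | q) - hq
      · exact absurd ⟨j, rfl⟩ hq
      · exact Iposet.glueInr_not_mem (downMatching (G.map d) (evAux G p).2) q.2 ▸ .cross hi q.2
    · exact (Set.compl_eq_univ_sdiff _).symm.trans (Iposet.range_glueInr _).symm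

/-- Concatenation of paths. -/
def Path.comp : {x y z : Cells X} → Path G X x y → Path G X y z → Path G X x z
  | _, _, _, .nil _, q => q
  | _, _, _, .up d hd hx p, q => .up d hd hx (p.comp q)
  | _, _, _, .down d hd hy p, q => .down d hd hy (p.comp q)

theorem Tracks.comp {p : Path G X x y} {q : Path G X y z} {F F' F'' : Set R.carrier}
    {s : Fin (G.obj x.1).len → R.carrier} {s' : Fin (G.obj y.1).len → R.carrier}
    {s'' : Fin (G.obj z.1).len → R.carrier} (hp : Tracks G R strict p F s F' s')
    (hq : Tracks G R strict q F' s' F'' s'') : Tracks G R strict (p.comp q) F s F'' s'' := by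
  induction p generalizing F with
  | nil =>
    obtain ⟨-, rfl, rfl⟩ := hp
    exact hq
  | up _ _ _ _ ih => exact ⟨hp.1, hp.2.imp fun _ hs => ⟨hs.1, ih hs.2 hq⟩⟩
  | down _ _ _ _ ih => exact ⟨hp.1, hp.2.1, ih hp.2.2 hq⟩

end Tracks

section CellMap

variable {C : Type u} [SmallCategory C] {G : C ⥤ LoSet Alph} {X : Cᵒᵖ ⥤ Type u}

variable (G X) in
/-- Morphisms over `G` from a presheaf on `C` to a precubical set, that is, maps from `X` to the
restriction of `Z` along `G`. -/
structure CellMap (Z : (LoSet Alph)ᵒᵖ ⥤ Type u) where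
  app : ∀ U : C, X.obj (op U) → Z.obj (op (G.obj U))
  naturality : ∀ {U V : C} (d : U ⟶ V) (x : X.obj (op V)),
    app U (X.map d.op x) = Z.map (G.map d).op (app V x)

namespace CellMap

variable {Z : (LoSet Alph)ᵒᵖ ⥤ Type u} (h : CellMap G X Z)

/-- The action of a morphism on cells. -/
def cell (x : Cells X) : Cells Z := ⟨G.obj x.1, h.app x.1 x.2⟩

/-- The action of a morphism on paths. -/
def path (h : CellMap G X Z) : {x y : Cells X} → Path G X x y →
    Path (𝟭 (LoSet Alph)) Z (h.cell x) (h.cell y)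
  | _, _, .nil x => .nil (h.cell x)
  | _, _, .up (x := x) (y := y) d hd hx p =>
      .up (x := h.cell x) (y := h.cell y) (G.map d) hd
        ((congrArg (h.app x.1) hx).trans (h.naturality d y.2)) (path h p)
  | _, _, .down (x := x) (y := y) d hd hy p =>
      .down (x := h.cell x) (y := h.cell y) (G.map d) hd
        ((congrArg (h.app y.1) hy).trans (h.naturality d x.2)) (path h p)

theorem evAux_path {x y : Cells X} (p : Path G X x y) :
    evAux (𝟭 (LoSet Alph)) (h.path p) = evAux G p := by
  induction p with
  | nil x => rfl
  | up d _ _ p ih =>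
    exact congrArg (fun e : Σ P : Iposet Alph, SrcIso _ P =>
      (⟨Iposet.glue (upMatching (G.map d) e.2), glueSrc (upSrc (G.map d)) _⟩ :
        Σ P : Iposet Alph, SrcIso _ P)) ih
  | down d _ _ p ih =>
    exact congrArg (fun e : Σ P : Iposet Alph, SrcIso _ P =>
      (⟨Iposet.glue (downMatching (G.map d) e.2), glueSrc (univSrc _ _) _⟩ :
        Σ P : Iposet Alph, SrcIso _ P)) ih

theorem pathEv_path {x y : Cells X} (p : Path G X x y) :
    pathEv (𝟭 (LoSet Alph)) (h.path p) = pathEv G p :=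
  congrArg (fun e => (Quotient.mk _ (Sigma.fst e) : Ipomset Alph)) (h.evAux_path p)

theorem tracks_path {R : Iposet Alph} {strict : Prop} {x y : Cells X} (p : Path G X x y)
    {F F' : Set R.carrier} {s : Fin (G.obj x.1).len → R.carrier}
    {s' : Fin (G.obj y.1).len → R.carrier} :
    Tracks (𝟭 (LoSet Alph)) R strict (h.path p) F s F' s' ↔ Tracks G R strict p F s F' s' := by
  induction p generalizing F with
  | nil => rfl
  | up _ _ _ _ ih => exact and_congr Iff.rfl (exists_congr fun s₁ => and_congr Iff.rfl ih)
  | down _ _ _ _ ih => exact and_congr Iff.rfl (and_congr Iff.rfl ih)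

end CellMap

end CellMap

theorem exists_equiv_fin_lt_iff {I : Type*} [Finite I] (r : I → I → Prop)
    [IsStrictTotalOrder I r] : ∃ n, ∃ e : Fin n ≃ I, ∀ i j, i < j ↔ r (e i) (e j) := by
  classical
  let _ : LinearOrder I := linearOrderOfSTO r
  let _ : Fintype I := Fintype.ofFinite I
  let e : Fin (Fintype.card I) ≃o I := Fintype.orderIsoFinOfCardEq I rfl
  exact ⟨_, e.toEquiv, fun _ _ => e.lt_iff_lt.symm⟩

namespace Iposet

/-- A cell with events `U` of the track object of `R`: the events of `R` are split into unstarted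
ones (`A`), active ones (enumerated by `emb`) and terminated ones (`B`). -/
@[ext]
structure Cut (R : Iposet Alph) (U : LoSet Alph) where
  emb : Fin U.len → R.carrier
  A : Set R.carrier
  B : Set R.carrier
  inj : Function.Injective emb
  lab : ∀ i, R.lab (emb i) = U.lab i
  ev : ∀ i j, i < j → R.ev (emb i) (emb j)
  disj : Disjoint A B
  union : A ∪ B = (Set.range emb)ᶜ
  cut : ∀ x y, R.lt x y → x ∈ B ∨ y ∈ A

namespace Cut

variable {P R : Iposet Alph} {U V : LoSet Alph}

section Basic

variable (c : Cut R U)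

theorem emb_notMem_A (i : Fin U.len) : c.emb i ∉ c.A :=
  fun h => (c.union ▸ Or.inl h : c.emb i ∈ (Set.range c.emb)ᶜ) ⟨i, rfl⟩

theorem emb_notMem_B (i : Fin U.len) : c.emb i ∉ c.B :=
  fun h => (c.union ▸ Or.inr h : c.emb i ∈ (Set.range c.emb)ᶜ) ⟨i, rfl⟩

theorem range_emb : Set.range c.emb = (c.A ∪ c.B)ᶜ := by
  rw [c.union, compl_compl]

theorem mem_range {x : R.carrier} (hA : x ∉ c.A) (hB : x ∉ c.B) : x ∈ Set.range c.emb := by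
  rw [c.range_emb]
  exact fun h => h.elim hA hB

theorem not_lt (i j : Fin U.len) : ¬ R.lt (c.emb i) (c.emb j) := fun h =>
  (c.cut _ _ h).elim (c.emb_notMem_B i) (c.emb_notMem_A j)

theorem lt_of_ev {i j : Fin U.len} (h : R.ev (c.emb i) (c.emb j)) : i < j := by
  rcases lt_trichotomy i j with h' | rfl | h'
  · exact h'
  · exact absurd h (R.ev_irrefl _)
  · exact absurd (R.ev_trans h (c.ev _ _ h')) (R.ev_irrefl _)

theorem isStage (strict : Prop) : R.IsStage strict U.lab c.Bᶜ c.emb where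
  inj := c.inj
  mem := c.emb_notMem_B
  lab := c.lab
  ev _ _ h _ _ := c.lt_of_ev h
  anti _ := c.not_lt

theorem image_preimage_union_A {A' : Set R.carrier} (h : c.A ⊆ A') (h' : Disjoint A' c.B) :
    c.emb '' (c.emb ⁻¹' A') ∪ c.A = A' := by
  rw [Set.image_preimage_eq_inter_range, c.range_emb]
  ext x
  have := @h x
  have := @Set.disjoint_left.1 h' x
  simp only [Set.mem_union, Set.mem_inter_iff, Set.mem_compl_iff]
  tauto

theorem image_preimage_union_B {B' : Set R.carrier} (h : c.B ⊆ B') (h' : Disjoint c.A B') :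
    c.emb '' (c.emb ⁻¹' B') ∪ c.B = B' := by
  rw [Set.image_preimage_eq_inter_range, c.range_emb]
  ext x
  have := @h x
  have := @Set.disjoint_right.1 h' x
  simp only [Set.mem_union, Set.mem_inter_iff, Set.mem_compl_iff]
  tauto

end Basic

section Face

/-- The faces of a cell of a track object. -/
def face (c : Cut R V) (d : U ⟶ V) : Cut R U where
  emb := c.emb ∘ d.emb
  A := c.emb '' d.A ∪ c.A
  B := c.emb '' d.B ∪ c.B
  inj := c.inj.comp d.emb.injective
  lab i := (c.lab _).trans (d.lab_emb i)
  ev i j h := c.ev _ _ (d.emb.lt_iff_lt.2 h)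
  disj := by
    simp only [Set.disjoint_union_left, Set.disjoint_union_right]
    refine ⟨⟨(Set.disjoint_image_iff c.inj).2 d.disj, ?_⟩, ?_, c.disj⟩
    · rw [Set.disjoint_left]
      rintro _ hx ⟨i, -, rfl⟩
      exact c.emb_notMem_A i hx
    · rw [Set.disjoint_left]
      rintro _ ⟨i, -, rfl⟩
      exact c.emb_notMem_B i
  union := by
    rw [Set.union_union_union_comm, ← Set.image_union, d.union, c.union, Set.range_comp,
      c.inj.compl_image_eq]
  cut x y h := (c.cut x y h).imp Or.inr Or.inr

variable (c : Cut R V) (d : U ⟶ V)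

theorem emb_mem_face_A {i : Fin V.len} : c.emb i ∈ (c.face d).A ↔ i ∈ d.A :=
  (or_iff_left (c.emb_notMem_A i)).trans c.inj.mem_set_image

theorem emb_mem_face_B {i : Fin V.len} : c.emb i ∈ (c.face d).B ↔ i ∈ d.B :=
  (or_iff_left (c.emb_notMem_B i)).trans c.inj.mem_set_image

theorem A_eq_empty_of_face_A_eq (h : (c.face d).A = c.A) : d.A = ∅ :=
  Set.eq_empty_of_forall_notMem fun i hi => c.emb_notMem_A i (h ▸ (c.emb_mem_face_A d).2 hi)

theorem B_eq_empty_of_face_B_eq (h : (c.face d).B = c.B) : d.B = ∅ :=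
  Set.eq_empty_of_forall_notMem fun i hi => c.emb_notMem_B i (h ▸ (c.emb_mem_face_B d).2 hi)

theorem compl_face_B (h : d.A = ∅) : (c.face d).Bᶜ = c.Bᶜ \ c.emb '' (Set.range d.emb)ᶜ := by
  rw [← d.union, h, Set.empty_union, Set.sdiff_eq, Set.inter_comm]
  exact Set.compl_union _ _

theorem exists_eq_face (c' : Cut R U) (hA : c.A ⊆ c'.A) (hB : c.B ⊆ c'.B) :
    ∃ d : U ⟶ V, c' = c.face d := by
  have h : ∀ i, ∃ j, c.emb j = c'.emb i := fun i =>
    c.mem_range (fun h => c'.emb_notMem_A i (hA h)) fun h => c'.emb_notMem_B i (hB h)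
  choose k hk using h
  have hmono : StrictMono k := fun i j hij => c.lt_of_ev (by rw [hk, hk]; exact c'.ev i j hij)
  have hrange : c.emb ⁻¹' Set.range c'.emb = Set.range k := by
    rw [← funext hk, Set.range_comp' c.emb k, c.inj.preimage_image]
  refine ⟨{ emb := OrderEmbedding.ofStrictMono k hmono
            A := c.emb ⁻¹' c'.A
            B := c.emb ⁻¹' c'.B
            lab_emb := fun i => ?_
            disj := c'.disj.preimage _
            union := ?_ }, ?_⟩
  · rw [← c.lab]
    exact (congrArg R.lab (hk i)).trans (c'.lab i)
  · rw [← Set.preimage_union, c'.union, Set.preimage_compl, hrange]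
    rfl
  · exact Cut.ext (funext fun i => (hk i).symm)
      (c.image_preimage_union_A hA (c'.disj.mono_right hB)).symm
      (c.image_preimage_union_B hB (c'.disj.mono_left hA)).symm

end Face

theorem exists_of_disjoint {A B : Set R.carrier} (disj : Disjoint A B)
    (cut : ∀ x y, R.lt x y → x ∈ B ∨ y ∈ A) : ∃ U, ∃ c : Cut R U, c.A = A ∧ c.B = B := by
  have := R.finite
  let I := {x : R.carrier // x ∈ (A ∪ B)ᶜ}
  have hlt : ∀ x y : I, ¬ R.lt x.1 y.1 := fun x y h =>
    (cut _ _ h).elim (fun h => x.2 (Or.inr h)) fun h => y.2 (Or.inl h)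
  have : IsStrictTotalOrder I fun x y => R.ev x.1 y.1 :=
    { irrefl := fun x => R.ev_irrefl x.1
      trans := fun _ _ _ => R.ev_trans
      trichotomous := fun x y h1 h2 => by
        rcases R.total x.1 y.1 with h | h | h | h | h
        · exact Subtype.ext h
        · exact absurd h (hlt _ _)
        · exact absurd h (hlt _ _)
        · exact absurd h h1
        · exact absurd h h2 }
  obtain ⟨n, e, he⟩ := exists_equiv_fin_lt_iff fun x y : I => R.ev x.1 y.1
  exact ⟨⟨n, fun i => R.lab (e i).1⟩,
    { emb := fun i => (e i).1
      A := A
      B := B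
      inj := Subtype.val_injective.comp e.injective
      lab := fun _ => rfl
      ev := fun i j => (he i j).1
      disj := disj
      union := by
        rw [Set.range_comp' Subtype.val e, e.range_eq_univ, Set.image_univ, Subtype.range_val]
        exact (compl_compl _).symm
      cut := cut }, rfl, rfl⟩

section Restrict

variable {k : P.carrier → R.carrier} (hk : IsRefining k)

/-- The restriction of a cell of a track object to a part that contains all active events. -/
noncomputable def restrict (c : Cut R U) (h : ∀ i, ∃ p, k p = c.emb i) : Cut P U where
  emb i := (h i).choose
  A := k ⁻¹' c.A
  B := k ⁻¹' c.B
  inj i j hij := c.inj ((h i).choose_spec.symm.trans ((congrArg k hij).trans (h j).choose_spec))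
  lab i := by rw [← hk.lab, (h i).choose_spec, c.lab]
  ev i j hij := by
    have h1 := c.ev i j hij
    have h2 := c.not_lt i j
    have h3 := c.not_lt j i
    rw [← (h i).choose_spec, ← (h j).choose_spec] at h1 h2 h3
    exact hk.ev _ _ h1 h2 h3
  disj := c.disj.preimage _
  union := by
    have hrange : Set.range c.emb = k '' Set.range fun i => (h i).choose := by
      rw [← Set.range_comp]
      exact congrArg Set.range (funext fun i => (h i).choose_spec.symm)
    rw [← Set.preimage_union, c.union, Set.preimage_compl, hrange, hk.inj.preimage_image]
  cut x y hxy := c.cut _ _ (hk.lt x y hxy)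

theorem restrict_emb (c : Cut R U) (h : ∀ i, ∃ p, k p = c.emb i) (i : Fin U.len) :
    k ((c.restrict hk h).emb i) = c.emb i := (h i).choose_spec

theorem restrict_face (c : Cut R V) (h : ∀ i, ∃ p, k p = c.emb i) (d : U ⟶ V) :
    (c.face d).restrict hk (fun i => h (d.emb i)) = (c.restrict hk h).face d := by
  have key (s t) : k ⁻¹' (c.emb '' s ∪ t) = (c.restrict hk h).emb '' s ∪ k ⁻¹' t := by
    have himage : c.emb '' s = k '' ((c.restrict hk h).emb '' s) := by
      rw [← Set.image_comp]
      exact congrArg (· '' s) (funext (c.restrict_emb hk h)).symm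
    rw [Set.preimage_union, himage, hk.inj.preimage_image]
  exact Cut.ext rfl (key _ _) (key _ _)

end Restrict

section Map

variable {f : P.carrier ≃ R.carrier} (hf : IsSubsumption P R f)

/-- The image of a cell of a track object under a subsumption. -/
def map (c : Cut P U) : Cut R U where
  emb := f ∘ c.emb
  A := f '' c.A
  B := f '' c.B
  inj := f.injective.comp c.inj
  lab i := (hf.lab _).trans (c.lab i)
  ev i j hij := hf.ev _ _ (c.ev i j hij) (c.not_lt i j) (c.not_lt j i)
  disj := (Set.disjoint_image_iff f.injective).2 c.disj
  union := by
    rw [← Set.image_union, c.union, Set.range_comp, Set.image_compl_eq f.bijective]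
  cut x y h := by
    simpa using c.cut (f.symm x) (f.symm y) (hf.lt _ _ (by simpa using h))

/-- The inverse image under a subsumption of a cell of a track object. -/
def comap (c : Cut R U) (h : ∀ x y, P.lt x y → f x ∈ c.B ∨ f y ∈ c.A) : Cut P U where
  emb := f.symm ∘ c.emb
  A := f ⁻¹' c.A
  B := f ⁻¹' c.B
  inj := f.symm.injective.comp c.inj
  lab i := by rw [← c.lab i, ← hf.lab]; simp
  ev i j hij := by
    have hlt : ∀ i j, ¬ P.lt (f.symm (c.emb i)) (f.symm (c.emb j)) := fun i j hl => by
      have := h _ _ hl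
      rw [f.apply_symm_apply, f.apply_symm_apply] at this
      exact this.elim (c.emb_notMem_B i) (c.emb_notMem_A j)
    rcases P.total (f.symm (c.emb i)) (f.symm (c.emb j)) with h' | h' | h' | h' | h'
    · exact absurd (c.inj (f.symm.injective h')) hij.ne
    · exact absurd h' (hlt _ _)
    · exact absurd h' (hlt _ _)
    · exact h'
    · have := hf.ev _ _ h' (hlt _ _) (hlt _ _)
      simp only [f.apply_symm_apply] at this
      exact absurd (c.lt_of_ev this) hij.not_gt
  disj := c.disj.preimage _
  union := by
    rw [← Set.preimage_union, c.union, Set.preimage_compl, Set.range_comp,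
      f.image_symm_eq_preimage]
  cut := h

theorem map_comap (c : Cut R U) (h : ∀ x y, P.lt x y → f x ∈ c.B ∨ f y ∈ c.A) :
    (c.comap hf h).map hf = c :=
  Cut.ext (funext fun _ => f.apply_symm_apply _) (Set.image_preimage_eq _ f.surjective)
    (Set.image_preimage_eq _ f.surjective)

theorem map_face (c : Cut P V) (d : U ⟶ V) : (c.face d).map hf = (c.map hf).face d := by
  have key (s t) : f '' (c.emb '' s ∪ t) = (f ∘ c.emb) '' s ∪ f '' t := by
    rw [Set.image_union, Set.image_comp]
  exact Cut.ext rfl (key _ _) (key _ _)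

end Map

section Interface

/-- The cell of the track object in which exactly the events of the source interface are active
and no event is terminated. -/
structure IsSource (c : Cut R U) : Prop where
  A_eq : c.A = R.Sᶜ
  B_eq : c.B = ∅

/-- The cell of the track object in which exactly the events of the target interface are active
and no event is unstarted. -/
structure IsTarget (c : Cut R U) : Prop where
  A_eq : c.A = ∅
  B_eq : c.B = R.Tᶜ

theorem IsSource.range_emb {c : Cut R U} (h : c.IsSource) : Set.range c.emb = R.S := by
  rw [c.range_emb, h.A_eq, h.B_eq, Set.union_empty, compl_compl]

theorem IsTarget.range_emb {c : Cut R U} (h : c.IsTarget) : Set.range c.emb = R.T := by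
  rw [c.range_emb, h.A_eq, h.B_eq, Set.empty_union, compl_compl]

theorem IsSource.exists_comap {f : P.carrier ≃ R.carrier} (hf : IsSubsumption P R f)
    {c : Cut R U} (hc : c.IsSource) : ∃ a : Cut P U, a.IsSource ∧ a.map hf = c := by
  have hS : f ⁻¹' R.S = P.S := by rw [← hf.S, f.preimage_image]
  refine ⟨c.comap hf fun x y hlt => Or.inr ?_, ⟨?_, ?_⟩, map_comap hf _ _⟩
  · rw [hc.A_eq]
    exact fun hy => P.S_min y (hS.subset hy) x hlt
  · exact (congrArg (f ⁻¹' ·) hc.A_eq).trans (congrArg compl hS)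
  · exact (congrArg (f ⁻¹' ·) hc.B_eq).trans Set.preimage_empty

theorem IsTarget.exists_comap {f : P.carrier ≃ R.carrier} (hf : IsSubsumption P R f)
    {c : Cut R U} (hc : c.IsTarget) : ∃ b : Cut P U, b.IsTarget ∧ b.map hf = c := by
  have hT : f ⁻¹' R.T = P.T := by rw [← hf.T, f.preimage_image]
  refine ⟨c.comap hf fun x y hlt => Or.inl ?_, ⟨?_, ?_⟩, map_comap hf _ _⟩
  · rw [hc.B_eq]
    exact fun hx => P.T_max x (hT.subset hx) y hlt
  · exact (congrArg (f ⁻¹' ·) hc.A_eq).trans Set.preimage_empty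
  · exact (congrArg (f ⁻¹' ·) hc.B_eq).trans (congrArg compl hT)

variable {k : P.carrier → R.carrier} (hk : IsRefining k)
  (hev : ∀ p p', P.ev p p' → R.ev (k p) (k p'))

include hev in
theorem IsSource.exists_restrict_eq {a : Cut P U} (ha : a.IsSource) (hS : k '' P.S = R.S) :
    ∃ c : Cut R U, c.IsSource ∧ ∀ h, c.restrict hk h = a := by
  have hrange : Set.range (k ∘ a.emb) = R.S := by rw [Set.range_comp, ha.range_emb, hS]
  let c : Cut R U :=
    { emb := k ∘ a.emb
      A := R.Sᶜ
      B := ∅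
      inj := hk.inj.comp a.inj
      lab := fun i => (hk.lab _).trans (a.lab i)
      ev := fun i j h => hev _ _ (a.ev i j h)
      disj := Set.disjoint_empty _
      union := by rw [Set.union_empty, hrange]
      cut := fun x y h => Or.inr fun hy => R.S_min y hy x h }
  refine ⟨c, ⟨rfl, rfl⟩, fun h => Cut.ext (funext fun i => hk.inj (c.restrict_emb hk h i)) ?_ ?_⟩
  · rw [ha.A_eq, ← hk.inj.preimage_image P.S, hS]
    rfl
  · exact ha.B_eq.symm

include hev in
theorem IsTarget.exists_restrict_eq {b : Cut P U} (hb : b.IsTarget) (hT : k '' P.T = R.T) :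
    ∃ c : Cut R U, c.IsTarget ∧ ∀ h, c.restrict hk h = b := by
  have hrange : Set.range (k ∘ b.emb) = R.T := by rw [Set.range_comp, hb.range_emb, hT]
  let c : Cut R U :=
    { emb := k ∘ b.emb
      A := ∅
      B := R.Tᶜ
      inj := hk.inj.comp b.inj
      lab := fun i => (hk.lab _).trans (b.lab i)
      ev := fun i j h => hev _ _ (b.ev i j h)
      disj := Set.empty_disjoint _
      union := by rw [Set.empty_union, hrange]
      cut := fun x y h => Or.inl fun hx => R.T_max x hx y h }
  refine ⟨c, ⟨rfl, rfl⟩, fun h => Cut.ext (funext fun i => hk.inj (c.restrict_emb hk h i)) ?_ ?_⟩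
  · exact hb.A_eq.symm
  · rw [hb.B_eq, ← hk.inj.preimage_image P.T, hT]
    rfl

end Interface

end Cut

variable {X : (LoSet Alph)ᵒᵖ ⥤ Type u}

/-- Maps from the track object of `R` to a precubical set. -/
structure CutMap (R : Iposet Alph) (X : (LoSet Alph)ᵒᵖ ⥤ Type u) where
  app : ∀ {U : LoSet Alph}, Cut R U → X.obj (op U)
  face : ∀ {U V : LoSet Alph} (c : Cut R V) (d : U ⟶ V), app (c.face d) = X.map d.op (app c)

/-- There is a map from the track object of `R` to `X` that maps the cell of the source interface
to `x` and the cell of the target interface to `y`. -/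
def HasTrack (R : Iposet Alph) (x y : Cells X) : Prop :=
  ∃ φ : CutMap R X, (∃ a : Cut R x.1, a.IsSource ∧ φ.app a = x.2) ∧
    ∃ b : Cut R y.1, b.IsTarget ∧ φ.app b = y.2

theorem HasTrack.of_subsumption {P R : Iposet Alph} {f : P.carrier ≃ R.carrier}
    (hf : IsSubsumption P R f) {x y : Cells X} (h : HasTrack R x y) : HasTrack P x y := by
  obtain ⟨φ, ⟨c, hc, hx⟩, c', hc', hy⟩ := h
  obtain ⟨a, ha, rfl⟩ := hc.exists_comap hf
  obtain ⟨b, hb, rfl⟩ := hc'.exists_comap hf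
  exact ⟨⟨fun c => φ.app (c.map hf), fun c d => by rw [Cut.map_face, φ.face]⟩, ⟨a, ha, hx⟩,
    b, hb, hy⟩

end Iposet

namespace Iposet

variable {X : (LoSet Alph)ᵒᵖ ⥤ Type u}

section Sweep

variable {R : Iposet Alph} {B : Set R.carrier}

/-- The events that cannot start as long as no events outside `B` terminate. -/
def blocked (R : Iposet Alph) (B : Set R.carrier) : Set R.carrier :=
  {y | y ∉ B ∧ ∃ x ∉ B, R.lt x y}

theorem exists_lt_blocked (hR : R.IsInterval) (h : (R.blocked B).Nonempty) :
    ∃ m ∉ B, ∀ y ∈ R.blocked B, R.lt m y := by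
  have := R.finite
  obtain ⟨b, e, -, hlt⟩ := hR
  obtain ⟨-, -, x₀, hx₀, -⟩ := h
  obtain ⟨m, hm, hmin⟩ := (Set.toFinite Bᶜ).exists_minimalFor e _ ⟨x₀, hx₀⟩
  refine ⟨m, hm, ?_⟩
  rintro y ⟨-, x, hx, hxy⟩
  rw [hlt] at hxy ⊢
  rcases le_total (e m) (e x) with h | h
  · exact h.trans_lt hxy
  · exact (hmin hx h).trans_lt hxy

namespace Cut

variable {U V : LoSet Alph} (c : Cut R U)

theorem mem_blocked {x y : R.carrier} (h : R.lt x y) (hx : x ∉ c.B) : y ∈ R.blocked c.B :=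
  ⟨fun hy => Set.disjoint_right.1 c.disj hy ((c.cut x y h).resolve_left hx), x, hx, h⟩

theorem blocked_subset : R.blocked c.B ⊆ c.A := by
  rintro y ⟨-, x, hx, h⟩
  exact (c.cut x y h).resolve_left hx

theorem exists_start : ∃ U₁, ∃ c₁ : Cut R U₁, c₁.A = R.blocked c.B ∧ c₁.B = c.B := by
  refine exists_of_disjoint (c.disj.mono_left c.blocked_subset) fun x y h => ?_
  by_cases hx : x ∈ c.B
  · exact Or.inl hx
  · exact Or.inr (c.mem_blocked h hx)

theorem exists_terminate : ∃ U₂, ∃ c₂ : Cut R U₂, c₂.A = R.blocked c.B ∧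
    c₂.B = c.B ∪ {x | ∀ y ∈ R.blocked c.B, R.lt x y} := by
  refine exists_of_disjoint (Set.disjoint_left.2 ?_) fun x y h => ?_
  · rintro x hx (h | h)
    · exact hx.1 h
    · exact R.lt_irrefl _ (h x hx)
  · by_cases hx : x ∈ c.B
    · exact Or.inl (Or.inl hx)
    · exact Or.inr (c.mem_blocked h hx)

end Cut

namespace CutMap

variable (φ : CutMap R X) {U V W : LoSet Alph}

/-- There is a path in `X` that executes `R` from the cell `c` of the track object to `b`. -/
def Reaches (c : Cut R U) (b : Cut R V) : Prop :=
  ∃ p : Path (𝟭 (LoSet Alph)) X ⟨U, φ.app c⟩ ⟨V, φ.app b⟩,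
    Tracks (𝟭 (LoSet Alph)) R True p c.Bᶜ c.emb b.Bᶜ b.emb

variable {φ} {c : Cut R U} {b : Cut R W}

theorem Reaches.refl : φ.Reaches b b :=
  ⟨.nil _, b.isStage True, rfl, rfl⟩

theorem Reaches.up {c₁ : Cut R V} (h : φ.Reaches c₁ b) (hA : c₁.A ⊆ c.A) (hB : c₁.B = c.B) :
    φ.Reaches c b := by
  obtain ⟨d, rfl⟩ := c₁.exists_eq_face c hA hB.le
  obtain ⟨p, hp⟩ := h
  exact ⟨.up (x := ⟨U, φ.app (c₁.face d)⟩) (y := ⟨V, φ.app c₁⟩) d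
    (c₁.B_eq_empty_of_face_B_eq d hB.symm) (φ.face c₁ d) p,
    (c₁.face d).isStage True, c₁.emb, rfl, hB ▸ hp⟩

theorem Reaches.down {c₂ : Cut R V} (h : φ.Reaches c₂ b) (hA : c₂.A = c.A) (hB : c.B ⊆ c₂.B)
    (hlt : ∀ x ∈ c₂.B, x ∉ c.B → ∀ y ∈ c.A, R.lt x y) : φ.Reaches c b := by
  obtain ⟨d, rfl⟩ := c.exists_eq_face c₂ hA.ge hB
  have hdA : d.A = ∅ := c.A_eq_empty_of_face_A_eq d hA
  have hdB : d.B = (Set.range d.emb)ᶜ := by rw [← d.union, hdA, Set.empty_union]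
  obtain ⟨p, hp⟩ := h
  refine ⟨.down (x := ⟨U, φ.app c⟩) (y := ⟨V, φ.app (c.face d)⟩) d hdA (φ.face c d) p,
    c.isStage True, fun i hi y hy hyr => ?_, ?_⟩
  · refine hlt _ ((c.emb_mem_face_B d).2 (hdB ▸ hi)) (c.emb_notMem_B i) y ?_
    by_contra hyA
    exact hyr (c.mem_range hyA hy)
  · exact c.compl_face_B d hdA ▸ hp

/-- Sweep along an interval representation: first start all events that are not blocked, then
terminate all events that precede all blocked ones. -/
theorem reaches_target (φ : CutMap R X) (hR : R.IsInterval) (hb : b.A = ∅) (c : Cut R U)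
    (hcb : c.B ⊆ b.B) : φ.Reaches c b := by
  have := R.finite
  induction hn : c.Bᶜ.ncard using Nat.strong_induction_on generalizing U c with
  | _ n ih =>
  obtain ⟨U₁, c₁, hA₁, hB₁⟩ := c.exists_start
  refine Reaches.up (c₁ := c₁) ?_ (hA₁ ▸ c.blocked_subset) hB₁
  rcases (R.blocked c.B).eq_empty_or_nonempty with hempty | hne
  · rw [hempty] at hA₁
    exact Reaches.refl.down (hb.trans hA₁.symm) (hB₁ ▸ hcb) fun _ _ _ y hy => by
      rw [hA₁] at hy
      exact hy.elim
  · obtain ⟨U₂, c₂, hA₂, hB₂⟩ := c.exists_terminate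
    obtain ⟨m, hm, hmlt⟩ := exists_lt_blocked hR hne
    have hsub : c₂.B ⊆ b.B := by
      obtain ⟨y, hy⟩ := hne
      rw [hB₂]
      refine Set.union_subset hcb fun x hx => (b.cut x y (hx y hy)).resolve_right ?_
      rw [hb]
      exact Set.notMem_empty y
    have hcard : c₂.Bᶜ.ncard < n := by
      rw [← hn, hB₂]
      exact Set.ncard_lt_ncard
        ⟨Set.compl_subset_compl.2 Set.subset_union_left, fun h => h hm (Or.inr hmlt)⟩
    refine (ih _ hcard c₂ hsub rfl).down (hA₂.trans hA₁.symm) ?_ fun x hx hxB => ?_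
    · rw [hB₁, hB₂]
      exact Set.subset_union_left
    · rw [hB₂] at hx
      rw [hA₁]
      exact hx.resolve_left (hB₁ ▸ hxB)

end CutMap

theorem HasTrack.exists_path (hR : R.IsInterval) {x y : Cells X} (h : HasTrack R x y) :
    ∃ p : Path (𝟭 (LoSet Alph)) X x y,
      pathEv (𝟭 (LoSet Alph)) p = (Quotient.mk _ R : Ipomset Alph) := by
  obtain ⟨U, x⟩ := x
  obtain ⟨V, y⟩ := y
  obtain ⟨φ, ⟨(a : R.Cut U), ha, (rfl : φ.app a = x)⟩, (b : R.Cut V), hb,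
    (rfl : φ.app b = y)⟩ := h
  obtain ⟨p, hp⟩ := φ.reaches_target hR hb.A_eq a (ha.B_eq ▸ Set.empty_subset _)
  rw [ha.B_eq, Set.compl_empty, hb.B_eq, compl_compl] at hp
  obtain ⟨g, hg, hs, ht⟩ := hp.exists_isSegment
  have hS : g '' (evAux _ p).1.S = R.S := by
    rw [← (evAux _ p).2.range_equiv, ← Set.range_comp, ← ha.range_emb]
    exact congrArg Set.range (funext hs)
  have hT : R.T ⊆ Set.range g := by
    rw [← hb.range_emb, ← funext ht]
    exact Set.range_comp_subset_range _ g
  obtain ⟨k, hk, hlt⟩ := hg.subsumed hS hT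
  have hiso : Isomorphic R (evAux _ p).1 := ⟨k, hk, hlt trivial⟩
  exact ⟨p, (Quotient.sound hiso).symm⟩

end Sweep

section Glue

variable {P Q : Iposet Alph} {f : Matching P Q} {U V W : LoSet Alph}

namespace Cut

/-- The cells of the track object of `P * Q` at which no event of `Q` outside its source interface
has started. -/
def IsLeft (c : Cut (glue f) W) : Prop := ∀ q ∉ Q.S, glueInr f q ∈ c.A

/-- The cells of the track object of `P * Q` at which all events of `P` outside its target
interface have terminated. -/
def IsRight (c : Cut (glue f) W) : Prop := ∀ p ∉ P.T, Sum.inl p ∈ c.B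

theorem isRight_of_not_isLeft {c : Cut (glue f) W} (h : ¬ c.IsLeft) : c.IsRight := by
  intro p hp
  simp only [IsLeft, not_forall] at h
  obtain ⟨q, hq, hqA⟩ := h
  exact (c.cut _ _ (.cross hp hq)).resolve_right hqA

theorem IsLeft.exists_inl_eq {c : Cut (glue f) W} (h : c.IsLeft) (i : Fin W.len) :
    ∃ p, Sum.inl p = c.emb i := by
  rcases hi : c.emb i with p | q
  · exact ⟨p, rfl⟩
  · have hq := h q.1 q.2
    rw [glueInr_not_mem f q.2] at hq
    exact absurd (hi ▸ hq) (c.emb_notMem_A i)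

theorem IsRight.exists_glueInr_eq {c : Cut (glue f) W} (h : c.IsRight) (i : Fin W.len) :
    ∃ q, glueInr f q = c.emb i := by
  rcases hi : c.emb i with p | q
  · by_cases hp : p ∈ P.T
    · exact ⟨_, glueInr_equiv f ⟨p, hp⟩⟩
    · exact absurd (hi ▸ h p hp) (c.emb_notMem_B i)
  · exact ⟨q.1, glueInr_not_mem f q.2⟩

/-- A left cell of the track object of `P * Q`, as a cell of the track object of `P`. -/
noncomputable def left (c : Cut (glue f) W) (h : c.IsLeft) : Cut P W :=
  c.restrict (isRefining_inl f) h.exists_inl_eq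

/-- A right cell of the track object of `P * Q`, as a cell of the track object of `Q`. -/
noncomputable def right (c : Cut (glue f) W) (h : c.IsRight) : Cut Q W :=
  c.restrict (isRefining_glueInr f) h.exists_glueInr_eq

theorem glueInr_emb_eq {b : Cut P U} {a : Cut Q U} (hb : b.IsTarget) (ha : a.IsSource)
    (f : Matching P Q) (i : Fin U.len) : glueInr f (a.emb i) = Sum.inl (b.emb i) := by
  have hbT : ∀ i, b.emb i ∈ P.T := fun i => hb.range_emb ▸ ⟨i, rfl⟩
  have hk : ∀ i, ∃ j, a.emb j = (f.equiv ⟨b.emb i, hbT i⟩).1 := fun i =>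
    ha.range_emb.symm.subset (f.equiv ⟨b.emb i, hbT i⟩).2
  choose k hk using hk
  have hmono : StrictMono k := fun i j hij => a.lt_of_ev (by
    rw [hk, hk]
    exact (f.ev_iff _ _).1 (b.ev i j hij))
  have hid : k = id := (hmono.range_inj strictMono_id).1 (by
    rw [Set.range_id, Set.range_eq_univ]
    exact Finite.surjective_of_injective hmono.injective)
  have hi := hk i
  rw [hid, id] at hi
  rw [hi, glueInr_equiv]

theorem exists_left_eq_face_right_eq_face {b : Cut P U} {a : Cut Q U} (hb : b.IsTarget)
    (ha : a.IsSource) (c : Cut (glue f) W) (hl : c.IsLeft) (hr : c.IsRight) :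
    ∃ d : W ⟶ U, c.left hl = b.face d ∧ c.right hr = a.face d := by
  have hf := glueInr_emb_eq hb ha f
  obtain ⟨d, hd⟩ := b.exists_eq_face (c.left hl) (hb.A_eq ▸ Set.empty_subset _)
    (hb.B_eq ▸ fun p hp => hr p hp)
  obtain ⟨d', hd'⟩ := a.exists_eq_face (c.right hr) (ha.A_eq ▸ fun q hq => hl q hq)
    (ha.B_eq ▸ Set.empty_subset _)
  suffices h : d = d' from ⟨d, hd, h ▸ hd'⟩
  refine LoSet.Hom.ext (RelEmbedding.ext fun i => a.inj (glueInr_injective f ?_)) ?_ ?_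
  · have hl' : (Sum.inl ((b.face d).emb i) : (glue f).carrier) = c.emb i :=
      hd ▸ c.restrict_emb (isRefining_inl f) hl.exists_inl_eq i
    have hr' : glueInr f ((a.face d').emb i) = c.emb i :=
      hd' ▸ c.restrict_emb (isRefining_glueInr f) hr.exists_glueInr_eq i
    exact (hf (d.emb i)).trans (hl'.trans hr'.symm)
  · ext i
    rw [← b.emb_mem_face_A, ← a.emb_mem_face_A, ← hd, ← hd']
    exact iff_of_eq (congrArg (· ∈ c.A) (hf i).symm)
  · ext i
    rw [← b.emb_mem_face_B, ← a.emb_mem_face_B, ← hd, ← hd']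
    exact iff_of_eq (congrArg (· ∈ c.B) (hf i).symm)

end Cut

section GlueMap

variable {φ : CutMap P X} {ψ : CutMap Q X} {b : Cut P U} {a : Cut Q U}

theorem app_left_eq_app_right (hb : b.IsTarget) (ha : a.IsSource) (h : φ.app b = ψ.app a)
    (c : Cut (glue f) W) (hl : c.IsLeft) (hr : c.IsRight) :
    φ.app (c.left hl) = ψ.app (c.right hr) := by
  obtain ⟨d, hd, hd'⟩ := Cut.exists_left_eq_face_right_eq_face hb ha c hl hr
  rw [hd, hd', φ.face, ψ.face, h]

theorem exists_glue_cutMap (hb : b.IsTarget) (ha : a.IsSource) (h : φ.app b = ψ.app a) :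
    ∃ χ : CutMap (glue f) X,
      (∀ {W} (c : Cut (glue f) W) (hc : c.IsLeft), χ.app c = φ.app (c.left hc)) ∧
      ∀ {W} (c : Cut (glue f) W) (hc : c.IsRight), χ.app c = ψ.app (c.right hc) := by
  classical
  let app {W : LoSet Alph} (c : Cut (glue f) W) : X.obj (op W) :=
    if hc : c.IsLeft then φ.app (c.left hc)
    else ψ.app (c.right (Cut.isRight_of_not_isLeft hc))
  have app_left {W} (c : Cut (glue f) W) (hc : c.IsLeft) : app c = φ.app (c.left hc) := dif_pos hc
  have app_right {W} (c : Cut (glue f) W) (hc : c.IsRight) : app c = ψ.app (c.right hc) := by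
    by_cases hc' : c.IsLeft
    · rw [app_left c hc', app_left_eq_app_right hb ha h]
    · exact dif_neg hc'
  refine ⟨⟨app, fun c d => ?_⟩, app_left, app_right⟩
  by_cases hc : c.IsLeft
  · have hc' : (c.face d).IsLeft := fun q hq => Or.inr (hc q hq)
    rw [app_left c hc, app_left _ hc', ← φ.face]
    exact congrArg φ.app (c.restrict_face _ hc.exists_inl_eq d)
  · have hr := Cut.isRight_of_not_isLeft hc
    have hr' : (c.face d).IsRight := fun p hp => Or.inr (hr p hp)
    rw [app_right c hr, app_right _ hr', ← ψ.face]
    exact congrArg ψ.app (c.restrict_face _ hr.exists_glueInr_eq d)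

end GlueMap

theorem Cut.IsSource.isLeft {c : Cut (glue f) W} (h : c.IsSource) : c.IsLeft := by
  rintro q hq
  rw [h.A_eq]
  rintro ⟨p, -, hp⟩
  rw [glueInr_not_mem f hq] at hp
  cases hp

theorem Cut.IsTarget.isRight {c : Cut (glue f) W} (h : c.IsTarget) : c.IsRight := by
  intro p hp
  rw [h.B_eq]
  exact inl_notMem_glue_T f hp

theorem HasTrack.glue {x y z : Cells X} (hP : HasTrack P x y) (hQ : HasTrack Q y z)
    (f : Matching P Q) : HasTrack (Iposet.glue f) x z := by
  obtain ⟨φ, ⟨a, ha, hx⟩, b, hb, hy⟩ := hP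
  obtain ⟨ψ, ⟨a', ha', hy'⟩, b', hb', hz⟩ := hQ
  obtain ⟨χ, hχφ, hχψ⟩ := exists_glue_cutMap (f := f) hb ha' (hy.trans hy'.symm)
  obtain ⟨c, hc, hca⟩ := ha.exists_restrict_eq (isRefining_inl f) (fun _ _ h => .single (.left h))
    rfl
  obtain ⟨c', hc', hcb⟩ := hb'.exists_restrict_eq (isRefining_glueInr f)
    (fun _ _ h => .single (.right h)) rfl
  refine ⟨χ, ⟨c, hc, ?_⟩, c', hc', ?_⟩
  · rw [hχφ c hc.isLeft, ← hx]
    exact congrArg φ.app (hca _)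
  · rw [hχψ c' hc'.isRight, ← hz]
    exact congrArg ψ.app (hcb _)

end Glue

section Cube

variable {V : LoSet Alph} {S T : Set (Fin V.len)}

/-- A cell of the track object of a discrete iposet, as a coface map. -/
def Cut.toHom {U : LoSet Alph} (c : Cut (ofILoSet ⟨V, S, T⟩) U) : U ⟶ V where
  emb := OrderEmbedding.ofStrictMono c.emb c.ev
  A := c.A
  B := c.B
  lab_emb := c.lab
  disj := c.disj
  union := c.union

/-- A coface map, as a cell of the track object of a discrete iposet. -/
def Cut.ofHom {U : LoSet Alph} (d : U ⟶ V) : Cut (ofILoSet ⟨V, S, T⟩) U where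
  emb := d.emb
  A := d.A
  B := d.B
  inj := d.emb.injective
  lab := d.lab_emb
  ev _ _ h := d.emb.lt_iff_lt.2 h
  disj := d.disj
  union := d.union
  cut _ _ h := h.elim

/-- The map from the track object of a discrete iposet given by a cell. -/
def cubeMap (S T : Set (Fin V.len)) (x : X.obj (op V)) : CutMap (ofILoSet ⟨V, S, T⟩) X where
  app c := X.map c.toHom.op x
  face c d := by
    rw [← Functor.map_comp_apply]
    rfl

theorem cubeMap_ofHom_id (x : X.obj (op V)) : (cubeMap S T x).app (Cut.ofHom (𝟙 V)) = x :=
  Functor.map_id_apply X (op V) x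

theorem hasTrack_upIposet {x y : Cells X} (d : x.1 ⟶ y.1) (hd : d.B = ∅)
    (hx : x.2 = X.map d.op y.2) : HasTrack (upIposet d) x y := by
  refine ⟨cubeMap _ _ y.2, ⟨Cut.ofHom d, ⟨?_, hd⟩, hx.symm⟩, Cut.ofHom (𝟙 _),
    ⟨rfl, Set.compl_univ.symm⟩, cubeMap_ofHom_id _⟩
  exact (Set.union_empty _).symm.trans (hd ▸ d.union)

theorem hasTrack_downIposet {x y : Cells X} (d : y.1 ⟶ x.1) (hd : d.A = ∅)
    (hy : y.2 = X.map d.op x.2) : HasTrack (downIposet d) x y := by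
  refine ⟨cubeMap _ _ x.2, ⟨Cut.ofHom (𝟙 _), ⟨Set.compl_univ.symm, rfl⟩, cubeMap_ofHom_id _⟩,
    Cut.ofHom d, ⟨hd, ?_⟩, hy.symm⟩
  exact (Set.empty_union _).symm.trans (hd ▸ d.union)

end Cube

theorem hasTrack_evAux {x y : Cells X} (p : Path (𝟭 (LoSet Alph)) X x y) :
    HasTrack (evAux _ p).1 x y := by
  induction p with
  | nil x =>
    exact ⟨cubeMap _ _ x.2, ⟨Cut.ofHom (𝟙 _), ⟨Set.compl_univ.symm, rfl⟩, cubeMap_ofHom_id _⟩,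
      Cut.ofHom (𝟙 _), ⟨rfl, Set.compl_univ.symm⟩, cubeMap_ofHom_id _⟩
  | up d hd hx p ih => exact (hasTrack_upIposet d hd hx).glue ih (upMatching d (evAux _ p).2)
  | down d hd hy p ih => exact (hasTrack_downIposet d hd hy).glue ih (downMatching d (evAux _ p).2)

theorem HasTrack.of_path {P : Iposet Alph} {x y : Cells X} (p : Path (𝟭 (LoSet Alph)) X x y)
    (hp : pathEv (𝟭 (LoSet Alph)) p = (Quotient.mk _ P : Ipomset Alph)) : HasTrack P x y := by
  obtain ⟨f, hf, -⟩ := Iposet.Isomorphic.symm (Quotient.exact hp)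
  exact (hasTrack_evAux p).of_subsumption hf

end Iposet

namespace LoSet.Hom

variable {U V W : LoSet Alph} (d : V ⟶ W) (i : Fin V.len)

theorem emb_notMem_A_union_B : d.emb i ∉ d.A ∪ d.B := by
  rw [d.union, Set.notMem_compl_iff]
  exact ⟨i, rfl⟩

theorem emb_notMem_A : d.emb i ∉ d.A := fun h => emb_notMem_A_union_B d i (Or.inl h)

theorem emb_notMem_B : d.emb i ∉ d.B := fun h => emb_notMem_A_union_B d i (Or.inr h)

variable {d}

theorem mem_range_of_notMem {i : Fin W.len} (hA : i ∉ d.A) (hB : i ∉ d.B) :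
    i ∈ Set.range d.emb := by
  rw [← Set.notMem_compl_iff, ← d.union]
  exact fun h => h.elim hA hB

theorem compl_range_emb_of_A_eq_empty (h : d.A = ∅) : (Set.range d.emb)ᶜ = d.B := by
  rw [← d.union, h, Set.empty_union]

variable (g : U ⟶ V) (d)

theorem comp_A_of_A_eq_empty (h : d.A = ∅) : (g ≫ d).A = d.emb '' g.A :=
  (congrArg (d.emb '' g.A ∪ ·) h).trans (Set.union_empty _)

theorem comp_B_of_B_eq_empty (h : d.B = ∅) : (g ≫ d).B = d.emb '' g.B :=
  (congrArg (d.emb '' g.B ∪ ·) h).trans (Set.union_empty _)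

variable {g}

theorem comp_A_of_left_A_eq_empty (h : g.A = ∅) : (g ≫ d).A = d.A := by
  change d.emb '' g.A ∪ d.A = d.A
  rw [h, Set.image_empty, Set.empty_union]

theorem comp_B_of_left_B_eq_empty (h : g.B = ∅) : (g ≫ d).B = d.B := by
  change d.emb '' g.B ∪ d.B = d.B
  rw [h, Set.image_empty, Set.empty_union]

variable (g) {d}

theorem emb_mem_comp_A_iff : d.emb i ∈ (g ≫ d).A ↔ i ∈ g.A :=
  (or_iff_left (emb_notMem_A d i)).trans d.emb.injective.mem_set_image

theorem emb_mem_comp_B_iff : d.emb i ∈ (g ≫ d).B ↔ i ∈ g.B :=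
  (or_iff_left (emb_notMem_B d i)).trans d.emb.injective.mem_set_image

end LoSet.Hom

/-- An assignment of events of `R` to the events of `V` that are active or terminated in the face
along `d : W ⟶ V`. The events of `F` are not yet terminated, and `s` enumerates the active ones. -/
structure IsPartialStage (R : Iposet Alph) {W V : LoSet Alph} (d : W ⟶ V) (F : Set R.carrier)
    (s : Fin W.len → R.carrier) (r : {i // i ∉ d.A} → R.carrier) : Prop where
  emb : ∀ w, r ⟨d.emb w, LoSet.Hom.emb_notMem_A d w⟩ = s w
  isStage : R.IsStage False (fun i => V.lab i.1) Set.univ r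
  notMem : ∀ i, i.1 ∈ d.B → r i ∉ F
  lt : ∀ i, i.1 ∈ d.B → ∀ y ∈ F, y ∉ Set.range s → R.lt (r i) y

/-- Every assignment at the face along `d : W ⟶ V` extends to a stage at `V` that satisfies `Out`,
where the events unstarted in the face are started early and those terminated in the face are
terminated late. -/
def ExtendsTo (R : Iposet Alph) {W V : LoSet Alph} (d : W ⟶ V) (F : Set R.carrier)
    (s : Fin W.len → R.carrier) (Out : Set R.carrier → (Fin V.len → R.carrier) → Prop) : Prop :=
  ∀ r, IsPartialStage R d F s r → ∃ r' : Fin V.len → R.carrier, (∀ i, r' i.1 = r i) ∧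
    (∀ i ∈ d.A, r' i ∈ F ∧ r' i ∉ Set.range s) ∧ Out (F ∪ r' '' d.B) r'

section Extends

variable {R : Iposet Alph} {W W' V M : LoSet Alph} {F : Set R.carrier}
  {Out : Set R.carrier → (Fin V.len → R.carrier) → Prop}

theorem ExtendsTo.mono {Out' : Set R.carrier → (Fin V.len → R.carrier) → Prop} {d : W ⟶ V}
    {s : Fin W.len → R.carrier} (h : ExtendsTo R d F s Out) (hOut : ∀ F r, Out F r → Out' F r) :
    ExtendsTo R d F s Out' :=
  fun r hr => (h r hr).imp fun _ h => ⟨h.1, h.2.1, hOut _ _ h.2.2⟩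

theorem exists_common_extension {ι κ₁ κ₂ β : Type*} {a : κ₁ → ι} {b : κ₂ → ι} {f : κ₁ → β}
    {g : κ₂ → β} (ha : a.Injective) (hb : b.Injective) (hfg : ∀ k l, a k = b l → f k = g l)
    (hcover : ∀ i, i ∈ Set.range a ∨ i ∈ Set.range b) :
    ∃ t : ι → β, t ∘ a = f ∧ t ∘ b = g := by
  have (i : ι) : ∃ p, (∀ k, a k = i → p = f k) ∧ ∀ l, b l = i → p = g l := by
    rcases hcover i with ⟨k, rfl⟩ | ⟨l, rfl⟩
    · exact ⟨f k, fun k' h => congrArg f (ha h.symm), fun l h => hfg k l h.symm⟩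
    · exact ⟨g l, fun k h => (hfg k l h).symm, fun l' h => congrArg g (hb h.symm)⟩
  choose t htf htg using this
  exact ⟨t, funext fun k => htf _ k rfl, funext fun l => htg _ l rfl⟩

theorem IsPartialStage.comp_down {d : W ⟶ V} {D : W' ⟶ W} {s : Fin W.len → R.carrier}
    {r : {i // i ∉ d.A} → R.carrier} (hr : IsPartialStage R d F s r) (hD : D.A = ∅)
    (hlt : ∀ i ∉ Set.range D.emb, ∀ y ∈ F, y ∉ Set.range s → R.lt (s i) y)
    (hA : (D ≫ d).A = d.A) :
    IsPartialStage R (D ≫ d) (F \ s '' (Set.range D.emb)ᶜ) (s ∘ D.emb)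
      fun i => r ⟨i.1, hA ▸ i.2⟩ where
  emb w := hr.emb _
  isStage := hr.isStage.comp_emb (Subtype.orderEmbedding fun _ h => hA ▸ h) (fun _ => rfl)
    fun _ => trivial
  notMem := by
    rintro ⟨_, hi⟩ (⟨k, hk, rfl⟩ | hiB) hm
    · rw [hr.emb] at hm
      exact hm.2 ⟨k, LoSet.Hom.compl_range_emb_of_A_eq_empty hD ▸ hk, rfl⟩
    · exact hr.notMem _ hiB hm.1
  lt := by
    rintro ⟨_, hi⟩ (⟨k, hk, rfl⟩ | hiB) y hyF hyr
    all_goals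
      have hys : y ∉ Set.range s := by
        rintro ⟨w, rfl⟩
        exact hyF.2 ⟨w, fun ⟨v, hv⟩ => hyr ⟨v, congrArg s hv⟩, rfl⟩
    · rw [← LoSet.Hom.compl_range_emb_of_A_eq_empty hD] at hk
      rw [hr.emb]
      exact hlt k hk y hyF.1 hys
    · exact hr.lt _ hiB y hyF.1 hys

theorem ExtendsTo.of_down {d : W ⟶ V} {D : W' ⟶ W} {s : Fin W.len → R.carrier} (hD : D.A = ∅)
    (hs : R.IsStage False W.lab F s)
    (hlt : ∀ i ∉ Set.range D.emb, ∀ y ∈ F, y ∉ Set.range s → R.lt (s i) y)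
    (h : ExtendsTo R (D ≫ d) (F \ s '' (Set.range D.emb)ᶜ) (s ∘ D.emb) Out) :
    ExtendsTo R d F s Out := by
  intro r hr
  have hA := LoSet.Hom.comp_A_of_left_A_eq_empty d hD
  obtain ⟨r', hr', hstart, hout⟩ := h _ (hr.comp_down hD hlt hA)
  replace hr' : ∀ i, r' i.1 = r i := fun i => hr' ⟨i.1, hA.symm ▸ i.2⟩
  refine ⟨r', hr', fun i hi => ?_, ?_⟩
  · obtain ⟨⟨hF, hn⟩, hs'⟩ := hstart i (hA.symm ▸ hi)
    refine ⟨hF, ?_⟩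
    rintro ⟨w, hw⟩
    exact hn ⟨w, fun ⟨v, hv⟩ => hs' ⟨v, (congrArg s hv).trans hw⟩, hw⟩
  · have hrs : r' '' (d.emb '' D.B) = s '' D.B := by
      rw [← Set.image_comp]
      exact Set.image_congr fun k _ => (hr' ⟨_, LoSet.Hom.emb_notMem_A d k⟩).trans (hr.emb k)
    have hsub : s '' D.B ⊆ F := by
      rintro _ ⟨k, -, rfl⟩
      exact hs.mem k
    convert hout using 1
    change _ = _ ∪ r' '' (d.emb '' D.B ∪ d.B)
    rw [Set.image_union, hrs, LoSet.Hom.compl_range_emb_of_A_eq_empty hD, ← Set.union_assoc,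
      Set.sdiff_union_of_subset hsub]

theorem IsPartialStage.exists_of_up {d : W' ⟶ V} {g : W ⟶ W'} {s : Fin W'.len → R.carrier}
    {r : {i // i ∉ (g ≫ d).A} → R.carrier} (hr : IsPartialStage R (g ≫ d) F (s ∘ g.emb) r)
    (hg : g.B = ∅) (hs : R.IsStage False W'.lab F s) :
    ∃ r₁, IsPartialStage R d F s r₁ ∧ ∀ i, r₁ ⟨i.1, fun h => i.2 (Or.inr h)⟩ = r i := by
  have hB := LoSet.Hom.comp_B_of_left_B_eq_empty d hg
  have hBA (i) (hi : i ∈ d.B) : i ∉ (g ≫ d).A :=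
    Set.disjoint_right.1 (g ≫ d).disj (hB.symm ▸ hi)
  have hgA (w) (hw : d.emb w ∉ (g ≫ d).A) : ∃ v, g.emb v = w :=
    LoSet.Hom.mem_range_of_notMem (fun h => hw ((LoSet.Hom.emb_mem_comp_A_iff w g).2 h))
      (hg ▸ Set.notMem_empty w)
  let a : Fin W'.len ↪o {i // i ∉ d.A} := d.emb.codRestrict d.Aᶜ (LoSet.Hom.emb_notMem_A d)
  let b : {i // i ∉ (g ≫ d).A} ↪o {i // i ∉ d.A} :=
    Subtype.orderEmbedding fun i hi h => hi (Or.inr h)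
  have hcover (i : {i // i ∉ d.A}) : i ∈ Set.range a ∨ i.1 ∈ d.B :=
    or_iff_not_imp_right.2 fun hi =>
      (LoSet.Hom.mem_range_of_notMem i.2 hi).imp fun _ h => Subtype.ext h
  have hab (k l) (h : a k = b l) : d.emb k = l.1 := congrArg Subtype.val h
  have hlab : (fun i : {i // i ∉ d.A} => V.lab i.1) ∘ a = W'.lab := funext d.lab_emb
  obtain ⟨r₁, rfl, rfl⟩ := exists_common_extension (f := s) (g := r) a.injective b.injective
    (fun k l h => by
      obtain ⟨v, rfl⟩ := hgA k (hab k l h ▸ l.2)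
      exact (hr.emb v).symm.trans (congrArg r (Subtype.ext (hab _ l h))))
    fun i => (hcover i).imp_right fun hi => ⟨⟨i.1, hBA i.1 hi⟩, rfl⟩
  refine ⟨r₁, ⟨fun _ => rfl, ?_, fun i hi => hr.notMem ⟨i.1, hBA i.1 hi⟩ (hB.symm ▸ hi),
    fun i hi y hy hys => hr.lt ⟨i.1, hBA i.1 hi⟩ (hB.symm ▸ hi) y hy
      fun ⟨v, hv⟩ => hys ⟨g.emb v, hv⟩⟩, fun _ => rfl⟩
  refine .of_cover a b (hlab ▸ hs) hr.isStage
    (fun i => (hcover i).imp_right fun hi => ⟨⟨i.1, hBA i.1 hi⟩, rfl⟩) (fun l hl k => ?_)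
    fun _ => trivial
  by_cases hk : ∃ v, g.emb v = k
  · obtain ⟨v, rfl⟩ := hk
    exact Or.inl ⟨⟨_, LoSet.Hom.emb_notMem_A (g ≫ d) v⟩, rfl⟩
  · exact Or.inr (hr.lt l (hB.symm ▸ (hcover (b l)).resolve_left hl) _ (hs.mem k)
      fun ⟨v, hv⟩ => hk ⟨v, hs.inj hv⟩)

theorem ExtendsTo.of_up {d : W' ⟶ V} {g : W ⟶ W'} {s : Fin W'.len → R.carrier} (hg : g.B = ∅)
    (hs : R.IsStage False W'.lab F s) (h : ExtendsTo R d F s Out) :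
    ExtendsTo R (g ≫ d) F (s ∘ g.emb) Out := by
  intro r hr
  obtain ⟨r₁, hr₁, hr₁r⟩ := hr.exists_of_up hg hs
  obtain ⟨r', hr', hstart, hout⟩ := h r₁ hr₁
  refine ⟨r', fun i => (hr' ⟨i.1, _⟩).trans (hr₁r i), ?_,
    (LoSet.Hom.comp_B_of_left_B_eq_empty d hg).symm ▸ hout⟩
  rintro _ (⟨w, hw, rfl⟩ | hi)
  · rw [(hr' ⟨_, LoSet.Hom.emb_notMem_A d w⟩).trans (hr₁.emb w)]
    refine ⟨hs.mem w, ?_⟩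
    rintro ⟨v, hv⟩
    exact LoSet.Hom.emb_notMem_A g v (hs.inj hv ▸ hw)
  · exact ⟨(hstart _ hi).1, fun ⟨v, hv⟩ => (hstart _ hi).2 ⟨_, hv⟩⟩

theorem ExtendsTo.restrict {d : W ⟶ M} {e : M ⟶ V} {s : Fin W.len → R.carrier} (he : e.B = ∅)
    (h : ExtendsTo R (d ≫ e) F s Out) :
    ExtendsTo R d F s fun F r => ∃ r', Out F r' ∧ r = r' ∘ e.emb := by
  intro r hr
  have hmem (k) : e.emb k ∈ (d ≫ e).A ↔ k ∈ d.A := LoSet.Hom.emb_mem_comp_A_iff k d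
  have hex (i : {i // i ∉ (d ≫ e).A}) : ∃ k : {k // k ∉ d.A}, e.emb k.1 = i.1 := by
    obtain ⟨k, hk⟩ := LoSet.Hom.mem_range_of_notMem (fun h => i.2 (Or.inr h))
      (he ▸ Set.notMem_empty i.1)
    exact ⟨⟨k, fun h => i.2 (hk ▸ (hmem k).2 h)⟩, hk⟩
  choose φ hφ using hex
  let ψ : {i // i ∉ (d ≫ e).A} ↪o {k // k ∉ d.A} := OrderEmbedding.ofMapLEIff φ fun i j => by
    rw [← Subtype.coe_le_coe, ← e.emb.le_iff_le, hφ, hφ, Subtype.coe_le_coe]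
  have hφe (k) : φ ⟨e.emb k.1, fun h => k.2 ((hmem k.1).1 h)⟩ = k :=
    Subtype.ext (e.emb.injective (hφ _))
  have hB (i) (hi : i.1 ∈ (d ≫ e).B) : (φ i).1 ∈ d.B :=
    (LoSet.Hom.emb_mem_comp_B_iff _ d).1 ((hφ i).symm ▸ hi)
  obtain ⟨r', hr', hstart, hout⟩ := h (r ∘ ψ)
    { emb w := (congrArg r (hφe ⟨_, LoSet.Hom.emb_notMem_A d w⟩)).trans (hr.emb w)
      isStage := hr.isStage.comp_emb ψ
        (fun i => (e.lab_emb _).symm.trans (congrArg V.lab (hφ i))) fun _ => trivial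
      notMem i hi := hr.notMem _ (hB i hi)
      lt i hi := hr.lt _ (hB i hi) }
  refine ⟨r' ∘ e.emb, fun k => (hr' _).trans (congrArg r (hφe k)),
    fun k hk => hstart _ ((hmem k).2 hk), r', ?_, rfl⟩
  rwa [Set.image_comp, ← LoSet.Hom.comp_B_of_B_eq_empty e d he]

theorem IsPartialStage.of_comp {d : W ⟶ M} {e : M ⟶ V} {s : Fin W.len → R.carrier}
    {r : {i // i ∉ (d ≫ e).A} → R.carrier} (hr : IsPartialStage R (d ≫ e) F s r) :
    IsPartialStage R d F s
      fun k => r ⟨e.emb k.1, fun h => k.2 ((LoSet.Hom.emb_mem_comp_A_iff k.1 d).1 h)⟩ where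
  emb := hr.emb
  isStage := hr.isStage.comp_emb
    ((OrderEmbedding.subtype (· ∉ d.A)).trans e.emb |>.codRestrict (d ≫ e).Aᶜ
      fun k h => k.2 ((LoSet.Hom.emb_mem_comp_A_iff k.1 d).1 h))
    (fun k => e.lab_emb k.1) fun _ => trivial
  notMem k hk := hr.notMem _ ((LoSet.Hom.emb_mem_comp_B_iff k.1 d).2 hk)
  lt k hk := hr.lt _ ((LoSet.Hom.emb_mem_comp_B_iff k.1 d).2 hk)

section Comp

variable {d : W ⟶ M} {e : M ⟶ V} {s : Fin W.len → R.carrier} {t : Fin V.len → R.carrier}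

theorem IsPartialStage.isStage_of_comp
    (hr : IsPartialStage R (d ≫ e) F s fun i => t i.1) (he : e.A = ∅)
    (hq : R.IsStage False M.lab (F ∪ (t ∘ e.emb) '' d.B) (t ∘ e.emb))
    (hstart : ∀ k ∈ d.A, t (e.emb k) ∈ F ∧ t (e.emb k) ∉ Set.range s) :
    R.IsStage False V.lab (F ∪ t '' (d ≫ e).B) t := by
  have hcover (i) : i ∈ Set.range e.emb ∨ i ∈ e.B :=
    or_iff_not_imp_right.2 (LoSet.Hom.mem_range_of_notMem (he ▸ Set.notMem_empty i))
  have hBA (i) (hi : i ∈ e.B) : i ∉ (d ≫ e).A :=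
    Set.disjoint_right.1 (d ≫ e).disj (Or.inr hi)
  have hlab : V.lab ∘ e.emb = M.lab := funext e.lab_emb
  refine .of_cover e.emb (OrderEmbedding.subtype (· ∉ (d ≫ e).A)) (hlab ▸ hq) hr.isStage
    (fun i => (hcover i).imp_right fun hi => ⟨⟨i, hBA i hi⟩, rfl⟩) (fun l hl k => ?_) fun i => ?_
  · by_cases hk : k ∈ d.A
    · exact Or.inr (hr.lt l (Or.inr ((hcover _).resolve_left hl)) _ (hstart k hk).1
        (hstart k hk).2)
    · exact Or.inl ⟨⟨_, fun h => hk ((LoSet.Hom.emb_mem_comp_A_iff k d).1 h)⟩, rfl⟩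
  · rcases hcover i with ⟨k, rfl⟩ | hi
    · refine (hq.mem k).imp_right ?_
      rintro ⟨l, hl, hlk⟩
      exact ⟨_, Or.inl ⟨l, hl, rfl⟩, hlk⟩
    · exact Or.inr ⟨i, Or.inr hi, rfl⟩

theorem IsPartialStage.lt_of_mem_B (hr : IsPartialStage R (d ≫ e) F s fun i => t i.1) {i}
    (hi : i ∈ e.B) {y : R.carrier} (hy : y ∈ F ∪ t '' (d ≫ e).B) (hyt : y ∉ Set.range t) :
    R.lt (t i) y := by
  refine hr.lt ⟨i, Set.disjoint_right.1 (d ≫ e).disj (Or.inr hi)⟩ (Or.inr hi) y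
    (hy.resolve_right fun h => hyt (Set.image_subset_range _ _ h)) ?_
  rintro ⟨w, rfl⟩
  exact hyt ⟨_, hr.emb w⟩

theorem IsPartialStage.union_image_comp_B_sdiff (hr : IsPartialStage R (d ≫ e) F s fun i => t i.1)
    (ht : t.Injective) :
    (F ∪ t '' (d ≫ e).B) \ t '' e.B = F ∪ (t ∘ e.emb) '' d.B := by
  have hdisj : Disjoint (F ∪ (t ∘ e.emb) '' d.B) (t '' e.B) := by
    rw [Set.disjoint_right]
    rintro _ ⟨i, hi, rfl⟩ (h | ⟨k, -, hk⟩)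
    · exact hr.notMem ⟨i, Set.disjoint_right.1 (d ≫ e).disj (Or.inr hi)⟩ (Or.inr hi) h
    · exact LoSet.Hom.emb_notMem_B e k (ht hk ▸ hi)
  change (F ∪ t '' (e.emb '' d.B ∪ e.B)) \ t '' e.B = _
  rw [Set.image_union, ← Set.image_comp, ← Set.union_assoc, Set.union_sdiff_right,
    hdisj.sdiff_eq_left]

theorem ExtendsTo.comp {Out' : Set R.carrier → (Fin M.len → R.carrier) → Prop} (he : e.A = ∅)
    (hOut' : ∀ F q, Out' F q → R.IsStage False M.lab F q) (h : ExtendsTo R d F s Out') :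
    ExtendsTo R (d ≫ e) F s fun F t => R.IsStage False V.lab F t ∧
      (∀ i ∉ Set.range e.emb, ∀ y ∈ F, y ∉ Set.range t → R.lt (t i) y) ∧
      Out' (F \ t '' (Set.range e.emb)ᶜ) (t ∘ e.emb) := by
  intro r hr
  obtain ⟨q, hqr, hstart, hout⟩ := h _ hr.of_comp
  have hcover (i) (hi : i ∉ Set.range e.emb) : i ∈ e.B :=
    LoSet.Hom.compl_range_emb_of_A_eq_empty he ▸ hi
  obtain ⟨t, rfl, rfl⟩ := exists_common_extension (f := q) (g := r) e.emb.injective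
    Subtype.val_injective
    (fun k l hkl => (hqr ⟨k, fun h => l.2 (hkl ▸ Or.inl ⟨k, h, rfl⟩)⟩).trans
      (congrArg r (Subtype.ext hkl)))
    fun i => or_iff_not_imp_left.2 fun hi =>
      ⟨⟨i, Set.disjoint_right.1 (d ≫ e).disj (Or.inr (hcover i hi))⟩, rfl⟩
  have ht := hr.isStage_of_comp he (hOut' _ _ hout) hstart
  refine ⟨t, fun _ => rfl, ?_, ht, fun i hi y => hr.lt_of_mem_B (hcover i hi), ?_⟩
  · rw [LoSet.Hom.comp_A_of_A_eq_empty e d he]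
    rintro _ ⟨k, hk, rfl⟩
    exact hstart k hk
  · rwa [LoSet.Hom.compl_range_emb_of_A_eq_empty he, hr.union_image_comp_B_sdiff ht.inj]

end Comp

end Extends

section Closure

variable {X : (ILoSet Alph)ᵒᵖ ⥤ Type u}

/-- The face of the cell `[z; ∅, ∅]` of the closure along `d`. Every cell of the closure is of this
form, since `[z; A, B]` is the face of `[z; ∅, ∅]` along `d_{A,B}`. -/
noncomputable def closureFace {V : ILoSet Alph} {W : LoSet Alph} (z : X.obj (op V))
    (d : W ⟶ V.toLoSet) : (closurePresheaf X).obj (op W) :=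
  (closurePresheaf X).map d.op (closureCellOf z)

theorem closureFace_eq {V : ILoSet Alph} {W : LoSet Alph} (z : X.obj (op V)) (d : W ⟶ V.toLoSet)
    (f : Factor d) :
    closureFace z d = (⟨f.mid, X.map f.e.op z, f.d, f.hA, f.hB⟩ : ClosureCell X W) :=
  ClosureCell.face_eq (⟨V, z, 𝟙 V.toLoSet, Set.empty_subset _, Set.empty_subset _⟩ :
      ClosureCell X V.toLoSet) d
    ⟨f.mid, f.e, f.d, f.fac.trans (Category.comp_id d).symm, f.hA, f.hB⟩

theorem map_closureFace {V : ILoSet Alph} {W W' : LoSet Alph} (z : X.obj (op V))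
    (d : W ⟶ V.toLoSet) (g : W' ⟶ W) :
    (closurePresheaf X).map g.op (closureFace z d) = closureFace z (g ≫ d) := by
  rw [closureFace, closureFace, op_comp, Functor.map_comp_apply]

theorem closureFace_id {V : ILoSet Alph} (z : X.obj (op V)) :
    closureFace z (𝟙 V.toLoSet) = closureCellOf z := by
  rw [closureFace, op_id, Functor.map_id_apply]

theorem exists_eq_closureFace {W : LoSet Alph} (w : (closurePresheaf X).obj (op W)) :
    ∃ (V : ILoSet Alph) (z : X.obj (op V)) (d : W ⟶ V.toLoSet), d.A ⊆ V.S ∧ d.B ⊆ V.T ∧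
      w = closureFace z d := by
  obtain ⟨V, z, d, hA, hB⟩ := w
  refine ⟨V, z, d, hA, hB, ?_⟩
  rw [closureFace_eq z d ⟨V, 𝟙 V, d, Category.comp_id d, hA, hB⟩]
  simp only [op_id, Functor.map_id_apply]
  rfl

theorem closureFace_comp_toHom {V V' : ILoSet Alph} {W : LoSet Alph} (z : X.obj (op V))
    (q : V' ⟶ V) (c : W ⟶ V'.toLoSet) (hA : c.A ⊆ V'.S) (hB : c.B ⊆ V'.T) :
    closureFace z (c ≫ q.toHom) = closureFace (X.map q.op z) c := by
  rw [closureFace_eq z _ ⟨V', q, c, rfl, hA, hB⟩,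
    closureFace_eq _ c ⟨V', 𝟙 V', c, Category.comp_id c, hA, hB⟩]
  simp only [op_id, Functor.map_id_apply]
  rfl

theorem exists_common_face {V V' : ILoSet Alph} {W : LoSet Alph} {z : X.obj (op V)}
    {z' : X.obj (op V')} {d : W ⟶ V.toLoSet} {d' : W ⟶ V'.toLoSet}
    (h : closureFace z d = closureFace z' d') :
    ∃ (f : Factor d) (e' : f.mid ⟶ V'), f.d ≫ e'.toHom = d' ∧
      X.map f.e.op z = X.map e'.op z' := by
  rw [closureFace_eq z d (factor d), closureFace_eq z' d' (factor d')] at h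
  generalize factor d = f at h
  generalize factor d' = f' at h
  obtain ⟨M', e', c', hc', hA', hB'⟩ := f'
  injection h with hM hx hd
  dsimp only at hM
  subst hM
  obtain rfl := eq_of_heq hd
  exact ⟨f, e', hc', eq_of_heq hx⟩

/-- The cell `x` generates a cube of `X` that is closed under the up-steps. -/
structure IsFinalCube (x : Cells X) : Prop where
  inj : ∀ {W : ILoSet Alph} (e e' : W ⟶ x.1), X.map e.op x.2 = X.map e'.op x.2 → e = e'
  closed : ∀ {M V : ILoSet Alph} (e : M ⟶ V) (z : X.obj (op V)) (e' : M ⟶ x.1), e.B = ∅ →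
    X.map e.op z = X.map e'.op x.2 → ∃ q : V ⟶ x.1, z = X.map q.op x.2

theorem IHDA.isFinalCube {X : IHDA Alph} (hs : X.AcceptSimple) (hp : X.AcceptProper)
    {x : Cells X.cell} (hx : x ∈ X.accept) : IsFinalCube x where
  inj {W} e e' h := by
    have h1 := @hp.1 (op W) ⟨⟨x, hx⟩, e⟩ ⟨⟨x, hx⟩, e'⟩ h
    exact eq_of_heq (Sigma.mk.inj h1).2
  closed {M V} e z e' he h := by
    obtain ⟨⟨⟨c, hc⟩, q⟩, hq⟩ := hp.2 ⟨M, X.cell.map e'.op x.2⟩ ⟨V, z⟩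
      ⟨.up (x := ⟨M, X.cell.map e'.op x.2⟩) (y := ⟨V, z⟩) e he h.symm (.nil _)⟩
      ⟨⟨⟨x, hx⟩, e'⟩, rfl⟩
    obtain rfl : c = x := by
      obtain ⟨y, hy⟩ := hs
      rw [hy] at hc hx
      exact hc.trans hx.symm
    exact ⟨q, hq.symm⟩

theorem IsFinalCube.closureFace_injective {x : Cells X} (h : IsFinalCube x) {W : LoSet Alph} :
    Function.Injective fun d : W ⟶ x.1.toLoSet => closureFace x.2 d := by
  intro d d' hd
  obtain ⟨f, e', rfl, he⟩ := exists_common_face hd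
  rw [← h.inj f.e e' he, f.fac]

theorem IsFinalCube.exists_eq_closureFace_of_map {x : Cells X} (h : IsFinalCube x)
    {W W' : LoSet Alph} (g : W ⟶ W') (hg : g.B = ∅) (w : (closurePresheaf X).obj (op W'))
    (d : W ⟶ x.1.toLoSet) (hd : (closurePresheaf X).map g.op w = closureFace x.2 d) :
    ∃ d' : W' ⟶ x.1.toLoSet, w = closureFace x.2 d' := by
  obtain ⟨V, z, c, hA, hB, rfl⟩ := exists_eq_closureFace w
  rw [map_closureFace] at hd
  obtain ⟨f, e', -, he⟩ := exists_common_face hd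
  have hfB : f.e.B = ∅ := by
    rw [f.e_B, LoSet.Hom.comp_B_of_left_B_eq_empty c hg, Set.sdiff_eq_empty]
    exact hB
  obtain ⟨q, rfl⟩ := h.closed f.e z e' hfB he
  exact ⟨_, (closureFace_comp_toHom x.2 q c hA hB).symm⟩

end Closure

/-- There is a path from the cell `z` to the cell `y`, tracked by `R` from the stage `(F, r)` to a
stage that satisfies `K`. -/
def ReachesStage {C : Type u} [SmallCategory C] (G : C ⥤ LoSet Alph) {X : Cᵒᵖ ⥤ Type u}
    (R : Iposet Alph) (y : Cells X)
    (K : Set R.carrier → (Fin (G.obj y.1).len → R.carrier) → Prop) {V : C} (z : X.obj (op V))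
    (F : Set R.carrier) (r : Fin (G.obj V).len → R.carrier) : Prop :=
  ∃ (q : Path G X ⟨V, z⟩ y) (F' : Set R.carrier) (s' : Fin (G.obj y.1).len → R.carrier),
    Tracks G R False q F r F' s' ∧ K F' s'

section ReachesStage

variable {R : Iposet Alph}

theorem ReachesStage.isStage {C : Type u} [SmallCategory C] {G : C ⥤ LoSet Alph}
    {X : Cᵒᵖ ⥤ Type u} {y : Cells X}
    {K : Set R.carrier → (Fin (G.obj y.1).len → R.carrier) → Prop} {V : C} {z : X.obj (op V)}
    {F : Set R.carrier} {r : Fin (G.obj V).len → R.carrier} (h : ReachesStage G R y K z F r) :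
    R.IsStage False (G.obj V).lab F r :=
  let ⟨_, _, _, hq, _⟩ := h
  hq.isStage

theorem ReachesStage.map_trans {C : Type u} [SmallCategory C] {G : C ⥤ LoSet Alph}
    {X : Cᵒᵖ ⥤ Type u} {Z : (LoSet Alph)ᵒᵖ ⥤ Type u} (j : CellMap G X Z) {y : Cells X}
    {t : Cells Z} {K : Set R.carrier → (Fin t.1.len → R.carrier) → Prop} {V : C} {z : X.obj (op V)}
    {F : Set R.carrier} {r : Fin (G.obj V).len → R.carrier}
    (h : ReachesStage G R y (ReachesStage (𝟭 (LoSet Alph)) R t K (j.app _ y.2)) z F r) :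
    ReachesStage (𝟭 (LoSet Alph)) R t K (j.app _ z) F r := by
  obtain ⟨q, F₁, s₁, hq, p, F', s', hp, hK⟩ := h
  exact ⟨(j.path q).comp p, F', s', ((j.tracks_path q).2 hq).comp hp, hK⟩

variable {X : (ILoSet Alph)ᵒᵖ ⥤ Type u} {y : Cells X}
  {K : Set R.carrier → (Fin y.1.len → R.carrier) → Prop}

theorem ExtendsTo.reaches_of_common_face {W : LoSet Alph} {M V V' : ILoSet Alph}
    {z : X.obj (op V)} {z' : X.obj (op V')} {e : M ⟶ V} {e' : M ⟶ V'} {c : W ⟶ M.toLoSet}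
    {F : Set R.carrier} {s : Fin W.len → R.carrier} (he : e.A = ∅) (he' : e'.B = ∅)
    (hz : X.map e.op z = X.map e'.op z')
    (h : ExtendsTo R (c ≫ e'.toHom) F s (ReachesStage (forgetIface Alph) R y K z')) :
    ExtendsTo R (c ≫ e.toHom) F s (ReachesStage (forgetIface Alph) R y K z) := by
  have hstage (F) (r) :
      (∃ r', ReachesStage (forgetIface Alph) R y K z' F r' ∧ r = r' ∘ e'.emb) →
        R.IsStage False M.lab F r := by
    rintro ⟨r', hr', rfl⟩
    exact hr'.isStage.comp_emb e'.emb e'.lab_emb fun k => hr'.isStage.mem (e'.emb k)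
  refine ((h.restrict he').comp he hstage).mono ?_
  rintro F r ⟨hr, hlt, r', ⟨q, F', s', hq, hK⟩, hrr⟩
  exact ⟨.down (x := ⟨V, z⟩) (y := ⟨M, X.map e.op z⟩) e he rfl
    (.up (x := ⟨M, X.map e.op z⟩) (y := ⟨V', z'⟩) e' he' hz q), F', s',
    ⟨hr, hlt, hstage _ _ ⟨r', ⟨q, F', s', hq, hK⟩, hrr⟩, r', hrr, hq⟩, hK⟩

theorem ExtendsTo.reaches_of_closureFace_eq {W W' : LoSet Alph} {V V' : ILoSet Alph}
    {z : X.obj (op V)} {z' : X.obj (op V')} {d : W ⟶ V.toLoSet} {d' : W' ⟶ V'.toLoSet}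
    {g : W ⟶ W'} {F : Set R.carrier} {s : Fin W.len → R.carrier} (hd : d.A ⊆ V.S)
    (hd' : d'.B ⊆ V'.T) (hg : g.B = ∅) (hz : closureFace z d = closureFace z' (g ≫ d'))
    (h : ExtendsTo R (g ≫ d') F s (ReachesStage (forgetIface Alph) R y K z')) :
    ExtendsTo R d F s (ReachesStage (forgetIface Alph) R y K z) := by
  obtain ⟨f, e', hc, he⟩ := exists_common_face hz
  rw [← hc] at h
  rw [← f.fac]
  refine h.reaches_of_common_face ?_ ?_ he
  · rw [f.e_A, Set.sdiff_eq_empty]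
    exact hd
  · rw [(⟨f.mid, e', f.d, hc, f.hA, f.hB⟩ : Factor (g ≫ d')).e_B,
      LoSet.Hom.comp_B_of_left_B_eq_empty d' hg, Set.sdiff_eq_empty]
    exact hd'

end ReachesStage

section Lift

variable {X : (ILoSet Alph)ᵒᵖ ⥤ Type u} {Z : (LoSet Alph)ᵒᵖ ⥤ Type u}

/-- The lifting property of a path `α` that starts in the image of a map `j` from a closure: if `R`
tracks `α` to `(F', s')` and `α` starts in the image of `[z; A, B]`, then the first stage extends to
a stage of `z` that satisfies `Out`, in which the events in `A` are started and those in `B` are not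
terminated yet. -/
def Path.LiftsTo (j : CellMap (𝟭 (LoSet Alph)) (closurePresheaf X) Z) (R : Iposet Alph)
    {x t : Cells Z} (α : Path (𝟭 (LoSet Alph)) Z x t) (F' : Set R.carrier)
    (s' : Fin t.1.len → R.carrier)
    (Out : ∀ ⦃V : ILoSet Alph⦄, X.obj (op V) → Set R.carrier → (Fin V.len → R.carrier) → Prop) :
    Prop :=
  ∀ ⦃V : ILoSet Alph⦄ (z : X.obj (op V)) (d : x.1 ⟶ V.toLoSet), d.A ⊆ V.S →
    x.2 = j.app x.1 (closureFace z d) → ∀ F s,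
      Tracks (𝟭 (LoSet Alph)) R False α F s F' s' → ExtendsTo R d F s (Out z)

variable {j : CellMap (𝟭 (LoSet Alph)) (closurePresheaf X) Z} {R : Iposet Alph} {t : Cells Z}
  {F' : Set R.carrier} {s' : Fin t.1.len → R.carrier}

theorem Path.LiftsTo.mono
    {Out Out' : ∀ ⦃V : ILoSet Alph⦄, X.obj (op V) → Set R.carrier → (Fin V.len → R.carrier) → Prop}
    {x : Cells Z} {α : Path (𝟭 (LoSet Alph)) Z x t} (h : α.LiftsTo j R F' s' Out)
    (hOut : ∀ ⦃V⦄ (z : X.obj (op V)) F r, Out z F r → Out' z F r) : α.LiftsTo j R F' s' Out' :=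
  fun _ z d hA hx F s ht => (h z d hA hx F s ht).mono (hOut z)

theorem Path.liftsTo_of_exit {y : Cells X}
    {K : Set R.carrier → (Fin y.1.len → R.carrier) → Prop}
    (E : ∀ {x : Cells Z}, Path (𝟭 (LoSet Alph)) Z x t → Prop)
    (hexit : ∀ {x : Cells Z} (α : Path (𝟭 (LoSet Alph)) Z x t), E α →
      α.LiftsTo j R F' s' fun _ => ReachesStage (forgetIface Alph) R y K)
    (hnil : E (.nil t))
    (hup : ∀ {x x' : Cells Z} (g : x.1 ⟶ x'.1) (hg : g.B = ∅) (hx : x.2 = Z.map g.op x'.2)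
      (α : Path (𝟭 (LoSet Alph)) Z x' t) (w : (closurePresheaf X).obj (op x.1)),
      x.2 = j.app x.1 w → ¬ E (.up g hg hx α) →
      ∃ w' : (closurePresheaf X).obj (op x'.1), w = (closurePresheaf X).map g.op w' ∧
        x'.2 = j.app x'.1 w')
    {x : Cells Z} (α : Path (𝟭 (LoSet Alph)) Z x t) :
    α.LiftsTo j R F' s' fun _ => ReachesStage (forgetIface Alph) R y K := by
  induction α with
  | nil x => exact hexit _ hnil
  | @up x x' t g hg hxx α ih =>
    by_cases hE : E (.up g hg hxx α)
    · exact hexit _ hE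
    rintro V z d hA hx F _ ⟨-, s₁, rfl, ht⟩
    obtain ⟨w', hw, hx'⟩ := hup g hg hxx α _ hx hE
    obtain ⟨V', z', d', hA', hB', rfl⟩ := exists_eq_closureFace w'
    rw [map_closureFace] at hw
    refine .reaches_of_closureFace_eq hA hB' hg hw ?_
    exact (ih E hexit hnil hup z' d' hA' hx' F s₁ ht).of_up hg ht.isStage
  | @down x x' t D hD hxx α ih =>
    by_cases hE : E (.down D hD hxx α)
    · exact hexit _ hE
    rintro V z d hA hx F s ⟨hs, hlt, ht⟩
    refine ExtendsTo.of_down hD hs hlt (ih E hexit hnil hup z (D ≫ d) ?_ ?_ _ _ ht)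
    · exact (LoSet.Hom.comp_A_of_left_A_eq_empty d hD).trans_subset hA
    · rw [hxx, hx, ← map_closureFace]
      exact (j.naturality D _).symm

end Lift

/-- The identity map of a precubical set. -/
def CellMap.id (Z : (LoSet Alph)ᵒᵖ ⥤ Type u) : CellMap (𝟭 (LoSet Alph)) Z Z where
  app _ x := x
  naturality _ _ := rfl

/-- The composition of a morphism with a map of precubical sets. -/
def CellMap.comp {C : Type u} [SmallCategory C] {G : C ⥤ LoSet Alph} {X : Cᵒᵖ ⥤ Type u}
    {Y Z : (LoSet Alph)ᵒᵖ ⥤ Type u} (h : CellMap G X Y) (j : CellMap (𝟭 (LoSet Alph)) Y Z) :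
    CellMap G X Z where
  app U x := j.app _ (h.app U x)
  naturality d x := by rw [h.naturality]; exact j.naturality _ _

/-- The inclusion of an ipc-set in its closure. -/
noncomputable def closureMap (X : (ILoSet Alph)ᵒᵖ ⥤ Type u) :
    CellMap (forgetIface Alph) X (closurePresheaf X) where
  app _ x := closureCellOf x
  naturality {U _} d x := (closureFace_eq x ((forgetIface Alph).map d)
    ⟨U, d, 𝟙 _, Category.id_comp _, Set.empty_subset _, Set.empty_subset _⟩).symm

/-- The data of a sequential composition of `n + 1` iHDAs, in the notation of `seqComp`. -/
structure SeqData (Alph : Type u) (n : ℕ) where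
  X : Fin (n + 1) → IHDA Alph
  U : Fin n → LoSet Alph
  S : ∀ k, Set (Fin (U k).len)
  T : ∀ k, Set (Fin (U k).len)
  xacc : ∀ k : Fin n, (X k.castSucc).cell.obj (op ⟨U k, S k, Set.univ⟩)
  xst : ∀ k : Fin n, (X k.succ).cell.obj (op ⟨U k, Set.univ, T k⟩)

namespace SeqData

section Incl

variable {n : ℕ} (D : SeqData Alph n)

/-- The sequential composition. -/
noncomputable abbrev comp : HDA Alph := seqComp D.X D.U D.S D.T D.xacc D.xst

/-- The map from the closure of the `k`-th iHDA to the sequential composition. -/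
noncomputable def incl (k : Fin (n + 1)) :
    CellMap (𝟭 (LoSet Alph)) (closurePresheaf (D.X k).cell) D.comp.cell where
  app _ w := Quot.mk _ ⟨k, w⟩
  naturality _ _ := rfl

/-- The map from the first iHDA to the sequential composition. -/
noncomputable abbrev headMap : CellMap (forgetIface Alph) (D.X 0).cell D.comp.cell :=
  (closureMap _).comp (D.incl 0)

theorem incl_glue (k : Fin n) {W : LoSet Alph} (d : W ⟶ D.U k) :
    (D.incl k.castSucc).app W (closureFace (D.xacc k) d) =
      (D.incl k.succ).app W (closureFace (D.xst k) d) :=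
  Quot.sound (GlueStep.mk (X := fun k => (D.X k).closure.cell) (Y := fun k => yoneda.obj (D.U k))
    (f := fun k => yonedaEquiv.symm (closureCellOf (D.xst k)))
    (g := fun k => yonedaEquiv.symm (closureCellOf (D.xacc k))) (W := op W) k d)

end Incl

/-- The sequential composition of a single iHDA is its closure. -/
noncomputable def toClosure (D : SeqData Alph 0) :
    CellMap (𝟭 (LoSet Alph)) D.comp.cell (closurePresheaf (D.X 0).cell) where
  app W := Quot.lift (fun p => Fin.cases
    (motive := fun k => (closurePresheaf (D.X k).cell).obj (op W) →
      (closurePresheaf (D.X 0).cell).obj (op W)) id (fun k => k.elim0) p.1 p.2)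
    fun _ _ ⟨k, _⟩ => k.elim0
  naturality _ x := by
    obtain ⟨k, w⟩ := x
    obtain rfl : k = 0 := Fin.eq_zero k
    rfl

section Tail

variable {n : ℕ} (D : SeqData Alph (n + 1))

/-- The data of the sequential composition of all iHDAs but the first one. -/
abbrev tail : SeqData Alph n where
  X k := D.X k.succ
  U k := D.U k.succ
  S k := D.S k.succ
  T k := D.T k.succ
  xacc k := D.xacc k.succ
  xst k := D.xst k.succ

/-- The map from the sequential composition of all iHDAs but the first one. -/
noncomputable def tailMap : CellMap (𝟭 (LoSet Alph)) D.tail.comp.cell D.comp.cell where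
  app W := Quot.map (fun p => ⟨p.1.succ, p.2⟩) fun _ _ ⟨k, d⟩ =>
    GlueStep.mk (X := fun k => (D.X k).closure.cell) (Y := fun k => yoneda.obj (D.U k))
      (f := fun k => yonedaEquiv.symm (closureCellOf (D.xst k)))
      (g := fun k => yonedaEquiv.symm (closureCellOf (D.xacc k))) (W := op W) k.succ d
  naturality d x := by
    induction x using Quot.ind
    rfl

/-- The accept cell of the first iHDA along which the tail is glued. -/
abbrev headAcc : Cells (D.X 0).cell := ⟨⟨D.U 0, D.S 0, Set.univ⟩, D.xacc 0⟩

/-- The faces of the cell of the tail that is glued to the accept cell of the first iHDA. -/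
noncomputable def startFace {W : LoSet Alph} (d : W ⟶ D.U 0) : D.tail.comp.cell.obj (op W) :=
  (D.tail.incl 0).app W (closureFace (D.xst 0) d)

/-- The cell of the tail that is glued to the accept cell of the first iHDA. -/
noncomputable abbrev tailStart : Cells D.tail.comp.cell :=
  (D.tail.incl 0).cell ⟨D.U 0, closureCellOf (D.xst 0)⟩

theorem incl_closureFace_headAcc {W : LoSet Alph} (d : W ⟶ D.U 0) :
    (D.incl 0).app W (closureFace D.headAcc.2 d) = D.tailMap.app W (D.startFace d) :=
  D.incl_glue 0 d

theorem headMap_headAcc : D.headMap.app _ D.headAcc.2 = D.tailMap.app _ D.tailStart.2 := by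
  have h := D.incl_closureFace_headAcc (𝟙 (D.U 0))
  rw [startFace] at h
  exact (congrArg _ (closureFace_id D.headAcc.2).symm).trans
    (h.trans (congrArg (fun w => D.tailMap.app _ ((D.tail.incl 0).app _ w))
      (closureFace_id (D.xst 0))))

theorem exists_eq_incl_or_tailMap {W : LoSet Alph} (z : D.comp.cell.obj (op W)) :
    (∃ w, z = (D.incl 0).app W w) ∨ ∃ c, z = D.tailMap.app W c := by
  obtain ⟨k, w⟩ := z
  induction k using Fin.cases with
  | zero => exact Or.inl ⟨w, rfl⟩
  | succ k => exact Or.inr ⟨Quot.mk _ ⟨k, w⟩, rfl⟩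

open Classical in
/-- The cell of the tail that is identified with a given cell of the closure of the first iHDA, or
the given cell itself if it is not a face of the accept cell. -/
noncomputable def headNormalForm {W : LoSet Alph}
    (w : (closurePresheaf (D.X 0).cell).obj (op W)) :
    (closurePresheaf (D.X 0).cell).obj (op W) ⊕ D.tail.comp.cell.obj (op W) :=
  if h : ∃ d : W ⟶ D.U 0, w = closureFace D.headAcc.2 d then .inr (D.startFace h.choose) else .inl w

variable {D} (h0 : IsFinalCube D.headAcc)

include h0

theorem headNormalForm_closureFace_headAcc {W : LoSet Alph} (d : W ⟶ D.U 0) :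
    D.headNormalForm (closureFace D.headAcc.2 d) = .inr (D.startFace d) := by
  have h : ∃ d' : W ⟶ D.U 0, closureFace D.headAcc.2 d = closureFace D.headAcc.2 d' := ⟨d, rfl⟩
  rw [headNormalForm, dif_pos h, ← h0.closureFace_injective h.choose_spec]

theorem exists_normalForm (W : LoSet Alph) :
    ∃ nf : D.comp.cell.obj (op W) →
        (closurePresheaf (D.X 0).cell).obj (op W) ⊕ D.tail.comp.cell.obj (op W),
      (∀ w, nf ((D.incl 0).app W w) = D.headNormalForm w) ∧
      ∀ c, nf (D.tailMap.app W c) = .inr c := by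
  refine ⟨Quot.lift (fun p => Fin.cases
      (motive := fun k => (closurePresheaf (D.X k).cell).obj (op W) →
        (closurePresheaf (D.X 0).cell).obj (op W) ⊕ D.tail.comp.cell.obj (op W))
      (fun w => D.headNormalForm w) (fun k w => .inr (Quot.mk _ ⟨k, w⟩))
      p.1 p.2) ?_, fun _ => rfl, ?_⟩
  · rintro _ _ ⟨k, d⟩
    induction k using Fin.cases with
    | zero => exact headNormalForm_closureFace_headAcc h0 d
    | succ k => exact congrArg Sum.inr (D.tail.incl_glue k d)
  · rintro ⟨c⟩
    rfl

theorem tailMap_injective (W : LoSet Alph) : Function.Injective (D.tailMap.app W) := by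
  obtain ⟨nf, -, hnf⟩ := exists_normalForm h0 W
  intro c c' h
  exact Sum.inr_injective ((hnf c).symm.trans ((congrArg nf h).trans (hnf c')))

theorem exists_of_incl_eq_tailMap {W : LoSet Alph}
    {w : (closurePresheaf (D.X 0).cell).obj (op W)} {c : D.tail.comp.cell.obj (op W)}
    (h : (D.incl 0).app W w = D.tailMap.app W c) :
    ∃ d : W ⟶ D.U 0, w = closureFace D.headAcc.2 d ∧ c = D.startFace d := by
  obtain ⟨nf, hnf, hnf'⟩ := exists_normalForm h0 W
  have h := congrArg nf h
  rw [hnf, hnf'] at h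
  by_cases hw : ∃ d : W ⟶ D.U 0, w = closureFace D.headAcc.2 d
  · obtain ⟨d, rfl⟩ := hw
    rw [headNormalForm_closureFace_headAcc h0 d] at h
    exact ⟨d, rfl, (Sum.inr_injective h).symm⟩
  · rw [headNormalForm, dif_neg hw] at h
    cases h

theorem eq_or_exists_tailMap_of_incl_eq {W : LoSet Alph}
    {w w' : (closurePresheaf (D.X 0).cell).obj (op W)}
    (h : (D.incl 0).app W w = (D.incl 0).app W w') :
    w = w' ∨ ∃ c, (D.incl 0).app W w = D.tailMap.app W c := by
  obtain ⟨nf, hnf, -⟩ := exists_normalForm h0 W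
  have h' := congrArg nf h
  rw [hnf, hnf] at h'
  by_cases hw : ∃ d : W ⟶ D.U 0, w = closureFace D.headAcc.2 d
  · obtain ⟨d, rfl⟩ := hw
    exact Or.inr ⟨_, D.incl_closureFace_headAcc d⟩
  by_cases hw' : ∃ d : W ⟶ D.U 0, w' = closureFace D.headAcc.2 d
  · obtain ⟨d, rfl⟩ := hw'
    exact Or.inr ⟨_, h.trans (D.incl_closureFace_headAcc d)⟩
  rw [headNormalForm, dif_neg hw, headNormalForm, dif_neg hw'] at h'
  exact Or.inl (Sum.inl_injective h')

theorem exists_eq_tailMap_of_map_eq {W W' : LoSet Alph} {g : W ⟶ W'} (hg : g.B = ∅)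
    {z : D.comp.cell.obj (op W')} {c : D.tail.comp.cell.obj (op W)}
    (h : D.comp.cell.map g.op z = D.tailMap.app W c) : ∃ c', z = D.tailMap.app W' c' := by
  rcases D.exists_eq_incl_or_tailMap z with ⟨w, rfl⟩ | hz
  · obtain ⟨d, hd, -⟩ := exists_of_incl_eq_tailMap h0 (((D.incl 0).naturality g w).trans h)
    obtain ⟨d', rfl⟩ := h0.exists_eq_closureFace_of_map g hg w d hd
    exact ⟨_, D.incl_closureFace_headAcc d'⟩
  · exact hz

theorem reachesStage_of_tailMap {R : Iposet Alph} {x t : Cells D.comp.cell}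
    (α : Path (𝟭 (LoSet Alph)) D.comp.cell x t) {c : D.tail.comp.cell.obj (op x.1)}
    (hc : x.2 = D.tailMap.app x.1 c) {c' : D.tail.comp.cell.obj (op t.1)}
    (hc' : t.2 = D.tailMap.app t.1 c') {K : Set R.carrier → (Fin t.1.len → R.carrier) → Prop}
    {F F' : Set R.carrier} {s : Fin x.1.len → R.carrier} {s' : Fin t.1.len → R.carrier}
    (hα : Tracks (𝟭 (LoSet Alph)) R False α F s F' s') (hK : K F' s') :
    ReachesStage (𝟭 (LoSet Alph)) R ⟨t.1, c'⟩ K c F s := by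
  induction α generalizing F with
  | nil x =>
    obtain rfl : c = c' := tailMap_injective h0 _ (hc.symm.trans hc')
    exact ⟨.nil _, F', s', hα, hK⟩
  | @up x x' t g hg hx α ih =>
    obtain ⟨c₁, hc₁⟩ := exists_eq_tailMap_of_map_eq h0 hg (hx.symm.trans hc)
    have hcg : c = D.tail.comp.cell.map g.op c₁ := by
      apply tailMap_injective h0
      rw [← hc, hx, hc₁]
      exact (D.tailMap.naturality g c₁).symm
    obtain ⟨h, s₁, hs, hα⟩ := hα
    obtain ⟨p, F₁, s₂, hp, hK⟩ := ih hc₁ hc' hα hK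
    exact ⟨.up (x := ⟨x.1, c⟩) (y := ⟨x'.1, c₁⟩) g hg hcg p, F₁, s₂, ⟨h, s₁, hs, hp⟩, hK⟩
  | @down x x' t g hg hx α ih =>
    obtain ⟨h, hlt, hα⟩ := hα
    obtain ⟨p, F₁, s₂, hp, hK⟩ := ih (c := D.tail.comp.cell.map g.op c) (by
      rw [hx, hc]
      exact (D.tailMap.naturality g c).symm) hc' hα hK
    exact ⟨.down (x := ⟨x.1, c⟩) (y := ⟨x'.1, D.tail.comp.cell.map g.op c⟩) g hg rfl p, F₁, s₂,
      ⟨h, hlt, hp⟩, hK⟩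

theorem exists_eq_map_of_notMem_tailMap {W W' : LoSet Alph} {g : W ⟶ W'}
    {z : D.comp.cell.obj (op W')} {w : (closurePresheaf (D.X 0).cell).obj (op W)}
    (hz : D.comp.cell.map g.op z = (D.incl 0).app W w)
    (hw : ¬ ∃ c, (D.incl 0).app W w = D.tailMap.app W c) :
    ∃ w', w = (closurePresheaf (D.X 0).cell).map g.op w' ∧ z = (D.incl 0).app W' w' := by
  rcases D.exists_eq_incl_or_tailMap z with ⟨w', rfl⟩ | ⟨c, rfl⟩
  · refine ⟨w', ?_, rfl⟩
    exact (eq_or_exists_tailMap_of_incl_eq h0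
      (hz.symm.trans ((D.incl 0).naturality g w').symm)).resolve_right hw
  · exact (hw ⟨_, hz.symm.trans (D.tailMap.naturality g c).symm⟩).elim

end Tail

end SeqData

section Extends

variable {R : Iposet Alph} {V : LoSet Alph} {F : Set R.carrier} {s : Fin V.len → R.carrier}
  {Out : Set R.carrier → (Fin V.len → R.carrier) → Prop}

theorem extendsTo_id (h : Out F s) : ExtendsTo R (𝟙 V) F s Out := by
  refine fun r hr => ⟨s, fun i => (hr.emb i.1).symm, fun _ hi => hi.elim, ?_⟩
  rwa [show (𝟙 V : V ⟶ V).B = ∅ from rfl, Set.image_empty, Set.union_empty]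

theorem ExtendsTo.of_id (h : ExtendsTo R (𝟙 V) F s Out) (hs : R.IsStage False V.lab F s) :
    Out F s := by
  obtain ⟨r', hr', -, hout⟩ := h (fun i => s i.1)
    { emb := fun _ => rfl
      isStage := hs.comp_emb (OrderEmbedding.subtype _) (fun _ => rfl) fun _ => trivial
      notMem := fun _ hi => hi.elim
      lt := fun _ hi => hi.elim }
  obtain rfl : r' = s := funext fun i => hr' ⟨i, Set.notMem_empty i⟩
  rwa [show (𝟙 V : V ⟶ V).B = ∅ from rfl, Set.image_empty, Set.union_empty] at hout

end Extends

/-- Paths of length zero. -/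
def Path.IsNil {C : Type u} [SmallCategory C] {G : C ⥤ LoSet Alph} {X : Cᵒᵖ ⥤ Type u} :
    {x y : Cells X} → Path G X x y → Prop
  | _, _, .nil _ => True
  | _, _, .up .. => False
  | _, _, .down .. => False

theorem Path.liftsTo_closure {X : (ILoSet Alph)ᵒᵖ ⥤ Type u} {R : Iposet Alph} {y : Cells X}
    {x : Cells (closurePresheaf X)} (α : Path (𝟭 (LoSet Alph)) _ x ((closureMap X).cell y))
    {F' : Set R.carrier} {s' : Fin y.1.len → R.carrier} :
    α.LiftsTo (CellMap.id _) R F' s' fun _ =>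
      ReachesStage (forgetIface Alph) R y fun F s => F = F' ∧ s = s' := by
  refine Path.liftsTo_of_exit (fun α => α.IsNil) ?_ (by exact trivial)
    (fun _ _ h _ _ hw _ => ⟨_, hw.symm.trans h, rfl⟩) α
  rintro x (_ | _ | _) hα V z d hA hx F s ht
  · obtain ⟨hs, rfl, rfl⟩ := ht
    have hz : closureFace z d = closureFace y.2 (𝟙 y.1.toLoSet ≫ 𝟙 y.1.toLoSet) := by
      rw [Category.comp_id, closureFace_id]
      exact hx.symm
    refine .reaches_of_closureFace_eq (W := y.1.toLoSet) hA (Set.empty_subset _) rfl hz ?_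
    rw [Category.comp_id]
    exact extendsTo_id ⟨.nil _, _, _, ⟨hs, rfl, rfl⟩, rfl, rfl⟩
  · exact hα.elim
  · exact hα.elim

namespace SeqData

section Tail

variable {n : ℕ} {D : SeqData Alph (n + 1)}

theorem exists_eq_tailMap_of_mem_accept {t : Cells D.comp.cell} (ht : t ∈ D.comp.accept) :
    ∃ t' ∈ D.tail.comp.accept, t = D.tailMap.cell t' := by
  obtain ⟨x, hx, rfl⟩ := ht
  exact ⟨_, ⟨x, hx, rfl⟩, rfl⟩

theorem tailMap_mem_accept {t : Cells D.tail.comp.cell} (ht : t ∈ D.tail.comp.accept) :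
    D.tailMap.cell t ∈ D.comp.accept := by
  obtain ⟨x, hx, rfl⟩ := ht
  exact ⟨x, hx, rfl⟩

theorem liftsTo_head (h0 : IsFinalCube D.headAcc) {R : Iposet Alph} {t : Cells D.tail.comp.cell}
    {F' : Set R.carrier} {s' : Fin t.1.len → R.carrier}
    {K : Set R.carrier → (Fin t.1.len → R.carrier) → Prop} (hK : K F' s')
    (htail : ∀ {x : Cells D.tail.comp.cell} (p : Path (𝟭 (LoSet Alph)) D.tail.comp.cell x t),
      p.LiftsTo (D.tail.incl 0) R F' s' fun _ z =>
        ReachesStage (𝟭 (LoSet Alph)) R t K ((D.tail.incl 0).app _ (closureCellOf z)))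
    {x : Cells D.comp.cell} (α : Path (𝟭 (LoSet Alph)) D.comp.cell x (D.tailMap.cell t)) :
    α.LiftsTo (D.incl 0) R F' s' fun _ => ReachesStage (forgetIface Alph) R D.headAcc
      (ReachesStage (𝟭 (LoSet Alph)) R t K D.tailStart.2) := by
  refine Path.liftsTo_of_exit (fun {x} _ => ∃ c, x.2 = D.tailMap.app x.1 c) ?_ ⟨t.2, rfl⟩ ?_ α
  · rintro x α ⟨c, hc⟩ V z d hA hx F s ht
    obtain ⟨e, he, hce⟩ := exists_of_incl_eq_tailMap h0 (hx.symm.trans hc)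
    obtain ⟨p, _, _, hp, rfl, rfl⟩ := reachesStage_of_tailMap h0 α hc (c' := t.2) rfl
      (K := fun F s => F = F' ∧ s = s') ht ⟨rfl, rfl⟩
    rw [← Category.id_comp e] at he
    refine .reaches_of_closureFace_eq hA (Set.subset_univ _) rfl he ?_
    rw [Category.id_comp]
    exact (htail p (D.xst 0) e (Set.subset_univ _) hce F s hp).mono fun F r h =>
      ⟨.nil _, F, r, ⟨h.isStage, rfl, rfl⟩, h⟩
  · intro x x' g _ hxx _ w hw hE
    have hw' : ¬ ∃ c, (D.incl 0).app x.1 w = D.tailMap.app x.1 c := by rwa [← hw]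
    exact exists_eq_map_of_notMem_tailMap h0 (hxx.symm.trans hw) hw'

end Tail

theorem liftsTo_comp {n : ℕ} {D : SeqData Alph n}
    (hcube : ∀ k, IsFinalCube (X := (D.X k.castSucc).cell) ⟨_, D.xacc k⟩) {R : Iposet Alph}
    {x t : Cells D.comp.cell} (hacc : t ∈ D.comp.accept) {F' : Set R.carrier}
    {s' : Fin t.1.len → R.carrier} (α : Path (𝟭 (LoSet Alph)) D.comp.cell x t) :
    α.LiftsTo (D.incl 0) R F' s' fun _ z =>
      ReachesStage (𝟭 (LoSet Alph)) R t (fun F s => F = F' ∧ s = s')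
        ((D.incl 0).app _ (closureCellOf z)) := by
  induction n with
  | zero =>
    obtain ⟨_, ⟨y, -, rfl⟩, rfl⟩ := hacc
    intro V z d hA hx F s ht
    refine ((Path.liftsTo_closure (y := y) (D.toClosure.path α)) z d hA
      (congrArg (D.toClosure.app _) hx) F s ((D.toClosure.tracks_path α).2 ht)).mono ?_
    rintro F r ⟨q, F₁, s₁, hq, hK⟩
    exact ⟨D.headMap.path q, F₁, s₁, (D.headMap.tracks_path q).2 hq, hK⟩
  | succ n ih =>
    obtain ⟨t, hacc', rfl⟩ := exists_eq_tailMap_of_mem_accept hacc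
    refine (liftsTo_head (hcube 0) ⟨rfl, rfl⟩
      (ih (D := D.tail) (fun k => hcube k.succ) hacc') α).mono ?_
    intro V z F r h
    refine ReachesStage.map_trans D.headMap (y := D.headAcc) ?_
    rw [D.headMap_headAcc]
    obtain ⟨q, F₁, s₁, hq, p, F₂, s₂, hp, hK⟩ := h
    exact ⟨q, F₁, s₁, hq, D.tailMap.path p, F₂, s₂, (D.tailMap.tracks_path p).2 hp, hK⟩

end SeqData

section Closure

variable {X : (ILoSet Alph)ᵒᵖ ⥤ Type u}

theorem exists_eq_closureMap_cell {w : Cells (closurePresheaf X)}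
    (hA : (ClosureCell.d w.2).A = ∅) (hB : (ClosureCell.d w.2).B = ∅) :
    ∃ x, w = (closureMap X).cell x := by
  obtain ⟨⟨n, l⟩, ⟨⟨⟨m, l'⟩, S, T⟩, x, ⟨f, A, B, hl, hd, hu⟩, hA', hB'⟩⟩ := w
  obtain rfl : A = (∅ : Set (Fin m)) := hA
  obtain rfl : B = (∅ : Set (Fin m)) := hB
  have hsurj : Function.Surjective f := by
    rw [← Set.range_eq_univ, ← compl_compl (Set.range f), ← hu, Set.union_empty, Set.compl_empty]
  obtain rfl : n = m := by simpa using Fintype.card_of_bijective ⟨f.injective, hsurj⟩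
  obtain rfl : f = RelEmbedding.refl _ := by
    ext1 i
    exact congrFun ((StrictMono.range_inj f.strictMono strictMono_id).1
      (hsurj.range_eq.trans Set.range_id.symm)) i
  obtain rfl : l' = l := funext hl
  exact ⟨⟨⟨⟨n, l'⟩, S, T⟩, x⟩, rfl⟩

theorem exists_face_of_closureFace_eq {V V' : ILoSet Alph} {x : X.obj (op V)} {x' : X.obj (op V')}
    {g : V.toLoSet ⟶ V'.toLoSet} (h : closureFace x' g = closureCellOf x) :
    ∃ e : V ⟶ V', g = e.toHom ∧ x = X.map e.op x' := by
  rw [closureFace_eq x' g (factor g)] at h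
  generalize factor g = f at h
  obtain ⟨M, e, c, hc, hA, hB⟩ := f
  injection h with hM hx hd
  obtain rfl : M = V := hM
  obtain rfl := eq_of_heq hd
  exact ⟨e, hc.symm.trans (Category.id_comp _), (eq_of_heq hx).symm⟩

theorem closureMap_cell_injective : Function.Injective (closureMap X).cell := by
  rintro ⟨V, x⟩ ⟨V', x'⟩ h
  exact congrArg (fun c : Cells (closurePresheaf X) =>
    (⟨ClosureCell.base c.2, ClosureCell.x c.2⟩ : Cells X)) h

section Face

variable {W W' : LoSet Alph} {c : ClosureCell X W} {g : W' ⟶ W}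

theorem ClosureCell.d_A_eq_empty_of_face (h : (c.face g).d.A = ∅) : c.d.A = ∅ := by
  let f := factor (g ≫ c.d)
  have hf : (f.d ≫ f.e.toHom).A = f.e.A := LoSet.Hom.comp_A_of_left_A_eq_empty _ h
  rw [f.fac] at hf
  exact Set.eq_empty_of_forall_notMem fun i hi =>
    f.e.A_S.notMem_of_mem_left (hf ▸ Or.inr hi) (c.hA hi)

theorem ClosureCell.d_B_eq_empty_of_face (h : (c.face g).d.B = ∅) : c.d.B = ∅ := by
  let f := factor (g ≫ c.d)
  have hf : (f.d ≫ f.e.toHom).B = f.e.B := LoSet.Hom.comp_B_of_left_B_eq_empty _ h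
  rw [f.fac] at hf
  exact Set.eq_empty_of_forall_notMem fun i hi =>
    f.e.B_T.notMem_of_mem_left (hf ▸ Or.inr hi) (c.hB hi)

theorem ClosureCell.face_d_A_eq_empty (hg : g.A = ∅) (hc : c.d.A = ∅) : (c.face g).d.A = ∅ := by
  let f := factor (g ≫ c.d)
  have hf : (f.d ≫ f.e.toHom).A = ∅ := by
    rw [f.fac, LoSet.Hom.comp_A_of_left_A_eq_empty _ hg, hc]
  exact Set.image_eq_empty.1 (Set.union_empty_iff.1 hf).1

theorem ClosureCell.face_d_B_eq_empty (hg : g.B = ∅) (hc : c.d.B = ∅) : (c.face g).d.B = ∅ := by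
  let f := factor (g ≫ c.d)
  have hf : (f.d ≫ f.e.toHom).B = ∅ := by
    rw [f.fac, LoSet.Hom.comp_B_of_left_B_eq_empty _ hg, hc]
  exact Set.image_eq_empty.1 (Set.union_empty_iff.1 hf).1

end Face

theorem Path.d_B_eq_empty {w w' : Cells (closurePresheaf X)} (α : Path (𝟭 (LoSet Alph)) _ w w')
    (h : (ClosureCell.d w'.2).B = ∅) : (ClosureCell.d w.2).B = ∅ := by
  induction α with
  | nil => exact h
  | up g hg hx _ ih =>
    rw [hx]
    exact ClosureCell.face_d_B_eq_empty hg (ih h)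
  | down g _ hx _ ih =>
    replace ih := ih h
    rw [hx] at ih
    exact ClosureCell.d_B_eq_empty_of_face ih

theorem exists_path_heq_closureMap {w w' : Cells (closurePresheaf X)}
    (α : Path (𝟭 (LoSet Alph)) _ w w') {x y : Cells X} (hw : w = (closureMap X).cell x)
    (hw' : w' = (closureMap X).cell y) :
    ∃ q : Path (forgetIface Alph) X x y, HEq α ((closureMap X).path q) := by
  induction α generalizing x with
  | nil w =>
    obtain rfl := closureMap_cell_injective (hw.symm.trans hw')
    subst hw
    exact ⟨.nil x, HEq.rfl⟩
  | @up w w₁ w' g hg hx α ih =>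
    subst hw
    have hface : ClosureCell.face w₁.2 g = closureCellOf x.2 := hx.symm
    obtain ⟨x₁, rfl⟩ := exists_eq_closureMap_cell
      (ClosureCell.d_A_eq_empty_of_face (by rw [hface]; rfl))
      (α.d_B_eq_empty (by rw [hw']; rfl))
    obtain ⟨q, hq⟩ := ih rfl hw'
    subst hw'
    obtain rfl := eq_of_heq hq
    obtain ⟨e, rfl, he⟩ := exists_face_of_closureFace_eq hx.symm
    exact ⟨.up e hg he q, HEq.rfl⟩
  | @down w w₁ w' g hg hx α ih =>
    subst hw
    obtain ⟨x₁, rfl⟩ := exists_eq_closureMap_cell (w := w₁)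
      (by rw [hx]; exact ClosureCell.face_d_A_eq_empty hg rfl)
      (α.d_B_eq_empty (by rw [hw']; rfl))
    obtain ⟨q, hq⟩ := ih rfl hw'
    subst hw'
    obtain rfl := eq_of_heq hq
    obtain ⟨e, rfl, he⟩ := exists_face_of_closureFace_eq hx.symm
    exact ⟨.down e hg he q, HEq.rfl⟩

end Closure

theorem exists_isSubsumption_glue_matchingOfIso {R P Q : Iposet Alph} {V : LoSet Alph}
    (t : TgtIso V P) (s : SrcIso V Q) {strict : Prop} {g : P.carrier → R.carrier}
    {h : Q.carrier → R.carrier} {F : Set R.carrier} (hP : R.IsSegment strict P g Set.univ F)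
    (hQ : R.IsSegment strict Q h F R.T) (hgh : ∀ i, g (t.equiv i).1 = h (s.equiv i).1)
    (hS : g '' P.S = R.S) (hT : R.T ⊆ Set.range h) :
    ∃ k, Iposet.IsSubsumption R (Iposet.glue (matchingOfIso t s)) k := by
  have hmatch : ∀ p, g p.1 = h ((matchingOfIso t s).equiv p).1 := by
    intro p
    obtain ⟨i, rfl⟩ := t.equiv.surjective p
    refine (hgh i).trans (congrArg (fun j => h (s.equiv j).1) ?_)
    exact (t.equiv.symm_apply_apply i).symm
  obtain ⟨k, hk, -⟩ := (hP.glue hQ _ hmatch).subsumed ((Set.image_image ..).trans hS) <| by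
    refine hT.trans ?_
    rintro _ ⟨q, rfl⟩
    exact ⟨_, Iposet.glueElim_glueInr _ hmatch q⟩
  exact ⟨k, hk⟩

namespace SeqData

theorem comp_lang_of_zero (D : SeqData Alph 0) : D.comp.Lang = (D.X 0).Lang := by
  ext P
  constructor
  · rintro ⟨_, ⟨_, ⟨x, hx, rfl⟩, rfl⟩, _, ⟨_, ⟨y, hy, rfl⟩, rfl⟩, α, rfl⟩
    obtain ⟨q, hq⟩ := exists_path_heq_closureMap (D.toClosure.path α) (x := x) (y := y) rfl rfl
    exact ⟨x, hx, y, hy, q, ((closureMap _).pathEv_path q).symm.trans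
      ((congrArg _ (eq_of_heq hq).symm).trans (D.toClosure.pathEv_path α))⟩
  · rintro ⟨x, hx, y, hy, q, rfl⟩
    exact ⟨_, ⟨_, ⟨x, hx, rfl⟩, rfl⟩, _, ⟨_, ⟨y, hy, rfl⟩, rfl⟩, D.headMap.path q,
      D.headMap.pathEv_path q⟩

section Tail

variable {n : ℕ} {D : SeqData Alph (n + 1)}

theorem langMul_subset_comp_lang (hacc : (D.X 0).accept = {D.headAcc})
    (hst : (D.tail.X 0).start = {⟨_, D.xst 0⟩}) :
    langMul (D.X 0).Lang D.tail.comp.Lang ⊆ D.comp.Lang := by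
  rintro _ ⟨P, Q, R, f, ⟨x, hx, y, hy, p, hp⟩,
    ⟨_, ⟨_, ⟨x₀, hx₀, rfl⟩, rfl⟩, y', hy', p', hp'⟩, rfl, hR, _, hf⟩
  rw [hacc, Set.mem_singleton_iff] at hy
  have hx₀ : x₀ ∈ (D.tail.X 0).start := hx₀
  rw [hst, Set.mem_singleton_iff] at hx₀
  subst hy hx₀
  have hglue : D.headMap.cell D.headAcc = D.tailMap.cell D.tailStart :=
    congrArg (Sigma.mk (D.U 0)) D.headMap_headAcc
  have hP := Iposet.HasTrack.of_path (D.headMap.path p) ((D.headMap.pathEv_path p).trans hp)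
  have hQ := Iposet.HasTrack.of_path (D.tailMap.path p') ((D.tailMap.pathEv_path p').trans hp')
  obtain ⟨q, hq⟩ := ((Iposet.HasTrack.glue hP (hglue ▸ hQ) f).of_subsumption hf).exists_path hR
  exact ⟨_, ⟨_, ⟨x, hx, rfl⟩, rfl⟩, _, tailMap_mem_accept hy', q, hq⟩

theorem comp_lang_subset_langMul
    (hcube : ∀ k, IsFinalCube (X := (D.X k.castSucc).cell) ⟨_, D.xacc k⟩)
    (hacc : D.headAcc ∈ (D.X 0).accept) (hst : ⟨_, D.xst 0⟩ ∈ (D.tail.X 0).start) :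
    D.comp.Lang ⊆ langMul (D.X 0).Lang D.tail.comp.Lang := by
  rintro _ ⟨_, ⟨_, ⟨x, hx, rfl⟩, rfl⟩, t, ht, α, rfl⟩
  obtain ⟨t, ht', rfl⟩ := exists_eq_tailMap_of_mem_accept ht
  have hα := tracks_evAux α
  have hlift := liftsTo_head (hcube 0) ⟨rfl, rfl⟩
    (liftsTo_comp (D := D.tail) (fun k => hcube k.succ) ht') α x.2 (𝟙 _) (Set.empty_subset _)
    (congrArg ((D.incl 0).app _) (closureFace_id _).symm) _ _ hα
  obtain ⟨q, Fm, sm, hq, p, _, _, hp, rfl, rfl⟩ := hlift.of_id hα.isStage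
  obtain ⟨g, hg, hgs, hgt⟩ := hq.exists_isSegment
  obtain ⟨h, hh, hhs, hht⟩ := hp.exists_isSegment
  have hS : g '' (evAux _ q).1.S = (evAux _ α).1.S := by
    rw [← SrcIso.range_equiv (evAux _ q).2, ← SrcIso.range_equiv (evAux _ α).2, ← Set.range_comp]
    exact congrArg Set.range (funext hgs)
  have hT : (evAux _ α).1.T ⊆ Set.range h := fun r hr => by
    obtain ⟨i, hi⟩ := (evTgt _ α).equiv.surjective ⟨r, hr⟩
    exact ⟨_, (hht i).trans (congrArg Subtype.val hi)⟩
  obtain ⟨k, hk⟩ := exists_isSubsumption_glue_matchingOfIso (evTgt _ q) (evAux _ p).2 hg hh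
    (fun i => (hgt i).trans (hhs i).symm) hS hT
  exact ⟨_, _, _, _, ⟨x, hx, _, hacc, q, rfl⟩, ⟨_, ⟨_, ⟨_, hst, rfl⟩, rfl⟩, t, ht', p, rfl⟩, rfl,
    evAux_interval _ α, k, hk⟩

end Tail

theorem comp_lang {n : ℕ} (D : SeqData Alph n)
    (hcube : ∀ k, IsFinalCube (X := (D.X k.castSucc).cell) ⟨_, D.xacc k⟩)
    (hacc : ∀ k, (D.X k.castSucc).accept = {⟨_, D.xacc k⟩})
    (hst : ∀ k, (D.X k.succ).start = {⟨_, D.xst k⟩}) :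
    D.comp.Lang = langProd fun k => (D.X k).Lang := by
  induction n with
  | zero => exact D.comp_lang_of_zero
  | succ n ih =>
    have htail : langProd (fun k => (D.X k).Lang) = langMul (D.X 0).Lang D.tail.comp.Lang :=
      congrArg (langMul _)
        (ih D.tail (fun k => hcube k.succ) (fun k => hacc k.succ) fun k => hst k.succ).symm
    rw [htail]
    exact (comp_lang_subset_langMul hcube ((hacc 0).superset rfl) ((hst 0).superset rfl)).antisymm
      (langMul_subset_comp_lang (hacc 0) (hst 0))

end SeqData

end HDAGluing

theorem mainTheorem7_general {Alph : Type u} {n : ℕ} (X : Fin (n + 1) → HDAGluing.IHDA Alph)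
    (hacc : ∀ k : Fin n, (X k.castSucc).AcceptSimple ∧ (X k.castSucc).AcceptProper)
    (hst : ∀ k : Fin n, (X k.succ).StartSimple)
    (U : Fin n → HDAGluing.LoSet Alph) (S T : ∀ k, Set (Fin (U k).len))
    (xacc : ∀ k : Fin n, (X k.castSucc).cell.obj (op ⟨U k, S k, Set.univ⟩))
    (xst : ∀ k : Fin n, (X k.succ).cell.obj (op ⟨U k, Set.univ, T k⟩))
    (hxacc : ∀ k : Fin n, ⟨_, xacc k⟩ ∈ (X k.castSucc).accept)
    (hxst : ∀ k : Fin n, ⟨_, xst k⟩ ∈ (X k.succ).start) :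
    (HDAGluing.seqComp X U S T xacc xst).Lang = HDAGluing.langProd fun k => (X k).Lang :=
  HDAGluing.SeqData.comp_lang ⟨X, U, S, T, xacc, xst⟩
    (fun k => HDAGluing.IHDA.isFinalCube (hacc k).1 (hacc k).2 (hxacc k))
    (fun k => (Set.exists_eq_singleton_iff_nonempty_subsingleton.1
      (hacc k).1).2.eq_singleton_of_mem (hxacc k))
    (fun k => (Set.exists_eq_singleton_iff_nonempty_subsingleton.1
      (hst k)).2.eq_singleton_of_mem (hxst k))

theorem mainTheorem7 {Alph : Type u} {n : ℕ} (X : Fin (n + 1) → HDAGluing.IHDA Alph)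
    (h_first : (X 0).AcceptSimple ∧ (X 0).AcceptProper)
    (h_mid : ∀ k, k ≠ 0 → k ≠ Fin.last n → (X k).Simple ∧ (X k).Proper)
    (h_last : (X (Fin.last n)).StartSimple ∧ (X (Fin.last n)).StartProper)
    (U : Fin n → HDAGluing.LoSet Alph) (S T : ∀ k, Set (Fin (U k).len))
    (xacc : ∀ k : Fin n, (X k.castSucc).cell.obj (op ⟨U k, S k, Set.univ⟩))
    (xst : ∀ k : Fin n, (X k.succ).cell.obj (op ⟨U k, Set.univ, T k⟩))
    (hxacc : ∀ k : Fin n, ⟨_, xacc k⟩ ∈ (X k.castSucc).accept)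
    (hxst : ∀ k : Fin n, ⟨_, xst k⟩ ∈ (X k.succ).start) :
    (HDAGluing.seqComp X U S T xacc xst).Lang = HDAGluing.langProd fun k => (X k).Lang := by
  refine mainTheorem7_general X (fun k => ?_) (fun k => ?_) U S T xacc xst hxacc hxst
  · by_cases hk : k.castSucc = 0
    · rwa [hk]
    · obtain ⟨hsimple, hproper⟩ := h_mid k.castSucc hk (Fin.castSucc_lt_last k).ne
      exact ⟨hsimple.2, hproper.2.1⟩
  · by_cases hk : k.succ = Fin.last n
    · exact hk ▸ h_last.1
    · exact (h_mid k.succ (Fin.succ_ne_zero k) hk).1.1
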